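/- Lemma (cell-wise stabilisation). Let $d\ge 1$. Let $\mathcal V_{\mathrm d}$ and $\mathcal V_0$ be finite-dimensional spaces of polynomial vector fields, respectively polynomials, on $\mathbb R^d$, and let $k_u,k_p\in\{0,1,\dots\}$ be the largest integers with $[\mathbb P_{k_u}]^d\subset\mathcal V_{\mathrm d}$ and $\mathbb P_{k_p}\subset\mathcal V_0$. *Geometry.* Let $\Omega\subset\mathbb R^d$ be an open set covered by a finite conforming background mesh of closed convex polytopes with maximal cell diameter $h$ (two distinct cells meet in a common, possibly empty, face). The mesh is quasi-uniform and shape-regular with parameter $\rho>0$: each cell $T$ has $\operatorname{diam}T\ge\rho h$ and contains a ball of radius $\rho\operatorname{diam}T$, and each facet of $T$ contains a $(d-1)$-dimensional ball of that radius. (For simplices and parallelotopes the facet condition follows from the cell condition, up to the value of $\rho$.) The active cells $\mathcal T_h$ are those that intersect $\Omega$; an active cell is interior if its interior lies in $\Omega$, and cut otherwise. Let $\Omega_h$ be the interior of the union of the active cells and $\Omega_h^{\mathrm{cut}}$ the union of the cut cells. Each cut cell is assigned to exactly one interior cell, its root, to which it is joined by a chain of facet-adjacent cells of the same aggregate (the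 set of all active cells with the same root, the root being an interior cell and its own root). The aggregates have diameter at most $Kh$. Let $\Omega^{\mathrm{ext}}\supset\Omega_h$ be open. *Spaces.* Let $V_{\mathrm d,h}=\{v\in H(\mathrm{div},\Omega_h): v|_T\in\mathcal V_{\mathrm d}(T)\ \forall T\in\mathcal T_h\}$ and $V_{0,h}=\{q\in L^2(\Omega_h): q|_T\in\mathcal V_0(T)\ \forall T\in\mathcal T_h\}$, where $\mathcal V(T)$ denotes restriction to $T$. Let $\Pi_{\mathrm d,h}:[L^2(\Omega_h)]^d\to V_{\mathrm d,h}$ and $\Pi_{0,h}:L^2(\Omega_h)\to V_{0,h}$ be interpolators such that $\|u-\Pi_{\mathrm d,h}u\|_{L^2(\Omega_h)}\le c\,h^r\|u\|_{H^r(\Omega_h)}$ for $r=0,\dots,k_u+1$ and $\|p-\Pi_{0,h}p\|_{L^2(\Omega_h)}\le c\,h^t\|p\|_{H^t(\Omega_h)}$ for $t=0,\dots,k_p+1$. *Stabilisation.* For $*\in\{\mathrm d,0\}$ let $$s^*_h(u,v)=(u-\mathscr H^*_hu,\;v-\mathscr H^*_hv)_{L^2(\Omega_h^{\mathrm{cut}})},$$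 where, independently for $*=\mathrm d$ and $*=0$, $\mathscr H^*_h$ is one of the following two operators: the aggregate-wise extension (on each aggregate, $\mathscr H^*_hv$ is the polynomial in $\mathcal V_*$ that coincides with $v$ on the root cell), or the aggregate-wise $L^2$-projection (on each aggregate $A$, $\mathscr H^*_hv$ is the $L^2(A)$-orthogonal projection of $v|_A$ onto $\mathcal V_*(A)$). *Claim.* There is a constant $C>0$ that depends only on $d,\mathcal V_{\mathrm d},\mathcal V_0,\rho,K,c$ (in particular, neither on $h$ nor on how $\Omega$ cuts the mesh) such that: 1. (Norm equivalence.) For all $w_h\in V_{\mathrm d,h}$, $\;C^{-1}\|w_h\|^2_{L^2(\Omega_h)}\le\|w_h\|^2_{L^2(\Omega)}+s^{\mathrm d}_h(w_h,w_h)\le C\|w_h\|^2_{L^2(\Omega_h)}$, and for all $r_h\in V_{0,h}$, $\;C^{-1}\|r_h\|^2_{L^2(\Omega_h)}\le\|r_h\|^2_{L^2(\Omega)}+s^0_h(r_h,r_h)\le C\|r_h\|^2_{L^2(\Omega_h)}$. 2. (Weak consistency.) For all integers $0\le s\le k_u+1$ and $0\le t\le k_p+1$, all $w\in[H^s(\Omega^{\mathrm{ext}})]^d$,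 $r\in H^t(\Omega^{\mathrm{ext}})$, $v_h\in V_{\mathrm d,h}$ and $q_h\in V_{0,h}$, $\;s^{\mathrm d}_h(\Pi_{\mathrm d,h}w,v_h)\le C h^s\|w\|_{H^s(\Omega^{\mathrm{ext}})}\|v_h\|_{L^2(\Omega_h)}$ and $\;s^0_h(\Pi_{0,h}r,q_h)\le C h^t\|r\|_{H^t(\Omega^{\mathrm{ext}})}\|q_h\|_{L^2(\Omega_h)}$. 3. (Constants.) $s^0_h(a,q_h)=0$ for every constant $a$ and every $q_h\in V_{0,h}$. 4. (Kernel approximation.) Let $\mathcal K^p_h=\{q_h\in V_{0,h}: s^0_h(q_h,\phi_h)=0\ \forall\phi_h\in V_{0,h}\}$. For every integer $0\le t\le k_p+1$ and every $\tilde r\in H^t(\Omega^{\mathrm{ext}})$ there is $w_h\in\mathcal K^p_h$ with $\|\tilde r-w_h\|_{L^2(\Omega_h)}\le C h^t\|\tilde r\|_{H^t(\Omega^{\mathrm{ext}})}$. -/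

import Mathlib

open MeasureTheory
open scoped ContDiff RealInnerProductSpace

noncomputable section

namespace UnfittedFE

/-- The Euclidean space `ℝ^d`. -/
abbrev Pt (d : ℕ) : Type := EuclideanSpace ℝ (Fin d)

/-! ### Polynomial functions -/

/-- `ℙ_k`: real polynomial functions on `ℝ^d` of total degree at most `k`. -/
def polyScalar (d k : ℕ) : Submodule ℝ (Pt d → ℝ) where
  carrier := {f | ∃ p : MvPolynomial (Fin d) ℝ, p.totalDegree ≤ k ∧
    ∀ x, f x = MvPolynomial.eval (fun i => x i) p}
  zero_mem' := ⟨0, by simp, fun x => by simp⟩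
  add_mem' := by
    rintro f g ⟨p, hp, hf⟩ ⟨q, hq, hg⟩
    exact ⟨p + q, (MvPolynomial.totalDegree_add p q).trans (max_le hp hq),
      fun x => by simp [hf x, hg x]⟩
  smul_mem' := by
    rintro c f ⟨p, hp, hf⟩
    exact ⟨c • p, (MvPolynomial.totalDegree_smul_le c p).trans hp,
      fun x => by simp [hf x, MvPolynomial.smul_eval]⟩

/-- `[ℙ_k]^d`: vector fields on `ℝ^d` all of whose components lie in `ℙ_k`. -/
def polyVector (d k : ℕ) : Submodule ℝ (Pt d → Pt d) where
  carrier := {f | ∀ i, (fun x => f x i) ∈ polyScalar d k}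
  zero_mem' := fun _ => (polyScalar d k).zero_mem
  add_mem' := fun hf hg i => (polyScalar d k).add_mem (hf i) (hg i)
  smul_mem' := fun c _ hf i => (polyScalar d k).smul_mem c (hf i)

/-! ### Lebesgue and Sobolev spaces on an open set -/

section Sobolev

variable {d : ℕ} {F : Type*} [NormedAddCommGroup F] [InnerProductSpace ℝ F]

/-- `(u, v)_S`, the `L²` inner product over `S`. -/
def l2Inner (S : Set (Pt d)) (u v : Pt d → F) : ℝ := ∫ x in S, ⟪u x, v x⟫

/-- `‖u‖_{L²(S)}`. -/
def l2Norm (S : Set (Pt d)) (u : Pt d → F) : ℝ := √(∫ x in S, ‖u x‖ ^ 2)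

/-- `u ∈ L²(S)`. -/
def MemL2 (S : Set (Pt d)) (u : Pt d → F) : Prop := MemLp u 2 (volume.restrict S)

/-- `φ ∈ C_c^∞(U)`. -/
def IsTestFunction (U : Set (Pt d)) (φ : Pt d → ℝ) : Prop :=
  ContDiff ℝ ∞ φ ∧ HasCompactSupport φ ∧ tsupport φ ⊆ U

/-- `g` is the weak partial derivative `∂_{I 0} ⋯ ∂_{I (j-1)} u` of order `j` in `U`. -/
def IsWeakPartial (U : Set (Pt d)) (u : Pt d → F) {j : ℕ} (I : Fin j → Fin d)
    (g : Pt d → F) : Prop :=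
  ∀ φ : Pt d → ℝ, IsTestFunction U φ →
    ∫ x in U, iteratedFDeriv ℝ j φ x (fun l => EuclideanSpace.single (I l) (1 : ℝ)) • u x
      = (-1 : ℝ) ^ j • ∫ x in U, φ x • g x

/-- `u ∈ H^k(U)`: `u` and all its weak partial derivatives of order at most `k` lie in `L²(U)`. -/
def MemSobolev (k : ℕ) (U : Set (Pt d)) (u : Pt d → F) : Prop :=
  MemL2 U u ∧ ∀ j ≤ k, ∀ I : Fin j → Fin d, ∃ g, MemL2 U g ∧ IsWeakPartial U u I g

open Classical in
/-- The square-integrable weak partial derivative of `u` along `I` in `U` (unique up to null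
sets for open `U`), and `0` if there is none. -/
def weakPartial (U : Set (Pt d)) (u : Pt d → F) {j : ℕ} (I : Fin j → Fin d) : Pt d → F :=
  if h : ∃ g, MemL2 U g ∧ IsWeakPartial U u I g then h.choose else 0

/-- `‖u‖_{H^k(U)} = (∑_{j ≤ k} ‖D^j u‖²_{L²(U)})^{1/2}`, where `D^j u` is the tensor of all weak
partial derivatives of order `j`. -/
def sobolevNorm (k : ℕ) (U : Set (Pt d)) (u : Pt d → F) : ℝ :=
  √(∑ j ∈ Finset.range (k + 1), ∑ I : Fin j → Fin d, l2Norm U (weakPartial U u I) ^ 2)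

/-- `v ∈ H(div, U)`: `v ∈ L²(U)` and its weak divergence lies in `L²(U)`. -/
def MemHdiv (U : Set (Pt d)) (v : Pt d → Pt d) : Prop :=
  MemL2 U v ∧ ∃ g : Pt d → ℝ, MemL2 U g ∧ ∀ φ : Pt d → ℝ, IsTestFunction U φ →
    ∫ x in U, ⟪v x, gradient φ x⟫ = - ∫ x in U, g x * φ x

end Sobolev

/-! ### Meshes -/

/-- A mesh cell: a (closed, bounded) convex polytope with nonempty interior. -/
def IsCell {d : ℕ} (T : Set (Pt d)) : Prop :=
  (∃ s : Finset (Pt d), T = convexHull ℝ (s : Set (Pt d))) ∧ (interior T).Nonempty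

/-- `F` is a facet of `T`, i.e. a face of dimension `d - 1`. -/
def IsFacet {d : ℕ} (F T : Set (Pt d)) : Prop :=
  F.Nonempty ∧ IsExposed ℝ T F ∧ Module.finrank ℝ (vectorSpan ℝ F) + 1 = d

/-- Two cells which share a facet. -/
def FacetAdjacent {d : ℕ} (T T' : Set (Pt d)) : Prop :=
  IsFacet (T ∩ T') T ∧ IsFacet (T ∩ T') T'

/-- A physical domain `Ω` embedded in the domain covered by a conforming background mesh. -/
structure UnfittedMesh (d : ℕ) where
  /-- the physical domain `Ω` -/
  domain : Set (Pt d)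
  /-- the cells of the background mesh -/
  cells : Finset (Set (Pt d))
  isOpen_domain : IsOpen domain
  isCell : ∀ T ∈ cells, IsCell T
  /-- two distinct cells meet in a common (possibly empty) face -/
  conforming : ∀ T ∈ cells, ∀ T' ∈ cells, T ≠ T' →
    IsExposed ℝ T (T ∩ T') ∧ IsExposed ℝ T' (T ∩ T')
  domain_subset : domain ⊆ ⋃ T ∈ cells, T

namespace UnfittedMesh

variable {d : ℕ} (M : UnfittedMesh d)

/-- The mesh size `h`, the maximal diameter of a cell of the background mesh. -/
def meshSize : ℝ := sSup (Metric.diam '' (M.cells : Set (Set (Pt d))))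

open Classical in
/-- The active cells: those which intersect `Ω`. -/
def active : Finset (Set (Pt d)) := M.cells.filter fun T => (T ∩ M.domain).Nonempty

open Classical in
/-- The interior cells: the active cells which, as open sets, are contained in `Ω`. -/
def interiorCells : Finset (Set (Pt d)) := M.active.filter fun T => interior T ⊆ M.domain

open Classical in
/-- The cut cells: the active cells which are not interior. -/
def cutCells : Finset (Set (Pt d)) := M.active \ M.interiorCells

/-- The active domain `Ω_h`. -/
def activeDomain : Set (Pt d) := interior (closure (⋃ T ∈ M.active, T))

/-- `Ω_h^cut`, the union of the cut cells. -/
def cutDomain : Set (Pt d) := ⋃ T ∈ M.cutCells, T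

/-- Shape regularity and quasi-uniformity of the background mesh, with parameter `ρ`: every cell
contains a ball, and every facet a `(d-1)`-dimensional ball, of radius `ρ` times the diameter of
the cell (for simplices and parallelotopes, the condition on the cells implies, up to the value of
`ρ`, the one on the facets), and the diameters of all the cells are comparable. -/
structure IsRegular (ρ : ℝ) : Prop where
  cell_ball : ∀ T ∈ M.cells, ∃ x, Metric.closedBall x (ρ * Metric.diam T) ⊆ T
  facet_ball : ∀ T ∈ M.cells, ∀ F, IsFacet F T →
    ∃ x ∈ F, Metric.closedBall x (ρ * Metric.diam T) ∩ (affineSpan ℝ F : Set (Pt d)) ⊆ F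
  quasiUniform : ∀ T ∈ M.cells, ρ * M.meshSize ≤ Metric.diam T

/-- An aggregated mesh: every active cell is associated with an interior cell, its root. Interior
cells are their own roots, and a cut cell is joined to its root by a chain of facet-adjacent cells
of the same aggregate. -/
structure Aggregation where
  root : Set (Pt d) → Set (Pt d)
  root_mem : ∀ T ∈ M.active, root T ∈ M.interiorCells
  root_self : ∀ T ∈ M.interiorCells, root T = T
  chain : ∀ T ∈ M.cutCells, Relation.ReflTransGen
    (fun S S' => FacetAdjacent S S' ∧ S' ∈ M.active ∧ root S' = root T) (root T) T

end UnfittedMesh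

namespace UnfittedMesh.Aggregation

variable {d : ℕ} {M : UnfittedMesh d} (A : M.Aggregation)

/-- The aggregate with root cell `R`. -/
def aggregate (R : Set (Pt d)) : Set (Pt d) := ⋃ T ∈ M.active, ⋃ (_ : A.root T = R), T

/-- The diameters of the aggregates are at most `K h`. -/
def IsBounded (K : ℝ) : Prop :=
  ∀ R ∈ M.interiorCells, Metric.diam (A.aggregate R) ≤ K * M.meshSize

end UnfittedMesh.Aggregation

/-! ### Discrete spaces -/

/-- `V_{0,h}`: functions on `Ω_h` whose restriction to each active cell lies in `𝒱₀`. -/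
def pressureSpace {d : ℕ} (M : UnfittedMesh d) (V0 : Submodule ℝ (Pt d → ℝ)) :
    Set (Pt d → ℝ) :=
  {q | ∀ T ∈ M.active, ∃ p ∈ V0, q =ᵐ[volume.restrict T] p}

/-- `V_{d,h}`: fields in `H(div, Ω_h)` whose restriction to each active cell lies in `𝒱_d`. -/
def fluxSpace {d : ℕ} (M : UnfittedMesh d) (Vd : Submodule ℝ (Pt d → Pt d)) :
    Set (Pt d → Pt d) :=
  {v | MemHdiv M.activeDomain v ∧ ∀ T ∈ M.active, ∃ p ∈ Vd, v =ᵐ[volume.restrict T] p}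

section Stabilisation

variable {d : ℕ} {F : Type*} [NormedAddCommGroup F] [InnerProductSpace ℝ F]

/-- `Π` is an interpolation operator on `L²(Ω_h)`, where `U = Ω_h`, with values in the discrete
space `Vh` and with the approximation properties of degree `k` (with constant `c`). -/
def IsInterpolator (U : Set (Pt d)) (Vh : Set (Pt d → F)) (k : ℕ) (h c : ℝ)
    (P : (Pt d → F) → (Pt d → F)) : Prop :=
  (∀ u, MemL2 U u → P u ∈ Vh) ∧
  ∀ r ≤ k + 1, ∀ u, MemSobolev r U u →
    l2Norm U (fun x => u x - P u x) ≤ c * h ^ r * sobolevNorm r U u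

open Classical in
/-- The element of the polynomial space `V` whose restriction to `S` is `v` (unique if `S` has
nonempty interior); `0` if there is none. -/
def localRep (V : Submodule ℝ (Pt d → F)) (S : Set (Pt d)) (v : Pt d → F) : Pt d → F :=
  if h : ∃ p ∈ V, v =ᵐ[volume.restrict S] p then h.choose else 0

open Classical in
/-- The `L²(S)`-projection of `v` onto the restriction to `S` of the polynomial space `V`. -/
def localProj (V : Submodule ℝ (Pt d → F)) (S : Set (Pt d)) (v : Pt d → F) : Pt d → F :=
  if h : ∃ p ∈ V, ∀ w ∈ V, l2Inner S (fun x => v x - p x) w = 0 then h.choose else 0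

/-- The two choices of the operators `ℋ_h`. -/
inductive BulkOperator
  | extension
  | projection

/-- The operator `ℋ_h`. On each aggregate it is a single element of `V`: the extension of the
restriction of `v` to the root cell, or the `L²`-projection of `v` on the aggregate. -/
def bulkOp {M : UnfittedMesh d} (A : M.Aggregation) (V : Submodule ℝ (Pt d → F)) :
    BulkOperator → (Pt d → F) → (Pt d → F)
  | .extension, v => ∑ T ∈ M.active, (interior T).indicator (localRep V (A.root T) v)
  | .projection, v =>
      ∑ T ∈ M.active, (interior T).indicator (localProj V (A.aggregate (A.root T)) v)

/-- The bulk ghost penalty `s_h(u, v) = (u - ℋ_h u, v - ℋ_h v)_{Ω_h^cut}`. -/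
def bulkStab {M : UnfittedMesh d} (A : M.Aggregation) (V : Submodule ℝ (Pt d → F))
    (κ : BulkOperator) (u v : Pt d → F) : ℝ :=
  l2Inner M.cutDomain (fun x => u x - bulkOp A V κ u x) (fun x => v x - bulkOp A V κ v x)

/-- Norm equivalence: `‖w‖²_{L²(Ω)} + s(w, w) ≃ ‖w‖²_{L²(Ω_h)}` on `Vh`, with constant `C`. -/
def NormEquivalence (M : UnfittedMesh d) (Vh : Set (Pt d → F))
    (s : (Pt d → F) → (Pt d → F) → ℝ) (C : ℝ) : Prop :=
  ∀ w ∈ Vh,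
    l2Norm M.domain w ^ 2 + s w w ≤ C * l2Norm M.activeDomain w ^ 2 ∧
    l2Norm M.activeDomain w ^ 2 ≤ C * (l2Norm M.domain w ^ 2 + s w w)

/-- Weak consistency: `s(Π w, v) ≤ C h^m ‖w‖_{H^m(Ω^ext)} ‖v‖_{L²(Ω_h)}` for `0 ≤ m ≤ k + 1`. -/
def WeakConsistency (M : UnfittedMesh d) (Ωext : Set (Pt d)) (Vh : Set (Pt d → F)) (k : ℕ)
    (P : (Pt d → F) → (Pt d → F)) (s : (Pt d → F) → (Pt d → F) → ℝ) (C : ℝ) : Prop :=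
  ∀ m ≤ k + 1, ∀ w, MemSobolev m Ωext w → ∀ v ∈ Vh,
    s (P w) v ≤ C * M.meshSize ^ m * sobolevNorm m Ωext w * l2Norm M.activeDomain v

/-- The kernel `{q ∈ Vh : s(q, φ) = 0 for all φ ∈ Vh}` of a stabilisation. -/
def stabKernel (Vh : Set (Pt d → F)) (s : (Pt d → F) → (Pt d → F) → ℝ) : Set (Pt d → F) :=
  {q | q ∈ Vh ∧ ∀ φ ∈ Vh, s q φ = 0}

/-- Approximation property of the kernel of a stabilisation, for orders `0 ≤ m ≤ k + 1`. -/
def KernelApproximation (M : UnfittedMesh d) (Ωext : Set (Pt d)) (Vh : Set (Pt d → F)) (k : ℕ)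
    (s : (Pt d → F) → (Pt d → F) → ℝ) (C : ℝ) : Prop :=
  ∀ m ≤ k + 1, ∀ r, MemSobolev m Ωext r → ∃ w ∈ stabKernel Vh s,
    l2Norm M.activeDomain (fun x => r x - w x) ≤ C * M.meshSize ^ m * sobolevNorm m Ωext r

end Stabilisation

end UnfittedFE

end

open MeasureTheory
open scoped ContDiff RealInnerProductSpace

noncomputable section

namespace UnfittedFE

/-! Everything is reduced to one aggregate at a time. An aggregate lies in a ball of radius `K h`,
and its root contains a ball of radius `ρ ^ 2 * h`. On polynomials of bounded degree the squared
`L²` norms over these balls are comparable, uniformly in position and scale (`exists_ball_bound`).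
Hence a polynomial on an aggregate is controlled by its values on the root
(`exists_aggregate_bound`), wherever `Ω` cuts the mesh.

This inverse estimate makes both operators `ℋ_h` quasi-optimal on each aggregate
(`sqInt_sub_bulkValue_le`). Comparison with the zero polynomial bounds the stabilisation from above.
For the lower bound, a field on the cut cells is split into its residual and the polynomial `ℋ_h v`,
and the latter is moved to the root. For the projection the residual on the root does not vanish,
but orthogonality bounds it by the residual on the cut cells (`sqInt_root_sub_bulkValue_le`).
Quasi-optimality also shows that a function which is one element of `V` per aggregate has zero
residual, which gives the statements on constants and on the kernel.

Weak consistency and kernel approximation need one polynomial per aggregate that approximates a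
Sobolev function (`exists_aggregate_approx`). Aggregates are neither convex nor uniformly Lipschitz,
so Bramble–Hilbert is proved on bounded open convex sets with constants that depend on dimension and
order only (`exists_polynomial_approx`). It is applied to cells and to balls centred on shared
facets. Such a ball, of radius proportional to `h`, fits in the union of the two cells
(`exists_facet_ball`); its polynomial links those of the two cells, and a chain of boundedly many
cells links each cell to the root.

The convex Bramble–Hilbert lemma mollifies along homotheties that map the convex set into itself,
expands the mollification by Taylor's formula, and chooses a good centre by averaging.

The flux space enters only through its cell-wise polynomial structure, so scalars and vector fields
are treated together, as polynomials with values in an inner product space. -/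

set_option linter.unusedSectionVars false

/-! ### Squared `L²` norms on subsets of `ℝ^d`. -/

section Squares

variable {d : ℕ} {F : Type*} [NormedAddCommGroup F] [InnerProductSpace ℝ F]

/-- The square `‖u‖²_{L²(S)}` of the `L²` norm. -/
def sqInt (S : Set (Pt d)) (u : Pt d → F) : ℝ := ∫ x in S, ‖u x‖ ^ 2

theorem sqInt_nonneg (S : Set (Pt d)) (u : Pt d → F) : 0 ≤ sqInt S u :=
  integral_nonneg fun _ => sq_nonneg _

theorem l2Norm_sq (S : Set (Pt d)) (u : Pt d → F) : l2Norm S u ^ 2 = sqInt S u :=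
  Real.sq_sqrt (sqInt_nonneg S u)

theorem l2Norm_nonneg (S : Set (Pt d)) (u : Pt d → F) : 0 ≤ l2Norm S u := Real.sqrt_nonneg _

theorem MemL2.integrable_sq {S : Set (Pt d)} {u : Pt d → F} (hu : MemL2 S u) :
    IntegrableOn (fun x => ‖u x‖ ^ 2) S :=
  MemLp.integrable_norm_pow hu (by norm_num)

theorem MemL2.mono {S T : Set (Pt d)} {u : Pt d → F} (hu : MemL2 T u) (h : S ⊆ T) : MemL2 S u :=
  MemLp.mono_measure (Measure.restrict_mono h le_rfl) hu

theorem MemL2.congr {S : Set (Pt d)} {u v : Pt d → F} (hu : MemL2 S u)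
    (h : u =ᵐ[volume.restrict S] v) : MemL2 S v :=
  (memLp_congr_ae h).1 hu

theorem MemL2.sub {S : Set (Pt d)} {u v : Pt d → F} (hu : MemL2 S u) (hv : MemL2 S v) :
    MemL2 S (fun x => u x - v x) :=
  MemLp.sub hu hv

theorem sqInt_mono {S T : Set (Pt d)} {u : Pt d → F} (hu : MemL2 T u) (h : S ⊆ T) :
    sqInt S u ≤ sqInt T u :=
  setIntegral_mono_set hu.integrable_sq (Filter.Eventually.of_forall fun _ => sq_nonneg _)
    h.eventuallyLE

theorem sqInt_congr {S : Set (Pt d)} {u v : Pt d → F} (h : u =ᵐ[volume.restrict S] v) :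
    sqInt S u = sqInt S v :=
  integral_congr_ae (h.mono fun x hx => by simp only [hx])

theorem sqInt_congr_set {S T : Set (Pt d)} (u : Pt d → F) (h : S =ᵐ[volume] T) :
    sqInt S u = sqInt T u :=
  setIntegral_congr_set h

/-- The parallelogram bound for differences that telescope. -/
theorem sqInt_sub_le {S : Set (Pt d)} {u v w : Pt d → F} (huv : MemL2 S (fun x => u x - v x))
    (hvw : MemL2 S (fun x => v x - w x)) :
    sqInt S (fun x => u x - w x) ≤
      2 * sqInt S (fun x => u x - v x) + 2 * sqInt S (fun x => v x - w x) := by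
  unfold sqInt
  rw [← integral_const_mul, ← integral_const_mul,
    ← integral_add (huv.integrable_sq.const_mul 2) (hvw.integrable_sq.const_mul 2)]
  refine integral_mono_of_nonneg (Filter.Eventually.of_forall fun _ => sq_nonneg _)
    ((huv.integrable_sq.const_mul 2).add (hvw.integrable_sq.const_mul 2))
    (Filter.Eventually.of_forall fun x => ?_)
  have h := norm_add_le (u x - v x) (v x - w x)
  rw [sub_add_sub_cancel] at h
  have h2 : ‖u x - w x‖ ^ 2 ≤ (‖u x - v x‖ + ‖v x - w x‖) ^ 2 := by gcongr
  simp only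
  nlinarith [sq_nonneg (‖u x - v x‖ - ‖v x - w x‖)]

theorem sqInt_le_add {S : Set (Pt d)} {u v : Pt d → F} (hu : MemL2 S u)
    (hv : MemL2 S v) :
    sqInt S u ≤ 2 * sqInt S (fun x => u x - v x) + 2 * sqInt S v := by
  have := sqInt_sub_le (w := fun _ => (0 : F)) (hu.sub hv) (by simpa using hv)
  simpa using this

theorem sqInt_sub_comm (S : Set (Pt d)) (u v : Pt d → F) :
    sqInt S (fun x => u x - v x) = sqInt S (fun x => v x - u x) := by
  unfold sqInt
  simp only [norm_sub_rev]

theorem memL2_of_continuous {S : Set (Pt d)} (hS : Bornology.IsBounded S) {u : Pt d → F}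
    (hu : Continuous u) : MemL2 S u := by
  obtain ⟨R, hR⟩ := hS.subset_closedBall 0
  have hK := isCompact_closedBall (0 : Pt d) R
  obtain ⟨M, hM⟩ := hK.exists_bound_of_continuousOn hu.continuousOn
  have : IsFiniteMeasure (volume.restrict (Metric.closedBall (0 : Pt d) R)) :=
    ⟨by simpa using hK.measure_lt_top⟩
  have h : MemL2 (Metric.closedBall (0 : Pt d) R) u := by
    refine MemLp.of_bound ?_ M ((ae_restrict_iff' hK.measurableSet).2 (.of_forall hM))
    exact hu.aestronglyMeasurable
  exact h.mono hR

theorem norm_toLp_sq {S : Set (Pt d)} {u : Pt d → F} (hu : MemL2 S u) :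
    ‖MemLp.toLp u hu‖ ^ 2 = sqInt S u := by
  rw [← real_inner_self_eq_norm_sq, L2.inner_def]
  refine integral_congr_ae ?_
  filter_upwards [MemLp.coeFn_toLp hu] with x hx
  rw [hx, real_inner_self_eq_norm_sq]

theorem inner_toLp {S : Set (Pt d)} {u v : Pt d → F} (hu : MemL2 S u) (hv : MemL2 S v) :
    ⟪MemLp.toLp u hu, MemLp.toLp v hv⟫ = l2Inner S u v := by
  rw [L2.inner_def]
  refine integral_congr_ae ?_
  filter_upwards [MemLp.coeFn_toLp hu, MemLp.coeFn_toLp hv] with x hx hy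
  rw [hx, hy]

theorem l2Inner_le {S : Set (Pt d)} {u v : Pt d → F} (hu : MemL2 S u) (hv : MemL2 S v) :
    |l2Inner S u v| ≤ l2Norm S u * l2Norm S v := by
  have h1 : ∀ {u : Pt d → F} (hu : MemL2 S u), ‖MemLp.toLp u hu‖ = l2Norm S u := fun hu =>
    (sq_eq_sq₀ (norm_nonneg _) (l2Norm_nonneg _ _)).1 (by rw [norm_toLp_sq, l2Norm_sq])
  rw [← inner_toLp hu hv, ← h1 hu, ← h1 hv]
  exact abs_real_inner_le_norm _ _

/-- A space of square-integrable functions as a subspace of `L²(S)`. -/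
def toL2 (S : Set (Pt d)) (V : Submodule ℝ (Pt d → F)) (hV : ∀ p ∈ V, MemL2 S p) :
    V →ₗ[ℝ] Lp F 2 (volume.restrict S) where
  toFun p := MemLp.toLp p.1 (hV p.1 p.2)
  map_add' p q := MemLp.toLp_add (hV p.1 p.2) (hV q.1 q.2)
  map_smul' a p := MemLp.toLp_const_smul a (hV p.1 p.2)

end Squares

/-! ### Polynomial functions and scale-invariant inverse estimates on balls. -/

section Polynomials

variable {d : ℕ} {F : Type*} [NormedAddCommGroup F] [InnerProductSpace ℝ F]

theorem polyScalar_mono {k l : ℕ} (h : k ≤ l) : polyScalar d k ≤ polyScalar d l := by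
  rintro f ⟨p, hp, hf⟩
  exact ⟨p, hp.trans h, hf⟩

theorem const_mem_polyScalar (k : ℕ) (a : ℝ) : (fun _ => a) ∈ polyScalar d k :=
  ⟨MvPolynomial.C a, by simp, fun x => by simp⟩

theorem coord_mem_polyScalar (i : Fin d) : (fun x : Pt d => x i) ∈ polyScalar d 1 :=
  ⟨MvPolynomial.X i, by simp, fun x => by simp⟩

theorem mul_mem_polyScalar {k l : ℕ} {f g : Pt d → ℝ} (hf : f ∈ polyScalar d k)
    (hg : g ∈ polyScalar d l) : (fun x => f x * g x) ∈ polyScalar d (k + l) := by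
  obtain ⟨p, hp, hf⟩ := hf
  obtain ⟨q, hq, hg⟩ := hg
  exact ⟨p * q, (MvPolynomial.totalDegree_mul p q).trans (add_le_add hp hq),
    fun x => by simp [hf x, hg x]⟩

theorem prod_mem_polyScalar {j : ℕ} {f : Fin j → Pt d → ℝ} (hf : ∀ l, f l ∈ polyScalar d 1) :
    (fun x => ∏ l, f l x) ∈ polyScalar d j := by
  induction j with
  | zero => simpa using const_mem_polyScalar 0 1
  | succ j ih =>
    simp only [Fin.prod_univ_succ]
    exact polyScalar_mono (add_comm 1 j).le (mul_mem_polyScalar (hf 0) (ih fun l => hf _))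

/-- Substituting polynomials of degree at most one for the variables does not raise the total
degree. -/
theorem comp_affine_mem_polyScalar {k : ℕ} {f : Pt d → ℝ} (hf : f ∈ polyScalar d k)
    (a : Pt d) (r : ℝ) : (fun x => f (a + r • x)) ∈ polyScalar d k := by
  obtain ⟨p, hp, hf⟩ := hf
  let φ : Fin d → MvPolynomial (Fin d) ℝ :=
    fun i => MvPolynomial.C (a i) + MvPolynomial.C r * MvPolynomial.X i
  have hφ : ∀ i, (φ i).totalDegree ≤ 1 := fun i => by
    refine (MvPolynomial.totalDegree_add _ _).trans (max_le (by simp) ?_)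
    exact (MvPolynomial.totalDegree_mul _ _).trans (by simp)
  refine ⟨MvPolynomial.bind₁ φ p, ?_, fun x => ?_⟩
  · rw [MvPolynomial.bind₁, MvPolynomial.aeval_def, MvPolynomial.eval₂_eq]
    refine MvPolynomial.totalDegree_finsetSum_le fun s hs => ?_
    refine (MvPolynomial.totalDegree_mul _ _).trans ?_
    rw [MvPolynomial.algebraMap_eq, MvPolynomial.totalDegree_C, zero_add]
    refine (MvPolynomial.totalDegree_finsetProd _ _).trans (le_trans ?_ hp)
    refine le_trans ?_ (MvPolynomial.le_totalDegree hs)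
    refine Finset.sum_le_sum fun i _ => ?_
    refine (MvPolynomial.totalDegree_pow _ _).trans ?_
    exact (Nat.mul_le_mul_left _ (hφ i)).trans (by simp)
  · change f (a + r • x) = _
    rw [hf, ← MvPolynomial.coe_aeval_eq_eval, ← MvPolynomial.coe_aeval_eq_eval]
    simp only [RingHom.coe_coe]
    rw [MvPolynomial.aeval_bind₁]
    congr 2
    ext i
    simp [φ]

theorem continuous_of_mem_polyScalar {k : ℕ} {f : Pt d → ℝ} (hf : f ∈ polyScalar d k) :
    Continuous f := by
  obtain ⟨p, -, hf⟩ := hf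
  rw [funext hf]
  exact (MvPolynomial.continuous_eval p).comp (by fun_prop)

instance (k : ℕ) : FiniteDimensional ℝ (polyScalar d k) := by
  let e : MvPolynomial.restrictTotalDegree (Fin d) ℝ k →ₗ[ℝ] polyScalar d k :=
    { toFun := fun p => ⟨fun x => MvPolynomial.eval (fun i => x i) p.1,
        p.1, (MvPolynomial.mem_restrictTotalDegree _ _ _).1 p.2, fun _ => rfl⟩
      map_add' := fun p q => by ext; simp
      map_smul' := fun a p => by ext; simp [MvPolynomial.smul_eval] }
  refine Module.Finite.of_surjective e ?_
  rintro ⟨f, p, hp, hf⟩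
  exact ⟨⟨p, (MvPolynomial.mem_restrictTotalDegree _ _ _).2 hp⟩, Subtype.ext (funext hf).symm⟩

/-- An open set contains a product of intervals, and a polynomial that vanishes on a product of
infinite sets is zero. -/
theorem eq_zero_of_eq_zero_on_isOpen {k : ℕ} {f : Pt d → ℝ} (hf : f ∈ polyScalar d k)
    {U : Set (Pt d)} (hU : IsOpen U) (hne : U.Nonempty) (h0 : ∀ x ∈ U, f x = 0) : f = 0 := by
  obtain ⟨p, -, hf⟩ := hf
  obtain ⟨a, ha⟩ := hne
  let ι : (Fin d → ℝ) → Pt d := fun y => WithLp.toLp 2 y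
  have hι : Continuous ι := PiLp.continuous_toLp 2 _
  have hopen : IsOpen (ι ⁻¹' U) := hU.preimage hι
  obtain ⟨ε, hε, hball⟩ := Metric.isOpen_iff.1 hopen (fun i => a i) ha
  have hp : p = 0 := by
    refine MvPolynomial.funext_set (fun i => Metric.ball (a i) ε) (fun i => ?_) fun y hy => ?_
    · exact infinite_of_mem_nhds _ (Metric.ball_mem_nhds _ hε)
    · have hy' : y ∈ Metric.ball (fun i => a i) ε := by
        rw [ball_pi _ hε]
        exact hy
      rw [map_zero, ← h0 (ι y) (hball hy'), hf]
  ext x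
  simp [hf, hp]

/-- The polynomial functions on `ℝ^d` of degree at most `k` with values in `F`. -/
def polyF (d : ℕ) (F : Type*) [NormedAddCommGroup F] [InnerProductSpace ℝ F] (k : ℕ) :
    Submodule ℝ (Pt d → F) where
  carrier := {f | ∀ y : F, (fun x => ⟪y, f x⟫) ∈ polyScalar d k}
  zero_mem' := fun y => by
    simp only [Pi.zero_apply, inner_zero_right]
    exact (polyScalar d k).zero_mem
  add_mem' := fun hf hg y => by
    simp only [Pi.add_apply, inner_add_right]
    exact (polyScalar d k).add_mem (hf y) (hg y)
  smul_mem' := fun c f hf y => by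
    simp only [Pi.smul_apply, inner_smul_right]
    exact (polyScalar d k).smul_mem c (hf y)

theorem mem_polyF {k : ℕ} {f : Pt d → F} :
    f ∈ polyF d F k ↔ ∀ y : F, (fun x => ⟪y, f x⟫) ∈ polyScalar d k := Iff.rfl

theorem polyF_mono {k l : ℕ} (h : k ≤ l) : polyF d F k ≤ polyF d F l :=
  fun _ hf y => polyScalar_mono h (hf y)

/-- With `polyF_euclidean`, this transfers results for values in a general `F` to pressures and
fluxes. -/
theorem polyF_real (k : ℕ) : polyF d ℝ k = polyScalar d k := by
  ext f
  rw [mem_polyF]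
  refine ⟨fun h => by simpa using h 1, fun h y => ?_⟩
  have := (polyScalar d k).smul_mem y h
  convert this using 1
  ext x
  simp [mul_comm]

theorem polyF_euclidean (k : ℕ) : polyF d (Pt d) k = polyVector d k := by
  ext f
  rw [mem_polyF]
  refine ⟨fun h i => ?_, fun h y => ?_⟩
  · simpa [EuclideanSpace.inner_single_left] using h (EuclideanSpace.single i 1)
  · have : ∑ i, y i • (fun x => f x i) ∈ polyScalar d k :=
      Submodule.sum_mem _ fun i _ => (polyScalar d k).smul_mem _ (h i)
    convert this using 1
    ext x
    simp [PiLp.inner_apply, mul_comm]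

theorem smul_const_mem_polyF {k : ℕ} {f : Pt d → ℝ} (hf : f ∈ polyScalar d k) (c : F) :
    (fun x => f x • c) ∈ polyF d F k := fun y => by
  have := (polyScalar d k).smul_mem ⟪y, c⟫ hf
  convert this using 1
  ext x
  simp [inner_smul_right, mul_comm]

variable [FiniteDimensional ℝ F]

theorem continuous_of_mem_polyF {k : ℕ} {f : Pt d → F} (hf : f ∈ polyF d F k) :
    Continuous f := by
  have h : f = fun x => ∑ i, ⟪stdOrthonormalBasis ℝ F i, f x⟫ • stdOrthonormalBasis ℝ F i := by
    ext x
    exact ((stdOrthonormalBasis ℝ F).sum_repr' (f x)).symm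
  rw [h]
  exact continuous_finsetSum _ fun i _ =>
    (continuous_of_mem_polyScalar (hf _)).smul continuous_const

theorem memL2_of_mem_polyF {k : ℕ} {f : Pt d → F} (hf : f ∈ polyF d F k) {S : Set (Pt d)}
    (hS : Bornology.IsBounded S) : MemL2 S f :=
  memL2_of_continuous hS (continuous_of_mem_polyF hf)

instance (k : ℕ) : FiniteDimensional ℝ (polyF d F k) := by
  let b := stdOrthonormalBasis ℝ F
  let e : polyF d F k →ₗ[ℝ] (Fin (Module.finrank ℝ F) → polyScalar d k) :=
    { toFun := fun f i => ⟨fun x => ⟪b i, f.1 x⟫, f.2 (b i)⟩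
      map_add' := fun f g => by ext; simp [inner_add_right]
      map_smul' := fun a f => by ext; simp [inner_smul_right] }
  refine FiniteDimensional.of_injective e fun f g hfg => ?_
  refine Subtype.ext (funext fun x => ?_)
  rw [← b.sum_repr' (f.1 x), ← b.sum_repr' (g.1 x)]
  refine Finset.sum_congr rfl fun i _ => ?_
  have h : ⟪b i, f.1 x⟫ = ⟪b i, g.1 x⟫ := congrFun (congrArg Subtype.val (congrFun hfg i)) x
  rw [h]

theorem sqInt_eq_sum {S : Set (Pt d)} {u : Pt d → F} {ι : Type*} [Fintype ι]
    (b : OrthonormalBasis ι ℝ F) (hu : MemL2 S u) :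
    sqInt S u = ∑ i, sqInt S (fun x => ⟪b i, u x⟫) := by
  unfold sqInt
  rw [← integral_finsetSum]
  · simp only [b.sum_sq_norm_inner_right]
  · intro i _
    exact MemL2.integrable_sq (MemLp.const_inner (b i) hu)

theorem sqInt_affine (u : Pt d → F) (y : Pt d) {r : ℝ} (hr : 0 < r) (t : ℝ) :
    sqInt (Metric.closedBall y (t * r)) u =
      r ^ d * sqInt (Metric.closedBall 0 t) (fun x => u (y + r • x)) := by
  unfold sqInt
  rw [Measure.setIntegral_comp_smul_of_pos volume (fun x => ‖u (y + x)‖ ^ 2) _ hr,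
    smul_closedBall' hr.ne', smul_zero, Real.norm_of_nonneg hr.le, finrank_euclideanSpace,
    Fintype.card_fin, smul_eq_mul, ← mul_assoc, mul_inv_cancel₀ (pow_ne_zero _ hr.ne'), one_mul,
    mul_comm r t, ← (measurePreserving_add_left volume y).setIntegral_preimage_emb
      (MeasurableEquiv.addLeft y).measurableEmbedding (fun x => ‖u x‖ ^ 2)]
  congr 2
  rw [preimage_add_closedBall, sub_self]

/-- Finite dimensionality: a polynomial is determined by its class in `L²` of the unit ball, and the
linear map from that class to the class on the ball of radius `t` is automatically bounded. -/
theorem exists_unit_ball_bound_polyScalar (d k : ℕ) (t : ℝ) :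
    ∃ C : ℝ, 0 < C ∧ ∀ f ∈ polyScalar d k,
      sqInt (Metric.closedBall 0 t) f ≤ C * sqInt (Metric.closedBall 0 1) f := by
  have hL : ∀ t : ℝ, ∀ f ∈ polyScalar d k, MemL2 (Metric.closedBall 0 t) f := fun t f hf =>
    memL2_of_continuous Metric.isBounded_closedBall (continuous_of_mem_polyScalar hf)
  let L₁ := toL2 (Metric.closedBall 0 1) (polyScalar d k) (hL 1)
  let L₂ := toL2 (Metric.closedBall 0 t) (polyScalar d k) (hL t)
  have hinj : Function.Injective L₁ := by
    rw [← LinearMap.ker_eq_bot, LinearMap.ker_eq_bot']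
    rintro ⟨f, hf⟩ h
    have h' : MemLp.toLp f (hL 1 f hf) = 0 := h
    have h0 : f =ᵐ[volume.restrict (Metric.ball 0 1)] fun _ => (0 : ℝ) :=
      ae_restrict_of_ae_restrict_of_subset Metric.ball_subset_closedBall
        ((MemLp.coeFn_toLp (hL 1 f hf)).symm.trans
          (h' ▸ Lp.coeFn_zero ℝ 2 _))
    have := Measure.eqOn_open_of_ae_eq h0 Metric.isOpen_ball
      (continuous_of_mem_polyScalar hf).continuousOn continuousOn_const
    exact Subtype.ext (eq_zero_of_eq_zero_on_isOpen hf Metric.isOpen_ball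
      ⟨0, Metric.mem_ball_self one_pos⟩ this)
  let e := LinearEquiv.ofInjective L₁ hinj
  let T := LinearMap.toContinuousLinearMap (L₂ ∘ₗ e.symm.toLinearMap)
  -- The summand 1 only makes the constant positive.
  refine ⟨‖T‖ ^ 2 + 1, by positivity, fun f hf => ?_⟩
  have h := T.le_opNorm (e ⟨f, hf⟩)
  have h1 : T (e ⟨f, hf⟩) = L₂ ⟨f, hf⟩ := by simp [T]
  have h2 : ‖e ⟨f, hf⟩‖ = ‖L₁ ⟨f, hf⟩‖ := rfl
  rw [h1, h2] at h
  have h3 : ‖L₂ ⟨f, hf⟩‖ ^ 2 ≤ (‖T‖ * ‖L₁ ⟨f, hf⟩‖) ^ 2 := by gcongr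
  have h4 : ‖L₂ ⟨f, hf⟩‖ ^ 2 = sqInt (Metric.closedBall 0 t) f := norm_toLp_sq (hL t f hf)
  have h5 : ‖L₁ ⟨f, hf⟩‖ ^ 2 = sqInt (Metric.closedBall 0 1) f := norm_toLp_sq (hL 1 f hf)
  rw [mul_pow, h4, h5] at h3
  nlinarith [sqInt_nonneg (Metric.closedBall 0 1) f]

/-- Scale-invariant comparison of the `L²` norms of a polynomial over concentric balls. -/
theorem exists_ball_bound (d : ℕ) (F : Type*) [NormedAddCommGroup F] [InnerProductSpace ℝ F]
    [FiniteDimensional ℝ F] (k : ℕ) (t : ℝ) :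
    ∃ C : ℝ, 0 < C ∧ ∀ f ∈ polyF d F k, ∀ (y : Pt d) (r : ℝ), 0 < r →
      sqInt (Metric.closedBall y (t * r)) f ≤ C * sqInt (Metric.closedBall y r) f := by
  obtain ⟨C, hC, h⟩ := exists_unit_ball_bound_polyScalar d k t
  refine ⟨C, hC, fun f hf y r hr => ?_⟩
  let b := stdOrthonormalBasis ℝ F
  rw [sqInt_eq_sum b (memL2_of_mem_polyF hf Metric.isBounded_closedBall),
    sqInt_eq_sum b (memL2_of_mem_polyF hf Metric.isBounded_closedBall), Finset.mul_sum]
  refine Finset.sum_le_sum fun i _ => ?_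
  -- The map `x ↦ y + r x` reduces both balls to balls centred at the origin; the Jacobian `r ^ d`
  -- is the same on both sides and cancels.
  have h1 := sqInt_affine (fun x => ⟪b i, f x⟫) y hr 1
  rw [one_mul] at h1
  rw [sqInt_affine _ y hr t, h1, mul_left_comm]
  gcongr
  exact h _ (comp_affine_mem_polyScalar (hf (b i)) y r)

end Polynomials

/-! ### Extended-valued squared norms, for use with Tonelli and Jensen. -/

section EnormSquares

variable {d : ℕ} {F : Type*} [NormedAddCommGroup F]

theorem enorm_sq_eq_ofReal (x : F) : ‖x‖ₑ ^ 2 = ENNReal.ofReal (‖x‖ ^ 2) := by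
  rw [← ofReal_norm, ENNReal.ofReal_pow (norm_nonneg x)]

theorem enorm_add_sq_le (x y : F) : ‖x + y‖ₑ ^ 2 ≤ 2 * ‖x‖ₑ ^ 2 + 2 * ‖y‖ₑ ^ 2 := by
  simp only [enorm_sq_eq_ofReal]
  rw [show (2 : ENNReal) = ENNReal.ofReal 2 by simp, ← ENNReal.ofReal_mul (by norm_num),
    ← ENNReal.ofReal_mul (by norm_num), ← ENNReal.ofReal_add (by positivity) (by positivity)]
  refine ENNReal.ofReal_le_ofReal ?_
  have h2 : ‖x + y‖ ^ 2 ≤ (‖x‖ + ‖y‖) ^ 2 := by gcongr; exact norm_add_le x y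
  nlinarith [sq_nonneg (‖x‖ - ‖y‖)]

theorem eLpNorm_two_sq {α : Type*} {m : MeasurableSpace α} (μ : Measure α) (f : α → F) :
    eLpNorm f 2 μ ^ 2 = ∫⁻ x, ‖f x‖ₑ ^ 2 ∂μ := by
  rw [eLpNorm_eq_lintegral_rpow_enorm_toReal (by norm_num) (by norm_num), ENNReal.toReal_ofNat,
    ← ENNReal.rpow_natCast, ← ENNReal.rpow_mul]
  simp

theorem memLp_two_iff {α : Type*} {m : MeasurableSpace α} {μ : Measure α} {f : α → F}
    (hf : AEStronglyMeasurable f μ) : MemLp f 2 μ ↔ ∫⁻ x, ‖f x‖ₑ ^ 2 ∂μ < ⊤ := by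
  rw [← eLpNorm_two_sq, ENNReal.pow_lt_top_iff]
  exact ⟨fun h => .inl h.2, fun h => ⟨hf, h.resolve_right (by norm_num)⟩⟩

variable [NormedSpace ℝ F]

theorem enorm_integral_sq_le {α : Type*} {m : MeasurableSpace α} (μ : Measure α)
    [IsProbabilityMeasure μ] {f : α → F} (hf : AEStronglyMeasurable f μ) :
    ‖∫ x, f x ∂μ‖ₑ ^ 2 ≤ ∫⁻ x, ‖f x‖ₑ ^ 2 ∂μ := by
  rw [← eLpNorm_two_sq]
  gcongr
  refine (enorm_integral_le_lintegral_enorm f).trans ?_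
  rw [← eLpNorm_one_eq_lintegral_enorm]
  exact eLpNorm_le_eLpNorm_of_exponent_le (by norm_num) hf

/-- Jensen for `c - f`. If the right-hand side is infinite there is nothing to show; otherwise `f`
is integrable, so `c` may be moved inside the integral. -/
theorem enorm_sub_integral_sq_le {α : Type*} {m : MeasurableSpace α} (μ : Measure α)
    [IsProbabilityMeasure μ] [CompleteSpace F] (c : F) {f : α → F}
    (hf : AEStronglyMeasurable f μ) :
    ‖c - ∫ x, f x ∂μ‖ₑ ^ 2 ≤ ∫⁻ x, ‖c - f x‖ₑ ^ 2 ∂μ := by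
  have hm : AEStronglyMeasurable (fun x => c - f x) μ := aestronglyMeasurable_const.sub hf
  by_cases h : ∫⁻ x, ‖c - f x‖ₑ ^ 2 ∂μ < ⊤
  · have h1 : Integrable (fun x => c - f x) μ :=
      ((memLp_two_iff hm).2 h).integrable (by norm_num)
    have h2 : Integrable f μ := by
      have := (integrable_const c).sub h1
      exact this.congr (Filter.Eventually.of_forall fun x => sub_sub_cancel c (f x))
    have h3 : c - ∫ x, f x ∂μ = ∫ x, (c - f x) ∂μ := by
      rw [integral_sub (integrable_const c) h2]
      simp
    rw [h3]
    exact enorm_integral_sq_le μ hm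
  · rw [not_lt_top_iff] at h
    rw [h]
    exact le_top

theorem lintegral_comp_affine {g : Pt d → ENNReal} (hg : Measurable g) (a : Pt d) {r : ℝ}
    (hr : 0 < r) : ∫⁻ x, g (a + r • x) = ENNReal.ofReal (r ^ d)⁻¹ * ∫⁻ x, g x := by
  have h1 : Measurable fun y => g (a + y) := hg.comp (measurable_const_add a)
  rw [← lintegral_map (f := fun y => g (a + y)) h1 (measurable_const_smul r),
    Measure.map_addHaar_smul _ hr.ne', lintegral_smul_measure, lintegral_add_left_eq_self,
    finrank_euclideanSpace, Fintype.card_fin, abs_of_pos (by positivity), smul_eq_mul]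

theorem integral_comp_affine (g : Pt d → F) (a : Pt d) {r : ℝ} (hr : 0 < r) :
    ∫ x, g (a + r • x) = (r ^ d)⁻¹ • ∫ x, g x := by
  rw [Measure.integral_comp_smul volume (fun y => g (a + y)) r, integral_add_left_eq_self,
    finrank_euclideanSpace, Fintype.card_fin, abs_of_pos (by positivity)]

end EnormSquares

/-! ### Mollification by homotheties that preserve a convex set. -/

section Mollification

variable {d : ℕ} {F : Type*} [NormedAddCommGroup F] [NormedSpace ℝ F]

/-- A smooth probability density supported in `D`. -/
structure IsMollifier (D : Set (Pt d)) (η : Pt d → ℝ) : Prop where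
  contDiff : ContDiff ℝ ∞ η
  hasCompactSupport : HasCompactSupport η
  tsupport_subset : tsupport η ⊆ D
  nonneg : ∀ w, 0 ≤ η w
  integral_eq_one : ∫ w, η w = 1

theorem exists_isMollifier {D : Set (Pt d)} (hD : IsOpen D) (hne : D.Nonempty) :
    ∃ η, IsMollifier D η := by
  obtain ⟨a, ha⟩ := hne
  obtain ⟨ε, hε, hball⟩ := Metric.isOpen_iff.1 hD a ha
  let b : ContDiffBump a := ⟨ε / 4, ε / 2, by positivity, by linarith⟩
  refine ⟨b.normed volume, b.contDiff_normed, b.hasCompactSupport_normed, ?_,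
    fun w => b.nonneg_normed w, b.integral_normed⟩
  rw [b.tsupport_normed_eq]
  exact (Metric.closedBall_subset_ball (half_lt_self hε)).trans hball

/-- The probability measure with density `η`. -/
def densityMeasure (η : Pt d → ℝ) : Measure (Pt d) :=
  volume.withDensity fun w => ENNReal.ofReal (η w)

/-- Mollification of `f` along the homotheties that shrink `ℝ^d` towards the support of `η`. -/
def mollify (η : Pt d → ℝ) (δ : ℝ) (f : Pt d → F) (x : Pt d) : F :=
  ∫ w, f ((1 - δ) • x + δ • w) ∂densityMeasure η

variable {D : Set (Pt d)} {η : Pt d → ℝ}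

theorem IsMollifier.isProbabilityMeasure (hη : IsMollifier D η) :
    IsProbabilityMeasure (densityMeasure η) := by
  refine ⟨?_⟩
  rw [densityMeasure, withDensity_apply _ MeasurableSet.univ, Measure.restrict_univ,
    ← ofReal_integral_eq_lintegral_ofReal
      (hη.contDiff.continuous.integrable_of_hasCompactSupport hη.hasCompactSupport)
      (Filter.Eventually.of_forall hη.nonneg), hη.integral_eq_one, ENNReal.ofReal_one]

theorem IsMollifier.ae_mem (hη : IsMollifier D η) : ∀ᵐ w ∂densityMeasure η, w ∈ D := by
  have hm : Measurable fun w => ENNReal.ofReal (η w) :=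
    hη.contDiff.continuous.measurable.ennreal_ofReal
  rw [densityMeasure, ae_withDensity_iff hm]
  refine Filter.Eventually.of_forall fun w hw => hη.tsupport_subset (subset_tsupport _ ?_)
  intro h0
  exact hw (by rw [h0, ENNReal.ofReal_zero])

/-- Substituting `z = (1 - δ) x + δ w` moves `x` from `f` into the kernel, where it can be
differentiated. -/
theorem IsMollifier.mollify_eq (hη : IsMollifier D η) {δ : ℝ} (hδ : 0 < δ) (f : Pt d → F)
    (x : Pt d) :
    mollify η δ f x = (δ ^ d)⁻¹ • ∫ z, η (δ⁻¹ • (z - (1 - δ) • x)) • f z := by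
  have hm : Measurable fun w => ENNReal.ofReal (η w) :=
    hη.contDiff.continuous.measurable.ennreal_ofReal
  rw [mollify, densityMeasure, integral_withDensity_eq_integral_toReal_smul hm
    (Filter.Eventually.of_forall fun _ => ENNReal.ofReal_lt_top),
    ← integral_comp_affine _ ((1 - δ) • x) hδ]
  refine integral_congr_ae (Filter.Eventually.of_forall fun w => ?_)
  simp only [add_sub_cancel_left, smul_smul, inv_mul_cancel₀ hδ.ne', one_smul,
    ENNReal.toReal_ofReal (hη.nonneg w)]

theorem IsMollifier.stronglyMeasurable_mollify (hη : IsMollifier D η) {δ : ℝ} {f : Pt d → F}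
    (hf : StronglyMeasurable f) : StronglyMeasurable (mollify η δ f) := by
  have := hη.isProbabilityMeasure
  refine StronglyMeasurable.integral_prod_right'
    (f := fun p : Pt d × Pt d => f ((1 - δ) • p.1 + δ • p.2)) ?_
  exact hf.comp_measurable (by fun_prop)

/-- Jensen in `w`, then Tonelli; for fixed `w` the homothety in `x` scales Lebesgue measure by `(1 -
δ) ^ d`. -/
theorem IsMollifier.lintegral_mollify_le (hη : IsMollifier D η) {δ : ℝ} (hδ : δ < 1)
    {f : Pt d → F} (hf : StronglyMeasurable f) :
    ∫⁻ x, ‖mollify η δ f x‖ₑ ^ 2 ≤ ENNReal.ofReal ((1 - δ) ^ d)⁻¹ * ∫⁻ x, ‖f x‖ₑ ^ 2 := by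
  have := hη.isProbabilityMeasure
  have hsq : Measurable fun x => ‖f x‖ₑ ^ 2 := hf.enorm.pow_const 2
  calc ∫⁻ x, ‖mollify η δ f x‖ₑ ^ 2
      ≤ ∫⁻ x, ∫⁻ w, ‖f ((1 - δ) • x + δ • w)‖ₑ ^ 2 ∂densityMeasure η :=
        lintegral_mono fun x => enorm_integral_sq_le _
          (hf.comp_measurable (by fun_prop)).aestronglyMeasurable
    _ = ∫⁻ w, (∫⁻ x, ‖f ((1 - δ) • x + δ • w)‖ₑ ^ 2) ∂densityMeasure η :=
        lintegral_lintegral_swap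
          (hsq.comp (g := fun x => ‖f x‖ₑ ^ 2) (f := fun p : Pt d × Pt d => (1 - δ) • p.1 + δ • p.2)
            (by fun_prop)).aemeasurable
    _ = ∫⁻ _w, (ENNReal.ofReal ((1 - δ) ^ d)⁻¹ * ∫⁻ x, ‖f x‖ₑ ^ 2) ∂densityMeasure η := by
        refine lintegral_congr fun w => ?_
        rw [← lintegral_comp_affine hsq (δ • w) (sub_pos.2 hδ)]
        simp only [add_comm]
    _ = _ := by simp

/-- Approximate `u` in `L²` by a continuous compactly supported `g`. Since `g` is uniformly
continuous, a homothety with small `δ` hardly changes it on the bounded set `D`, uniformly in the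
centre `w`. Averaging over `w` concludes. -/
theorem IsMollifier.exists_mollify_approx (hη : IsMollifier D η) [CompleteSpace F]
    (hD : MeasurableSet D) (hbdd : Bornology.IsBounded D) {u : Pt d → F}
    (hu : StronglyMeasurable u) (hu2 : MemLp u 2 volume) {ε : ENNReal} (hε : ε ≠ 0) :
    ∃ δ : ℝ, 0 < δ ∧ δ ≤ 1 / 2 ∧ ∫⁻ x in D, ‖u x - mollify η δ u x‖ₑ ^ 2 ≤ ε := by
  have := hη.isProbabilityMeasure
  have hvol : volume D ≠ ⊤ := hbdd.measure_lt_top.ne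
  -- it suffices to bound by `A * a ^ 2 + B * b ^ 2`
  obtain ⟨a, ha0, ha⟩ : ∃ a : ENNReal, a ≠ 0 ∧ (4 + 2 * 2 ^ d) * a ^ 2 ≤ ε / 2 := by
    have hc : (4 + 2 * 2 ^ d : ENNReal) ≠ ⊤ := by finiteness
    have ht : Filter.Tendsto (fun a : ENNReal => (4 + 2 * 2 ^ d) * a ^ 2) (nhds 0)
        (nhds ((4 + 2 * 2 ^ d) * 0 ^ 2)) :=
      ENNReal.Tendsto.const_mul (((ENNReal.continuous_pow 2).tendsto 0)) (.inr hc)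
    have h2 : ∀ᶠ a : ENNReal in nhds 0, (4 + 2 * 2 ^ d) * a ^ 2 < ε / 2 :=
      ht.eventually_lt_const (by simpa using hε)
    obtain ⟨r, hr, hr'⟩ := (ENNReal.nhds_zero_basis.eventually_iff).1 h2
    obtain ⟨s, hs0, hsr⟩ := exists_between hr
    exact ⟨s, hs0.ne', (hr' hsr).le⟩
  obtain ⟨b, hb0, hb⟩ : ∃ b : ℝ, 0 < b ∧ 4 * ENNReal.ofReal (b ^ 2) * volume D ≤ ε / 2 := by
    have ht : Filter.Tendsto (fun b : ℝ => 4 * ENNReal.ofReal (b ^ 2) * volume D)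
        (nhds 0) (nhds (4 * ENNReal.ofReal (0 ^ 2) * volume D)) := by
      refine ENNReal.Tendsto.mul_const (ENNReal.Tendsto.const_mul ?_ (.inr (by finiteness)))
        (.inr hvol)
      exact (ENNReal.continuous_ofReal.comp (continuous_pow 2)).tendsto 0
    have h2 : ∀ᶠ b : ℝ in nhds 0, 4 * ENNReal.ofReal (b ^ 2) * volume D < ε / 2 :=
      ht.eventually_lt_const (by simpa using hε)
    obtain ⟨b, hb, hb'⟩ := ((h2.filter_mono nhdsWithin_le_nhds).and
      (self_mem_nhdsWithin (s := Set.Ioi (0 : ℝ)))).exists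
    exact ⟨b, hb', hb.le⟩
  obtain ⟨g, hgc, hga, hgcont, hg2⟩ :=
    hu2.exists_hasCompactSupport_eLpNorm_sub_le (by norm_num) ha0
  have hug : ∫⁻ x, ‖u x - g x‖ₑ ^ 2 ≤ a ^ 2 := by
    rw [← eLpNorm_two_sq]
    exact pow_le_pow_left' hga 2
  have huc : UniformContinuous g := hgc.uniformContinuous_of_continuous hgcont
  obtain ⟨θ, hθ, hgθ⟩ := Metric.uniformContinuous_iff.1 huc b hb0
  obtain ⟨R, hR⟩ := Metric.isBounded_iff.1 hbdd
  -- A homothety moves `x` by `δ ‖x - w‖`, at most `δ |R|` for `x` and `w` in `D`; this must stay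
  -- below the modulus of continuity `θ`. The bound 1/2 keeps the Jacobian factor below `2 ^ d`.
  let δ := min (1 / 2) (θ / (2 * (|R| + 1)))
  have hδ0 : 0 < δ := lt_min (by norm_num) (by positivity)
  have hδ2 : δ ≤ 1 / 2 := min_le_left _ _
  have hδθ : δ * (|R| + 1) < θ := by
    have : δ ≤ θ / (2 * (|R| + 1)) := min_le_right _ _
    calc δ * (|R| + 1) ≤ θ / (2 * (|R| + 1)) * (|R| + 1) := by gcongr
      _ = θ / 2 := by field_simp
      _ < θ := half_lt_self hθ
  refine ⟨δ, hδ0, hδ2, ?_⟩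
  have hsub : StronglyMeasurable fun x => u x - g x := hu.sub hgcont.stronglyMeasurable
  have hsq : Measurable fun x => ‖u x - g x‖ₑ ^ 2 := hsub.enorm.pow_const 2
  have key : ∀ w ∈ D, ∫⁻ x in D, ‖u x - u ((1 - δ) • x + δ • w)‖ₑ ^ 2 ≤ ε := by
    intro w hw
    have h1 : ∀ x ∈ D, ‖u x - u ((1 - δ) • x + δ • w)‖ₑ ^ 2 ≤
        4 * ‖u x - g x‖ₑ ^ 2 + 4 * ENNReal.ofReal (b ^ 2) +
          2 * ‖u ((1 - δ) • x + δ • w) - g ((1 - δ) • x + δ • w)‖ₑ ^ 2 := by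
      intro x hx
      set z := (1 - δ) • x + δ • w with hz
      have hgz : ‖g x - g z‖ₑ ^ 2 ≤ ENNReal.ofReal (b ^ 2) := by
        rw [enorm_sq_eq_ofReal]
        refine ENNReal.ofReal_le_ofReal ?_
        have hdist : dist x z < θ := by
          have : x - z = δ • (x - w) := by rw [hz]; module
          rw [dist_eq_norm, this, norm_smul, Real.norm_of_nonneg hδ0.le, ← dist_eq_norm]
          refine lt_of_le_of_lt ?_ hδθ
          gcongr
          exact (hR hx hw).trans ((le_abs_self R).trans (by linarith))
        have := (hgθ hdist).le
        rw [dist_eq_norm] at this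
        gcongr
      calc ‖u x - u z‖ₑ ^ 2 = ‖((u x - g x) + (g x - g z)) + -(u z - g z)‖ₑ ^ 2 := by
            congr 2; abel
        _ ≤ 2 * ‖(u x - g x) + (g x - g z)‖ₑ ^ 2 + 2 * ‖-(u z - g z)‖ₑ ^ 2 :=
            enorm_add_sq_le _ _
        _ ≤ 2 * (2 * ‖u x - g x‖ₑ ^ 2 + 2 * ‖g x - g z‖ₑ ^ 2) + 2 * ‖u z - g z‖ₑ ^ 2 := by
            rw [enorm_neg]
            gcongr
            exact enorm_add_sq_le _ _
        _ = 4 * ‖u x - g x‖ₑ ^ 2 + 4 * ‖g x - g z‖ₑ ^ 2 + 2 * ‖u z - g z‖ₑ ^ 2 := by ring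
        _ ≤ _ := by gcongr
    have hz2 : ∫⁻ x in D, ‖u ((1 - δ) • x + δ • w) - g ((1 - δ) • x + δ • w)‖ₑ ^ 2 ≤
        2 ^ d * a ^ 2 := by
      refine (setLIntegral_le_lintegral D _).trans ?_
      have := lintegral_comp_affine hsq (δ • w) (r := 1 - δ) (by linarith)
      simp only [add_comm (δ • w)] at this
      rw [this]
      refine mul_le_mul' ?_ hug
      rw [← inv_pow, ENNReal.ofReal_pow (by simp; linarith)]
      gcongr
      rw [show (2 : ENNReal) = ENNReal.ofReal 2 by simp]
      refine ENNReal.ofReal_le_ofReal ?_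
      rw [inv_le_comm₀ (by linarith) (by norm_num)]
      linarith
    calc ∫⁻ x in D, ‖u x - u ((1 - δ) • x + δ • w)‖ₑ ^ 2
        ≤ ∫⁻ x in D, (4 * ‖u x - g x‖ₑ ^ 2 + 4 * ENNReal.ofReal (b ^ 2) +
          2 * ‖u ((1 - δ) • x + δ • w) - g ((1 - δ) • x + δ • w)‖ₑ ^ 2) :=
          setLIntegral_mono' hD h1
      _ = 4 * (∫⁻ x in D, ‖u x - g x‖ₑ ^ 2) + 4 * ENNReal.ofReal (b ^ 2) * volume D +
          2 * ∫⁻ x in D, ‖u ((1 - δ) • x + δ • w) - g ((1 - δ) • x + δ • w)‖ₑ ^ 2 := by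
          have hsq4 : Measurable fun x => 4 * ‖u x - g x‖ₑ ^ 2 + 4 * ENNReal.ofReal (b ^ 2) :=
            (hsq.const_mul 4).add measurable_const
          rw [lintegral_add_left hsq4,
            lintegral_add_left (hsq.const_mul 4), lintegral_const_mul _ hsq, setLIntegral_const,
            lintegral_const_mul]
          exact hsq.comp (by fun_prop : Measurable fun x : Pt d => (1 - δ) • x + δ • w)
      _ ≤ 4 * a ^ 2 + ε / 2 + 2 * (2 ^ d * a ^ 2) := by
          gcongr
          exact (setLIntegral_le_lintegral D _).trans hug
      _ = (4 + 2 * 2 ^ d) * a ^ 2 + ε / 2 := by ring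
      _ ≤ ε / 2 + ε / 2 := by gcongr
      _ = ε := ENNReal.add_halves ε
  calc ∫⁻ x in D, ‖u x - mollify η δ u x‖ₑ ^ 2
      ≤ ∫⁻ x in D, ∫⁻ w, ‖u x - u ((1 - δ) • x + δ • w)‖ₑ ^ 2 ∂densityMeasure η :=
        lintegral_mono fun x => enorm_sub_integral_sq_le _ _
          (hu.comp_measurable (by fun_prop)).aestronglyMeasurable
    _ = ∫⁻ w, (∫⁻ x in D, ‖u x - u ((1 - δ) • x + δ • w)‖ₑ ^ 2) ∂densityMeasure η := by
        refine lintegral_lintegral_swap (Measurable.aemeasurable ?_)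
        have : StronglyMeasurable fun p : Pt d × Pt d =>
            u p.1 - u ((1 - δ) • p.1 + δ • p.2) :=
          (hu.comp_measurable measurable_fst).sub (hu.comp_measurable (by fun_prop))
        exact this.enorm.pow_const 2
    _ ≤ ∫⁻ _w, ε ∂densityMeasure η := lintegral_mono_ae (hη.ae_mem.mono key)
    _ = ε := by simp

end Mollification

/-! ### Taylor expansion of the mollification with weak derivatives in the remainder. -/

section Taylor

variable {d : ℕ} {F : Type*} [NormedAddCommGroup F] [InnerProductSpace ℝ F]

theorem multilinear_diag_eq_sum {m : ℕ}
    (L : ContinuousMultilinearMap ℝ (fun _ : Fin m => Pt d) ℝ) (v : Pt d) :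
    L (fun _ => v) = ∑ I : Fin m → Fin d,
      (∏ l, v (I l)) * L (fun l => EuclideanSpace.single (I l) (1 : ℝ)) := by
  have hv : v = ∑ i, v i • EuclideanSpace.single i (1 : ℝ) := by
    ext j
    simp [Pi.single_apply]
  conv_lhs => rw [hv]
  rw [L.map_sum]
  refine Finset.sum_congr rfl fun I _ => ?_
  rw [L.map_smul_univ, smul_eq_mul]

variable {D U : Set (Pt d)} {η : Pt d → ℝ}

theorem IsTestFunction.mono {φ : Pt d → ℝ} (hφ : IsTestFunction D φ) (h : D ⊆ U) :
    IsTestFunction U φ :=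
  ⟨hφ.1, hφ.2.1, hφ.2.2.trans h⟩

theorem IsTestFunction.eq_zero {φ : Pt d → ℝ} (hφ : IsTestFunction D φ) {x : Pt d}
    (hx : x ∉ D) : φ x = 0 := by
  by_contra h
  exact hx (hφ.2.2 (subset_tsupport _ h))

theorem IsTestFunction.iteratedFDeriv_eq_zero {φ : Pt d → ℝ} (hφ : IsTestFunction D φ) (j : ℕ)
    {x : Pt d} (hx : x ∉ D) : iteratedFDeriv ℝ j φ x = 0 := by
  by_contra h
  exact hx (hφ.2.2 (support_iteratedFDeriv_subset j h))

/-- If the kernel's argument is a point `w` of `tsupport η`, then `z = (1 - δ) x + δ w` is a convex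
combination of two points of `D`. No distance of `x` to the boundary of `D` is required. -/
theorem IsMollifier.isTestFunction (hη : IsMollifier D η) (hD : Convex ℝ D) {δ : ℝ}
    (hδ0 : 0 < δ) (hδ1 : δ < 1) {x : Pt d} (hx : x ∈ D) :
    IsTestFunction D fun z => η (δ⁻¹ • (z - (1 - δ) • x)) := by
  have hcl : Topology.IsClosedEmbedding fun z : Pt d => δ⁻¹ • (z - (1 - δ) • x) :=
    ((Homeomorph.subRight ((1 - δ) • x)).trans
      (Homeomorph.smulOfNeZero δ⁻¹ (inv_ne_zero hδ0.ne'))).isClosedEmbedding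
  refine ⟨hη.contDiff.comp (by fun_prop), hη.hasCompactSupport.comp_isClosedEmbedding hcl, ?_⟩
  intro z hz
  have hz' := hη.tsupport_subset (tsupport_comp_subset_preimage η hcl.continuous hz)
  have : z = (1 - δ) • x + δ • (δ⁻¹ • (z - (1 - δ) • x)) := by
    rw [smul_smul, mul_inv_cancel₀ hδ0.ne', one_smul, add_sub_cancel]
  rw [this]
  exact hD hx hz' (by linarith) hδ0.le (by ring)

theorem iteratedFDeriv_comp_shrink {f : Pt d → ℝ} (hf : ContDiff ℝ ∞ f) (m : ℕ) (r : ℝ)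
    (a z : Pt d) :
    iteratedFDeriv ℝ m (fun z => f (r • (z - a))) z = r ^ m • iteratedFDeriv ℝ m f (r • (z - a)) := by
  have h1 := iteratedFDeriv_comp_sub (𝕜 := ℝ) (f := fun z => f (r • z)) m a z
  rw [h1, iteratedFDeriv_comp_const_smul r (hf.of_le (by exact_mod_cast le_top))]

/-- Test functions and their derivatives vanish off `U`, so the integrals may run over the whole
space; restriction to smaller sets is then immediate. -/
theorem isWeakPartial_iff {u g : Pt d → F} {j : ℕ} {I : Fin j → Fin d} :
    IsWeakPartial U u I g ↔ ∀ φ : Pt d → ℝ, IsTestFunction U φ →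
      ∫ x, iteratedFDeriv ℝ j φ x (fun l => EuclideanSpace.single (I l) (1 : ℝ)) • u x
        = (-1 : ℝ) ^ j • ∫ x, φ x • g x := by
  refine forall₂_congr fun φ hφ => ?_
  rw [setIntegral_eq_integral_of_forall_compl_eq_zero (s := U),
    setIntegral_eq_integral_of_forall_compl_eq_zero (s := U)]
  · intro x hx
    rw [hφ.eq_zero hx, zero_smul]
  · intro x hx
    rw [hφ.iteratedFDeriv_eq_zero j hx, zero_apply, zero_smul]

theorem IsWeakPartial.mono {u g : Pt d → F} {j : ℕ} {I : Fin j → Fin d}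
    (h : IsWeakPartial U u I g) (hD : D ⊆ U) : IsWeakPartial D u I g :=
  isWeakPartial_iff.2 fun φ hφ => isWeakPartial_iff.1 h φ (hφ.mono hD)

theorem IsWeakPartial.congr {u g u' g' : Pt d → F} {j : ℕ} {I : Fin j → Fin d}
    (h : IsWeakPartial U u I g) (hu : u =ᵐ[volume.restrict U] u')
    (hg : g =ᵐ[volume.restrict U] g') : IsWeakPartial U u' I g' := by
  intro φ hφ
  have h1 : ∫ x in U, φ x • g x = ∫ x in U, φ x • g' x :=
    integral_congr_ae (hg.mono fun x hx => by simp only [hx])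
  rw [← h1, ← h φ hφ]
  exact (integral_congr_ae (hu.mono fun x hx => by simp only [hx])).symm

/-- The weak derivative is tested with the kernel. The chain rule contributes `δ⁻¹ ^ m`, the
integrations by parts `(-1) ^ m`, and the normalisation of `mollify` the factor `δ ^ d`. -/
theorem IsMollifier.integral_kernel_deriv (hη : IsMollifier D η) (hD : Convex ℝ D) {δ : ℝ}
    (hδ0 : 0 < δ) (hδ1 : δ < 1) {u g : Pt d → F} {m : ℕ} {I : Fin m → Fin d}
    (h : IsWeakPartial D u I g) {x : Pt d} (hx : x ∈ D) :
    ∫ z, iteratedFDeriv ℝ m η (δ⁻¹ • (z - (1 - δ) • x))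
        (fun l => EuclideanSpace.single (I l) (1 : ℝ)) • u z
      = ((-δ) ^ m * δ ^ d) • mollify η δ g x := by
  have h1 := isWeakPartial_iff.1 h _ (hη.isTestFunction hD hδ0 hδ1 hx)
  simp only [iteratedFDeriv_comp_shrink hη.contDiff, smul_apply,
    smul_assoc, integral_smul] at h1
  rw [hη.mollify_eq hδ0, smul_smul, mul_assoc, mul_inv_cancel₀ (pow_ne_zero _ hδ0.ne'), mul_one,
    neg_pow, mul_comm, mul_smul, ← h1, smul_smul, ← mul_pow, mul_inv_cancel₀ hδ0.ne', one_pow,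
    one_smul]

/-- The Taylor polynomial of degree `n` at `y` of the mollification of `u`. -/
def mollTaylor (η : Pt d → ℝ) (δ : ℝ) (n : ℕ) (u : Pt d → F) (y x : Pt d) : F :=
  ∑ k ∈ Finset.range (n + 1), ((k.factorial : ℝ)⁻¹ * (δ ^ d)⁻¹) •
    ∫ z, iteratedFDeriv ℝ k η (δ⁻¹ • (z - (1 - δ) • y))
      (fun _ => (-((1 - δ) / δ)) • (x - y)) • u z

theorem IsMollifier.integrable_kernel (hη : IsMollifier D η) {δ : ℝ} (hδ0 : 0 < δ)
    {u : Pt d → F} (hu : LocallyIntegrable u) (k : ℕ) (v : Fin k → Pt d) (y : Pt d) :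
    Integrable fun z => iteratedFDeriv ℝ k η (δ⁻¹ • (z - (1 - δ) • y)) v • u z := by
  have hcl : Topology.IsClosedEmbedding fun z : Pt d => δ⁻¹ • (z - (1 - δ) • y) :=
    ((Homeomorph.subRight ((1 - δ) • y)).trans
      (Homeomorph.smulOfNeZero δ⁻¹ (inv_ne_zero hδ0.ne'))).isClosedEmbedding
  refine hu.integrable_smul_left_of_hasCompactSupport ?_ ?_
  · have := hη.contDiff.continuous_iteratedFDeriv (m := k) (by exact_mod_cast le_top)
    exact (this.comp hcl.continuous).eval_const v
  · have := (hη.hasCompactSupport.iteratedFDeriv (𝕜 := ℝ) k).comp_isClosedEmbedding hcl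
    exact this.comp_left (g := fun L => L v) rfl

/-- Expanding each derivative in coordinates leaves products of at most `n` affine functions of `x`,
times vectors independent of `x`. -/
theorem IsMollifier.mollTaylor_mem (hη : IsMollifier D η) {δ : ℝ} (hδ0 : 0 < δ) (n : ℕ)
    {u : Pt d → F} (hu : LocallyIntegrable u) (y : Pt d) : mollTaylor η δ n u y ∈ polyF d F n := by
  have h : mollTaylor η δ n u y = ∑ k ∈ Finset.range (n + 1), ((k.factorial : ℝ)⁻¹ * (δ ^ d)⁻¹) •
      ∑ I : Fin k → Fin d, fun x => (∏ l, (-((1 - δ) / δ)) * (x (I l) - y (I l))) •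
        ∫ z, iteratedFDeriv ℝ k η (δ⁻¹ • (z - (1 - δ) • y))
          (fun l => EuclideanSpace.single (I l) (1 : ℝ)) • u z := by
    ext1 x
    simp only [mollTaylor, Finset.sum_apply, Pi.smul_apply]
    refine Finset.sum_congr rfl fun k _ => ?_
    congr 1
    simp only [multilinear_diag_eq_sum _ ((-((1 - δ) / δ)) • (x - y)), Finset.sum_smul, mul_smul]
    rw [integral_finsetSum]
    · refine Finset.sum_congr rfl fun I _ => ?_
      rw [integral_smul]
      simp
    · intro I _
      exact Integrable.smul (∏ l, ((-((1 - δ) / δ)) • (x - y)) (I l))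
        (hη.integrable_kernel hδ0 hu k _ y)
  rw [h]
  refine Submodule.sum_mem _ fun k hk => Submodule.smul_mem _ _ (Submodule.sum_mem _ fun I _ => ?_)
  refine polyF_mono (Finset.mem_range_succ_iff.1 hk) (smul_const_mem_polyF ?_ _)
  refine prod_mem_polyScalar fun l => ?_
  exact (polyScalar d 1).smul_mem _ (sub_mem (coord_mem_polyScalar (I l))
    (const_mem_polyScalar 1 (y (I l))))

/-- For each `z`, Taylor's formula is applied to `η` along the segment from its argument at `y` to
its argument at `x`. Integration against `u` turns the leading terms into `mollTaylor`; in the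
remainder, Fubini exchanges `t` and `z`, and the derivatives pass from `η` to `u`. -/
theorem IsMollifier.mollify_sub_mollTaylor [CompleteSpace F] (hη : IsMollifier D η)
    (hD : Convex ℝ D) (hDm : MeasurableSet D) (hbdd : Bornology.IsBounded D) {δ : ℝ} (hδ0 : 0 < δ)
    (hδ1 : δ < 1) {n : ℕ} {u : Pt d → F}
    {g : (Fin (n + 1) → Fin d) → Pt d → F} (hu : MemLp u 2 volume)
    (hg : ∀ I, IsWeakPartial D u I (g I)) {x y : Pt d} (hx : x ∈ D) (hy : y ∈ D) :
    mollify η δ u x - mollTaylor η δ n u y x =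
      (n.factorial : ℝ)⁻¹ • ∫ t in (0 : ℝ)..1, ((1 - t) ^ n * (1 - δ) ^ (n + 1)) •
        ∑ I, (∏ l, (x (I l) - y (I l))) • mollify η δ (g I) (y + t • (x - y)) := by
  have hul : LocallyIntegrable u := hu.locallyIntegrable (by norm_num)
  set v : Pt d := (-((1 - δ) / δ)) • (x - y) with hv
  set a : Pt d → Pt d := fun z => δ⁻¹ • (z - (1 - δ) • y) with ha
  -- Moving the centre from `y` towards `x` moves the argument of `η` along the constant direction
  -- `v`.
  have hav : ∀ (t : ℝ) (z : Pt d), a z + t • v = δ⁻¹ • (z - (1 - δ) • (y + t • (x - y))) := by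
    intro t z
    simp only [ha, hv]
    have h1 : (1 - δ) / δ = δ⁻¹ * (1 - δ) := by ring
    rw [h1]
    module
  have hcont : Continuous (iteratedFDeriv ℝ (n + 1) η) :=
    hη.contDiff.continuous_iteratedFDeriv (by exact_mod_cast le_top)
  have hmem : ∀ t ∈ Set.uIoc (0 : ℝ) 1, y + t • (x - y) ∈ D := by
    intro t ht
    rw [Set.uIoc_of_le zero_le_one] at ht
    have : y + t • (x - y) = (1 - t) • y + t • x := by module
    rw [this]
    exact hD hy hx (by linarith [ht.2]) ht.1.le (by ring)
  -- the remainder of the Taylor expansion of the kernel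
  set K : ℝ → Pt d → ℝ := fun t z =>
    (1 - t) ^ n * iteratedFDeriv ℝ (n + 1) η (a z + t • v) (fun _ => v) with hK
  have hKint : Integrable (Function.uncurry fun t z => K t z • u z)
      ((volume.restrict (Set.uIoc (0 : ℝ) 1)).prod volume) := by
    obtain ⟨B, hB⟩ := (hcont.bounded_above_of_compact_support
      (hη.hasCompactSupport.iteratedFDeriv (n + 1)))
    have hB0 : 0 ≤ B := (norm_nonneg _).trans (hB 0)
    have hfin : IsFiniteMeasure (volume.restrict D) := ⟨by simpa using hbdd.measure_lt_top⟩
    have huD : Integrable (D.indicator fun z => ‖u z‖) := by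
      rw [integrable_indicator_iff hDm]
      exact ((hu.restrict D).integrable (by norm_num)).norm
    have hdom : Integrable (fun p : ℝ × Pt d => (B * ‖v‖ ^ (n + 1)) * D.indicator (fun z => ‖u z‖) p.2)
        ((volume.restrict (Set.uIoc (0 : ℝ) 1)).prod volume) := by
      have : IsFiniteMeasure (volume.restrict (Set.uIoc (0 : ℝ) 1)) :=
        ⟨by simp [Set.uIoc_of_le]⟩
      exact (huD.comp_snd _).const_mul _
    refine hdom.mono' ?_ ?_
    · have hKc : Continuous (Function.uncurry K) := by
        refine Continuous.mul (by fun_prop) ?_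
        exact (hcont.comp (by fun_prop : Continuous fun p : ℝ × Pt d => a p.2 + p.1 • v)).eval_const _
      exact hKc.aestronglyMeasurable.smul hu.1.comp_snd
    · have : ∀ᵐ p : ℝ × Pt d ∂((volume.restrict (Set.uIoc (0 : ℝ) 1)).prod volume),
          p.1 ∈ Set.uIoc (0 : ℝ) 1 :=
        Measure.quasiMeasurePreserving_fst.ae (ae_restrict_mem measurableSet_uIoc)
      filter_upwards [this] with p hp
      obtain ⟨t, z⟩ := p
      simp only [Function.uncurry, norm_smul]
      by_cases hz : z ∈ D
      · rw [Set.indicator_of_mem hz]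
        gcongr
        rw [hK]
        simp only [norm_mul, norm_pow]
        rw [Set.uIoc_of_le zero_le_one] at hp
        have h1 : ‖1 - t‖ ≤ 1 := by
          rw [Real.norm_eq_abs, abs_le]
          constructor <;> linarith [hp.1, hp.2]
        have h2 := (iteratedFDeriv ℝ (n + 1) η (a z + t • v)).le_opNorm (fun _ => v)
        rw [Finset.prod_const, Finset.card_univ, Fintype.card_fin] at h2
        calc ‖1 - t‖ ^ n * ‖iteratedFDeriv ℝ (n + 1) η (a z + t • v) fun _ => v‖
            ≤ 1 * (B * ‖v‖ ^ (n + 1)) := by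
              refine mul_le_mul (pow_le_one₀ (norm_nonneg _) h1) (h2.trans ?_) (norm_nonneg _)
                zero_le_one
              gcongr
              exact hB _
          _ = _ := one_mul _
      · have h0 : iteratedFDeriv ℝ (n + 1) η (a z + t • v) = 0 := by
          rw [hav]
          have h1 := (hη.isTestFunction hD hδ0 hδ1 (hmem t hp)).iteratedFDeriv_eq_zero (n + 1) hz
          rw [iteratedFDeriv_comp_shrink hη.contDiff] at h1
          exact (smul_eq_zero.1 h1).resolve_left (pow_ne_zero _ (inv_ne_zero hδ0.ne'))
        rw [Set.indicator_of_notMem hz, hK]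
        simp [h0]
  have htaylor : ∀ z, η (δ⁻¹ • (z - (1 - δ) • x)) =
      ∑ k ∈ Finset.range (n + 1), (k.factorial : ℝ)⁻¹ • iteratedFDeriv ℝ k η (a z) (fun _ => v) +
        (n.factorial : ℝ)⁻¹ • ∫ t in (0 : ℝ)..1, K t z := by
    intro z
    have h1 := map_add_eq_sum_add_integral_iteratedFDeriv (f := η) (x := a z) (y := v) (n := n)
      (fun t _ => (hη.contDiff.of_le (by exact_mod_cast le_top)).contDiffAt)
    have h2 := hav 1 z
    rw [one_smul, one_smul, add_sub_cancel] at h2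
    rw [h2] at h1
    exact h1
  have hsplit : ∫ z, η (δ⁻¹ • (z - (1 - δ) • x)) • u z =
      (∑ k ∈ Finset.range (n + 1), (k.factorial : ℝ)⁻¹ •
        ∫ z, iteratedFDeriv ℝ k η (a z) (fun _ => v) • u z) +
        (n.factorial : ℝ)⁻¹ • ∫ z, (∫ t in (0 : ℝ)..1, K t z • u z) := by
    simp only [htaylor, add_smul, Finset.sum_smul, smul_assoc, ← intervalIntegral.integral_smul_const]
    have hk : ∀ k ∈ Finset.range (n + 1), Integrable fun z =>
        (k.factorial : ℝ)⁻¹ • iteratedFDeriv ℝ k η (a z) (fun _ => v) • u z :=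
      fun k _ => (hη.integrable_kernel hδ0 hul k _ y).smul _
    have hr : Integrable fun z => (n.factorial : ℝ)⁻¹ • ∫ t in (0 : ℝ)..1, K t z • u z := by
      refine Integrable.smul _ ?_
      simp only [intervalIntegral.integral_of_le zero_le_one]
      rw [Set.uIoc_of_le zero_le_one] at hKint
      exact hKint.integral_prod_right
    rw [integral_add (integrable_finsetSum _ hk) hr, integral_finsetSum _ hk]
    simp only [integral_smul]
  have hswap : ∫ z, (∫ t in (0 : ℝ)..1, K t z • u z) =
      ∫ t in (0 : ℝ)..1, (δ ^ d * ((1 - t) ^ n * (1 - δ) ^ (n + 1))) •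
        ∑ I, (∏ l, (x (I l) - y (I l))) • mollify η δ (g I) (y + t • (x - y)) := by
    rw [← intervalIntegral_integral_swap hKint]
    refine intervalIntegral.integral_congr_ae (Filter.Eventually.of_forall fun t ht => ?_)
    simp only [hK, mul_smul, integral_smul, multilinear_diag_eq_sum _ v, Finset.sum_smul, hav]
    rw [integral_finsetSum]
    · simp only [integral_smul, hη.integral_kernel_deriv hD hδ0 hδ1 (hg _) (hmem t ht),
        Finset.smul_sum]
      simp only [smul_smul]
      refine Finset.sum_congr rfl fun I _ => ?_
      congr 1
      have h1 : ∏ l, v (I l) = (-((1 - δ) / δ)) ^ (n + 1) * ∏ l, (x (I l) - y (I l)) := by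
        simp only [hv, PiLp.smul_apply, PiLp.sub_apply, smul_eq_mul, Finset.prod_mul_distrib,
          Finset.prod_const, Finset.card_univ, Fintype.card_fin]
      -- The negative powers of `δ` from differentiating the kernel cancel those from the
      -- integration by parts; the remainder stays bounded as `δ` tends to zero.
      have h2 : (-((1 - δ) / δ)) ^ (n + 1) * (-δ) ^ (n + 1) = (1 - δ) ^ (n + 1) := by
        rw [← mul_pow]
        congr 1
        field_simp
      rw [h1, ← h2]
      ring
    · intro I _
      exact Integrable.smul (∏ l, v (I l)) (hη.integrable_kernel hδ0 hul _ _ _)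
  simp only [mul_smul (δ ^ d), intervalIntegral.integral_smul] at hswap
  rw [hη.mollify_eq hδ0, hsplit, hswap, mollTaylor, smul_add, Finset.smul_sum]
  simp only [smul_smul]
  have hδd : δ ^ d ≠ 0 := pow_ne_zero _ hδ0.ne'
  rw [add_sub_right_comm, add_eq_right.2]
  · congr 1
    field_simp
  · rw [sub_eq_zero]
    refine Finset.sum_congr rfl fun k _ => ?_
    rw [mul_comm]

end Taylor

/-! ### The Bramble–Hilbert lemma on convex sets. -/

section BrambleHilbert

variable {d : ℕ} {F : Type*} [NormedAddCommGroup F] [InnerProductSpace ℝ F]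
variable {D : Set (Pt d)} {η : Pt d → ℝ}

theorem ofReal_inv_pow_le {r : ℝ} (hr : 1 / 2 ≤ r) (d : ℕ) :
    ENNReal.ofReal (r ^ d)⁻¹ ≤ 2 ^ d := by
  rw [show (2 : ENNReal) = ENNReal.ofReal 2 by simp, ← ENNReal.ofReal_pow (by norm_num)]
  refine ENNReal.ofReal_le_ofReal ?_
  rw [← inv_pow]
  have : 0 < r := by linarith
  gcongr
  rw [inv_le_comm₀ this (by norm_num)]
  linarith

/-- The point is `(1 - t) y + t x`, and one of the two weights is at least 1/2. Substituting in that
variable costs at most `2 ^ d`, so no singular factor `t ^ (-d)` appears. -/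
theorem lintegral_segment_le {G : Pt d → ENNReal} (hG : Measurable G) {t : ℝ} :
    ∫⁻ y in D, ∫⁻ x in D, G (y + t • (x - y)) ≤ 2 ^ d * volume D * ∫⁻ x, G x := by
  have hfin : ∀ (r : ℝ), 1 / 2 ≤ r → ∀ a : Pt d,
      ∫⁻ x in D, G (a + r • x) ≤ 2 ^ d * ∫⁻ x, G x := by
    intro r hr a
    refine (setLIntegral_le_lintegral D _).trans ?_
    rw [lintegral_comp_affine hG a (by linarith)]
    gcongr
    exact ofReal_inv_pow_le hr d
  have hconst : ∫⁻ _y in D, 2 ^ d * ∫⁻ x, G x = 2 ^ d * volume D * ∫⁻ x, G x := by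
    rw [setLIntegral_const]
    ring
  rcases le_total (1 / 2) t with ht | ht
  · rw [← hconst]
    refine lintegral_mono fun y => ?_
    have := hfin t ht ((1 - t) • y)
    refine le_trans (le_of_eq ?_) this
    refine lintegral_congr fun x => ?_
    congr 1
    module
  · have hm : Measurable (Function.uncurry fun y x : Pt d => G (y + t • (x - y))) :=
      hG.comp (by fun_prop : Measurable fun p : Pt d × Pt d => p.1 + t • (p.2 - p.1))
    rw [lintegral_lintegral_swap hm.aemeasurable, ← hconst]
    refine lintegral_mono fun x => ?_
    have := hfin (1 - t) (by linarith) (t • x)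
    refine le_trans (le_of_eq ?_) this
    refine lintegral_congr fun x => ?_
    congr 1
    module

/-- Jensen in `t`, then Cauchy–Schwarz over the `d ^ (n + 1)` index tuples; each coordinate of `x -
y` is at most `h`, and the remaining scalar factors are at most 1. -/
theorem IsMollifier.enorm_mollify_sub_mollTaylor_sq_le [CompleteSpace F] (hη : IsMollifier D η)
    (hD : Convex ℝ D) (hDm : MeasurableSet D) (hbdd : Bornology.IsBounded D) {h : ℝ}
    (hh : ∀ x ∈ D, ∀ y ∈ D, ‖x - y‖ ≤ h) {δ : ℝ} (hδ0 : 0 < δ)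
    (hδ1 : δ < 1) {n : ℕ} {u : Pt d → F}
    {g : (Fin (n + 1) → Fin d) → Pt d → F} (hu : MemLp u 2 volume)
    (hgm : ∀ I, StronglyMeasurable (g I))
    (hg : ∀ I, IsWeakPartial D u I (g I)) {x y : Pt d} (hx : x ∈ D) (hy : y ∈ D) :
    ‖mollify η δ u x - mollTaylor η δ n u y x‖ₑ ^ 2 ≤
      ENNReal.ofReal ((d : ℝ) ^ (n + 1) * h ^ (2 * (n + 1))) *
        ∫⁻ t in Set.Ioc (0 : ℝ) 1, ∑ I, ‖mollify η δ (g I) (y + t • (x - y))‖ₑ ^ 2 := by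
  have h0 : 0 ≤ h := (norm_nonneg _).trans (hh x hx y hy)
  have hprob : IsProbabilityMeasure (volume.restrict (Set.Ioc (0 : ℝ) 1)) := ⟨by simp⟩
  have hfac : ‖(n.factorial : ℝ)⁻¹‖ₑ ≤ 1 := by
    rw [← ofReal_norm, Real.norm_of_nonneg (by positivity)]
    refine ENNReal.ofReal_le_one.2 (inv_le_one_of_one_le₀ ?_)
    exact_mod_cast n.factorial_pos
  have hcoord : ∀ I : Fin (n + 1) → Fin d, ‖∏ l, (x (I l) - y (I l))‖ ≤ h ^ (n + 1) := by
    intro I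
    rw [norm_prod]
    calc ∏ l, ‖x (I l) - y (I l)‖ ≤ ∏ _l : Fin (n + 1), h := by
          refine Finset.prod_le_prod (fun _ _ => norm_nonneg _) fun l _ => ?_
          exact (PiLp.norm_apply_le (x - y) (I l)).trans (hh x hx y hy)
      _ = h ^ (n + 1) := by simp
  rw [hη.mollify_sub_mollTaylor hD hDm hbdd hδ0 hδ1 hu hg hx hy, enorm_smul,
    intervalIntegral.integral_of_le zero_le_one, mul_pow]
  have hsm : ∀ I, StronglyMeasurable fun t : ℝ => mollify η δ (g I) (y + t • (x - y)) := fun I =>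
    (hη.stronglyMeasurable_mollify (hgm I)).comp_measurable (by fun_prop)
  have hmeas : StronglyMeasurable fun t : ℝ => ((1 - t) ^ n * (1 - δ) ^ (n + 1)) •
      ∑ I, (∏ l, (x (I l) - y (I l))) • mollify η δ (g I) (y + t • (x - y)) := by
    refine StronglyMeasurable.smul
      (Continuous.stronglyMeasurable (by fun_prop)) ?_
    exact Finset.stronglyMeasurable_fun_sum _ fun I _ => (hsm I).const_smul _
  calc ‖(n.factorial : ℝ)⁻¹‖ₑ ^ 2 * ‖∫ t in Set.Ioc (0 : ℝ) 1, ((1 - t) ^ n * (1 - δ) ^ (n + 1)) •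
        ∑ I, (∏ l, (x (I l) - y (I l))) • mollify η δ (g I) (y + t • (x - y))‖ₑ ^ 2
      ≤ 1 * ∫⁻ t in Set.Ioc (0 : ℝ) 1, ‖((1 - t) ^ n * (1 - δ) ^ (n + 1)) •
        ∑ I, (∏ l, (x (I l) - y (I l))) • mollify η δ (g I) (y + t • (x - y))‖ₑ ^ 2 := by
        refine mul_le_mul' (pow_le_one₀ (zero_le) hfac) ?_
        exact enorm_integral_sq_le _ hmeas.aestronglyMeasurable
    _ ≤ ∫⁻ t in Set.Ioc (0 : ℝ) 1, ENNReal.ofReal ((d : ℝ) ^ (n + 1) * h ^ (2 * (n + 1))) *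
          ∑ I, ‖mollify η δ (g I) (y + t • (x - y))‖ₑ ^ 2 := by
        rw [one_mul]
        refine setLIntegral_mono' measurableSet_Ioc fun t ht => ?_
        simp only [enorm_sq_eq_ofReal]
        rw [← ENNReal.ofReal_sum_of_nonneg (fun _ _ => by positivity),
          ← ENNReal.ofReal_mul (by positivity)]
        refine ENNReal.ofReal_le_ofReal ?_
        have ht1 : ‖(1 - t) ^ n * (1 - δ) ^ (n + 1)‖ ≤ 1 := by
          rw [norm_mul, norm_pow, norm_pow, Real.norm_of_nonneg (by linarith [ht.2]),
            Real.norm_of_nonneg (by linarith)]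
          exact mul_le_one₀ (pow_le_one₀ (by linarith [ht.2]) (by linarith [ht.1]))
            (by have : 0 ≤ 1 - δ := by linarith
                positivity)
            (pow_le_one₀ (by linarith) (by linarith))
        have hsum : ‖∑ I, (∏ l, (x (I l) - y (I l))) • mollify η δ (g I) (y + t • (x - y))‖ ≤
            h ^ (n + 1) * ∑ I, ‖mollify η δ (g I) (y + t • (x - y))‖ := by
          rw [Finset.mul_sum]
          refine norm_sum_le_of_le _ fun I _ => ?_
          rw [norm_smul]
          gcongr
          exact hcoord I
        have hcs := sq_sum_le_card_mul_sum_sq (s := (Finset.univ : Finset (Fin (n + 1) → Fin d)))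
          (f := fun I => ‖mollify η δ (g I) (y + t • (x - y))‖)
        simp only [Finset.card_univ, Fintype.card_fun, Fintype.card_fin, Nat.cast_pow] at hcs
        calc ‖((1 - t) ^ n * (1 - δ) ^ (n + 1)) •
              ∑ I, (∏ l, (x (I l) - y (I l))) • mollify η δ (g I) (y + t • (x - y))‖ ^ 2
            ≤ (1 * (h ^ (n + 1) * ∑ I, ‖mollify η δ (g I) (y + t • (x - y))‖)) ^ 2 := by
              rw [norm_smul]
              gcongr
          _ = h ^ (2 * (n + 1)) * (∑ I, ‖mollify η δ (g I) (y + t • (x - y))‖) ^ 2 := by ring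
          _ ≤ h ^ (2 * (n + 1)) * ((d : ℝ) ^ (n + 1) *
                ∑ I, ‖mollify η δ (g I) (y + t • (x - y))‖ ^ 2) := by gcongr
          _ = _ := by ring
    _ = _ := lintegral_const_mul' _ _ ENNReal.ofReal_ne_top

theorem lintegral_setLIntegral_segment_le {G : Pt d → ENNReal} (hG : Measurable G) :
    ∫⁻ y in D, ∫⁻ x in D, ∫⁻ t in Set.Ioc (0 : ℝ) 1, G (y + t • (x - y)) ≤
      2 ^ d * volume D * ∫⁻ x, G x := by
  have h1 : ∀ y, ∫⁻ x in D, ∫⁻ t in Set.Ioc (0 : ℝ) 1, G (y + t • (x - y)) =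
      ∫⁻ t in Set.Ioc (0 : ℝ) 1, ∫⁻ x in D, G (y + t • (x - y)) := fun y => by
    have hm : Measurable (Function.uncurry fun (x : Pt d) (t : ℝ) => G (y + t • (x - y))) :=
      hG.comp (by fun_prop : Measurable fun p : Pt d × ℝ => y + p.2 • (p.1 - y))
    exact lintegral_lintegral_swap hm.aemeasurable
  have h2 : Measurable (Function.uncurry fun (y : Pt d) (t : ℝ) =>
      ∫⁻ x in D, G (y + t • (x - y))) := by
    have hm : Measurable fun p : (Pt d × ℝ) × Pt d => G (p.1.1 + p.1.2 • (p.2 - p.1.1)) :=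
      hG.comp (by fun_prop)
    exact hm.lintegral_prod_right'
  calc ∫⁻ y in D, ∫⁻ x in D, ∫⁻ t in Set.Ioc (0 : ℝ) 1, G (y + t • (x - y))
      = ∫⁻ y in D, ∫⁻ t in Set.Ioc (0 : ℝ) 1, ∫⁻ x in D, G (y + t • (x - y)) :=
        lintegral_congr h1
    _ = ∫⁻ t in Set.Ioc (0 : ℝ) 1, ∫⁻ y in D, ∫⁻ x in D, G (y + t • (x - y)) :=
        lintegral_lintegral_swap h2.aemeasurable
    _ ≤ ∫⁻ _t in Set.Ioc (0 : ℝ) 1, 2 ^ d * volume D * ∫⁻ z, G z :=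
        lintegral_mono fun t => lintegral_segment_le hG
    _ = _ := by simp

theorem measurable_segment_integral {G : Pt d → ENNReal} (hG : Measurable G) :
    Measurable fun p : Pt d × Pt d => ∫⁻ t in Set.Ioc (0 : ℝ) 1, G (p.1 + t • (p.2 - p.1)) := by
  have hm : Measurable fun p : (Pt d × Pt d) × ℝ => G (p.1.1 + p.2 • (p.1.2 - p.1.1)) :=
    hG.comp (by fun_prop)
  exact hm.lintegral_prod_right'

/-- Some centre `y` does no worse than the average over `D`, which cancels the volume of `D` in the
double integral. -/
theorem exists_segment_integral_le (hDo : IsOpen D) (hbdd : Bornology.IsBounded D)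
    (hne : D.Nonempty) {G : Pt d → ENNReal} (hG : Measurable G) :
    ∃ y ∈ D, ∫⁻ x in D, ∫⁻ t in Set.Ioc (0 : ℝ) 1, G (y + t • (x - y)) ≤
      2 ^ d * ∫⁻ x, G x := by
  have hHm : Measurable fun y => ∫⁻ x in D, ∫⁻ t in Set.Ioc (0 : ℝ) 1, G (y + t • (x - y)) :=
    (measurable_segment_integral hG).lintegral_prod_right'
  obtain ⟨y, hy, hyH⟩ := exists_le_setLAverage (μ := volume) (hDo.measure_pos volume hne).ne'
    hbdd.measure_lt_top.ne hHm.aemeasurable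
  refine ⟨y, hy, hyH.trans ?_⟩
  rw [setLAverage_eq]
  refine ENNReal.div_le_of_le_mul ((lintegral_setLIntegral_segment_le hG).trans (le_of_eq ?_))
  ring

/-- Split `u - q` at the mollification: the first part is at most `ε` for small `δ`, the second is
the Taylor remainder at a good centre. One factor `2 ^ d` comes from the averaging over segments,
the other from the `L²` bound of the mollified derivatives. -/
theorem exists_polynomial_lintegral_le [CompleteSpace F] [FiniteDimensional ℝ F] (hDo : IsOpen D)
    (hD : Convex ℝ D)
    (hbdd : Bornology.IsBounded D) (hne : D.Nonempty) {h : ℝ}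
    (hh : ∀ x ∈ D, ∀ y ∈ D, ‖x - y‖ ≤ h) {n : ℕ} {u : Pt d → F}
    {g : (Fin (n + 1) → Fin d) → Pt d → F} (hum : StronglyMeasurable u) (hu : MemLp u 2 volume)
    (hgm : ∀ I, StronglyMeasurable (g I)) (hg : ∀ I, IsWeakPartial D u I (g I))
    {ε : ENNReal} (hε : ε ≠ 0) :
    ∃ q ∈ polyF d F n, ∫⁻ x in D, ‖u x - q x‖ₑ ^ 2 ≤ 2 * ε +
      2 * (ENNReal.ofReal ((d : ℝ) ^ (n + 1) * h ^ (2 * (n + 1))) *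
        (2 ^ d * (2 ^ d * ∑ I, ∫⁻ x, ‖g I x‖ₑ ^ 2))) := by
  obtain ⟨η, hη⟩ := exists_isMollifier hDo hne
  obtain ⟨δ, hδ0, hδ2, hδ⟩ := hη.exists_mollify_approx hDo.measurableSet hbdd hum hu hε
  have hδ1 : δ < 1 := by linarith
  have hmeas : ∀ I, Measurable fun z => ‖mollify η δ (g I) z‖ₑ ^ 2 := fun I =>
    (hη.stronglyMeasurable_mollify (hgm I)).enorm.pow_const 2
  have hbound := fun x y => hη.enorm_mollify_sub_mollTaylor_sq_le hD hDo.measurableSet hbdd hh hδ0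
    hδ1 hu hgm hg (x := x) (y := y)
  generalize ENNReal.ofReal ((d : ℝ) ^ (n + 1) * h ^ (2 * (n + 1))) = A at hbound ⊢
  obtain ⟨G, hGdef⟩ : ∃ G : Pt d → ENNReal, ∀ z, G z = ∑ I, ‖mollify η δ (g I) z‖ₑ ^ 2 :=
    ⟨_, fun _ => rfl⟩
  simp only [← hGdef] at hbound
  have hGm : Measurable G := by
    rw [funext hGdef]
    exact Finset.measurable_fun_sum _ fun I _ => hmeas I
  have hG : ∫⁻ z, G z ≤ 2 ^ d * ∑ I, ∫⁻ x, ‖g I x‖ₑ ^ 2 := by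
    simp only [hGdef]
    rw [lintegral_finsetSum _ fun I _ => hmeas I, Finset.mul_sum]
    refine Finset.sum_le_sum fun I _ => (hη.lintegral_mollify_le hδ1 (hgm I)).trans ?_
    gcongr
    exact ofReal_inv_pow_le (by linarith) d
  obtain ⟨y, hy, hyH⟩ := exists_segment_integral_le hDo hbdd hne hGm
  refine ⟨mollTaylor η δ n u y, hη.mollTaylor_mem hδ0 n (hu.locallyIntegrable (by norm_num)) y, ?_⟩
  calc ∫⁻ x in D, ‖u x - mollTaylor η δ n u y x‖ₑ ^ 2
      ≤ ∫⁻ x in D, (2 * ‖u x - mollify η δ u x‖ₑ ^ 2 +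
          2 * (A * ∫⁻ t in Set.Ioc (0 : ℝ) 1, G (y + t • (x - y)))) := by
        refine setLIntegral_mono' hDo.measurableSet fun x hx => ?_
        have := enorm_add_sq_le (u x - mollify η δ u x)
          (mollify η δ u x - mollTaylor η δ n u y x)
        rw [sub_add_sub_cancel] at this
        refine this.trans ?_
        gcongr
        exact hbound x y hx hy
    _ = 2 * (∫⁻ x in D, ‖u x - mollify η δ u x‖ₑ ^ 2) + 2 * (A *
          ∫⁻ x in D, ∫⁻ t in Set.Ioc (0 : ℝ) 1, G (y + t • (x - y))) := by
        have hm1 : Measurable fun x => ‖u x - mollify η δ u x‖ₑ ^ 2 :=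
          (hum.sub (hη.stronglyMeasurable_mollify hum)).enorm.pow_const 2
        have hm2 : Measurable fun x => ∫⁻ t in Set.Ioc (0 : ℝ) 1, G (y + t • (x - y)) :=
          (measurable_segment_integral hGm).comp (by fun_prop : Measurable fun x : Pt d => (y, x))
        rw [lintegral_add_left (hm1.const_mul 2), lintegral_const_mul _ hm1,
          lintegral_const_mul _ (hm2.const_mul A), lintegral_const_mul _ hm2]
    _ ≤ 2 * ε + 2 * (A * (2 ^ d * (2 ^ d * ∑ I, ∫⁻ x, ‖g I x‖ₑ ^ 2))) := by
        gcongr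
        exact hyH.trans (by gcongr)

theorem sqInt_eq_toReal {S : Set (Pt d)} {u : Pt d → F} (hu : MemL2 S u) :
    sqInt S u = (∫⁻ x in S, ‖u x‖ₑ ^ 2).toReal := by
  unfold sqInt
  rw [integral_eq_lintegral_of_nonneg_ae (Filter.Eventually.of_forall fun _ => sq_nonneg _)
    hu.integrable_sq.1]
  simp only [enorm_sq_eq_ofReal]

theorem lintegral_enorm_sq_ne_top {S : Set (Pt d)} {u : Pt d → F} (hu : MemL2 S u) :
    ∫⁻ x in S, ‖u x‖ₑ ^ 2 ≠ ⊤ :=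
  ((memLp_two_iff hu.1).1 hu).ne

/-- The Bramble–Hilbert lemma on bounded open convex sets, with a constant that depends on the
dimension and the order only. -/
theorem exists_polynomial_approx [FiniteDimensional ℝ F] (hDo : IsOpen D) (hD : Convex ℝ D)
    (hbdd : Bornology.IsBounded D) {h : ℝ} (h0 : 0 < h)
    (hh : ∀ x ∈ D, ∀ y ∈ D, ‖x - y‖ ≤ h) {m : ℕ} {u : Pt d → F}
    {g : (Fin m → Fin d) → Pt d → F} (hu : MemL2 D u)
    (hg2 : ∀ I, MemL2 D (g I)) (hg : ∀ I, IsWeakPartial D u I (g I)) :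
    ∃ q ∈ polyF d F (m - 1), sqInt D (fun x => u x - q x) ≤
      (2 * 4 ^ d * d ^ m + 2) * h ^ (2 * m) * (sqInt D u + ∑ I, sqInt D (g I)) := by
  have := FiniteDimensional.complete ℝ F
  have hsum0 : 0 ≤ ∑ I, sqInt D (g I) := Finset.sum_nonneg fun _ _ => sqInt_nonneg _ _
  have hu0 := sqInt_nonneg D u
  have hC : (0 : ℝ) ≤ 2 * 4 ^ d * d ^ m := by positivity
  -- The tolerance chosen below is a multiple of `sqInt D u` and must be positive, so the null case
  -- is treated apart. Order `m = 0` is also separate: there the zero polynomial suffices, and the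
  -- truncated `m - 1` is 0.
  rcases hu0.eq_or_lt with hz | hpos
  · refine ⟨0, zero_mem _, ?_⟩
    simp only [Pi.zero_apply, sub_zero, ← hz]
    positivity
  rcases m with _ | n
  · refine ⟨0, zero_mem _, ?_⟩
    simp only [Pi.zero_apply, sub_zero, mul_zero, pow_zero, mul_one]
    nlinarith [show (0 : ℝ) ≤ 2 * 4 ^ d by positivity]
  have hne : D.Nonempty := by
    by_contra hne
    rw [Set.not_nonempty_iff_eq_empty] at hne
    simp [sqInt, hne] at hpos
  have hDm := hDo.measurableSet
  -- strongly measurable representatives that vanish off `D`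
  have hrep : ∀ {f : Pt d → F}, MemL2 D f → ∃ f', StronglyMeasurable f' ∧ MemLp f' 2 volume ∧
      f =ᵐ[volume.restrict D] f' ∧ ∫⁻ x, ‖f' x‖ₑ ^ 2 = ∫⁻ x in D, ‖f x‖ₑ ^ 2 := by
    intro f hf
    have hae : f =ᵐ[volume.restrict D] D.indicator (hf.1.mk f) :=
      hf.1.ae_eq_mk.trans (indicator_ae_eq_restrict hDm).symm
    refine ⟨D.indicator (hf.1.mk f), hf.1.stronglyMeasurable_mk.indicator hDm, ?_, hae, ?_⟩
    · rw [memLp_indicator_iff_restrict hDm]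
      exact (memLp_congr_ae hf.1.ae_eq_mk).1 hf
    · rw [lintegral_congr_ae (hae.mono fun x hx => by simp only [hx] :
        ∀ᵐ x ∂volume.restrict D, ‖f x‖ₑ ^ 2 = ‖D.indicator (hf.1.mk f) x‖ₑ ^ 2),
        ← lintegral_indicator hDm]
      refine lintegral_congr fun x => ?_
      by_cases hx : x ∈ D <;> simp [hx]
  obtain ⟨u', hum, hu2, huu, -⟩ := hrep hu
  choose g' hgm _ hgg hgint using fun I => hrep (hg2 I)
  -- No limit `δ → 0` is taken: the mollification error is absorbed in the zeroth-order term of the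
  -- right-hand side, whence the summand 2 in the constant.
  let ε : ℝ := h ^ (2 * (n + 1)) * sqInt D u
  have hε : 0 < ε := by positivity
  obtain ⟨q, hq, hle⟩ := exists_polynomial_lintegral_le hDo hD hbdd hne hh hum hu2 hgm
    (fun I => (hg I).congr huu (hgg I)) (ENNReal.ofReal_pos.2 hε).ne'
  refine ⟨q, by simpa using hq, ?_⟩
  have hq2 : MemL2 D q := memL2_of_mem_polyF hq hbdd
  rw [sqInt_eq_toReal (hu.sub hq2)]
  have h1 : ∫⁻ x in D, ‖u x - q x‖ₑ ^ 2 = ∫⁻ x in D, ‖u' x - q x‖ₑ ^ 2 :=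
    lintegral_congr_ae (huu.mono fun x hx => by simp only [hx])
  have h2 : ∑ I, ∫⁻ x, ‖g' I x‖ₑ ^ 2 = ENNReal.ofReal (∑ I, sqInt D (g I)) := by
    rw [ENNReal.ofReal_sum_of_nonneg fun _ _ => sqInt_nonneg _ _]
    refine Finset.sum_congr rfl fun I _ => ?_
    rw [hgint, sqInt_eq_toReal (hg2 I), ENNReal.ofReal_toReal (lintegral_enorm_sq_ne_top (hg2 I))]
  rw [h1]
  refine ENNReal.toReal_le_of_le_ofReal (by positivity) (hle.trans ?_)
  rw [h2, show (2 : ENNReal) = ENNReal.ofReal 2 by simp, ← ENNReal.ofReal_pow (by norm_num),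
    ← ENNReal.ofReal_mul (by norm_num), ← ENNReal.ofReal_mul (by positivity),
    ← ENNReal.ofReal_mul (by positivity), ← ENNReal.ofReal_mul (by positivity),
    ← ENNReal.ofReal_mul (by positivity), ← ENNReal.ofReal_add (by positivity) (by positivity)]
  refine ENNReal.ofReal_le_ofReal ?_
  have h4 : (2 : ℝ) ^ d * 2 ^ d = 4 ^ d := by rw [← mul_pow]; norm_num
  have h5 : 0 ≤ h ^ (2 * (n + 1)) * ∑ I, sqInt D (g I) := by positivity
  have h6 : 0 ≤ (2 * 4 ^ d * (d : ℝ) ^ (n + 1)) * (h ^ (2 * (n + 1)) * sqInt D u) := by positivity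
  simp only [ε, ← h4] at h6 ⊢
  linear_combination h6 + 2 * h5

end BrambleHilbert

/-! ### Cells, null boundaries and decomposition of integrals over the mesh. -/

section Cells

variable {d : ℕ} {F : Type*} [NormedAddCommGroup F] [InnerProductSpace ℝ F]

theorem IsCell.convex {T : Set (Pt d)} (hT : IsCell T) : Convex ℝ T := by
  obtain ⟨⟨s, rfl⟩, -⟩ := hT
  exact convex_convexHull ℝ _

theorem IsCell.isCompact {T : Set (Pt d)} (hT : IsCell T) : IsCompact T := by
  obtain ⟨⟨s, rfl⟩, -⟩ := hT
  exact s.finite_toSet.isCompact_convexHull ℝ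

theorem IsCell.isBounded {T : Set (Pt d)} (hT : IsCell T) : Bornology.IsBounded T :=
  hT.isCompact.isBounded

theorem IsCell.interior_ae_eq {T : Set (Pt d)} (hT : IsCell T) : interior T =ᵐ[volume] T :=
  interior_ae_eq_of_null_frontier (hT.convex.addHaar_frontier volume)

theorem IsCell.restrict_interior {T : Set (Pt d)} (hT : IsCell T) :
    volume.restrict (interior T) = volume.restrict T :=
  Measure.restrict_congr_set hT.interior_ae_eq

theorem IsCell.diam_pos (hd : 1 ≤ d) {T : Set (Pt d)} (hT : IsCell T) : 0 < Metric.diam T := by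
  have : Nonempty (Fin d) := ⟨⟨0, hd⟩⟩
  obtain ⟨x, hx⟩ := hT.2
  have hinf : T.Infinite := infinite_of_mem_nhds x (mem_interior_iff_mem_nhds.1 hx)
  exact Metric.diam_pos hinf.nontrivial hT.isBounded

/-- The exposing functional has a local maximum at an interior point, so its derivative, which is
the functional itself, vanishes, and the face it exposes is everything. -/
theorem eq_of_isExposed_of_mem_interior {A B : Set (Pt d)} (h : IsExposed ℝ A B) {z : Pt d}
    (hzB : z ∈ B) (hzA : z ∈ interior A) : B = A := by
  obtain ⟨l, hl⟩ := h ⟨z, hzB⟩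
  have hmax : ∀ y ∈ A, l y ≤ l z := by
    rw [hl] at hzB
    exact hzB.2
  have hloc : IsLocalMax l z := by
    filter_upwards [mem_interior_iff_mem_nhds.1 hzA] with y hy using hmax y hy
  have h0 : l = 0 := by
    have := hloc.fderiv_eq_zero
    rwa [ContinuousLinearMap.fderiv] at this
  rw [hl, h0]
  ext x
  simp

namespace UnfittedMesh

variable (M : UnfittedMesh d)

/-- A common interior point would make the face `T ∩ T'` equal to both cells. -/
theorem disjoint_interior {T T' : Set (Pt d)} (hT : T ∈ M.cells) (hT' : T' ∈ M.cells)
    (hne : T ≠ T') : Disjoint (interior T) (interior T') := by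
  rw [Set.disjoint_left]
  intro z hz hz'
  have hmem : z ∈ T ∩ T' := ⟨interior_subset hz, interior_subset hz'⟩
  obtain ⟨h1, h2⟩ := M.conforming T hT T' hT' hne
  exact hne ((eq_of_isExposed_of_mem_interior h1 hmem hz).symm.trans
    (eq_of_isExposed_of_mem_interior h2 hmem hz'))

variable {M}

theorem mem_active {T : Set (Pt d)} :
    T ∈ M.active ↔ T ∈ M.cells ∧ (T ∩ M.domain).Nonempty := by
  simp [active]

theorem mem_interiorCells {T : Set (Pt d)} :
    T ∈ M.interiorCells ↔ T ∈ M.active ∧ interior T ⊆ M.domain := by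
  simp [interiorCells]

theorem mem_cutCells {T : Set (Pt d)} :
    T ∈ M.cutCells ↔ T ∈ M.active ∧ T ∉ M.interiorCells := by
  simp [cutCells]

theorem active_subset : M.active ⊆ M.cells := fun _ hT => (mem_active.1 hT).1

theorem interiorCells_subset : M.interiorCells ⊆ M.active := fun _ hT => (mem_interiorCells.1 hT).1

theorem cutCells_subset : M.cutCells ⊆ M.active := fun _ hT => (mem_cutCells.1 hT).1

theorem isCell_of_mem_active {T : Set (Pt d)} (hT : T ∈ M.active) : IsCell T :=
  M.isCell T (active_subset hT)

variable {s : Finset (Set (Pt d))}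

/-- Frontiers of convex sets are null, so overlaps of cells along their boundaries do not count in
integrals. -/
theorem biUnion_interior_ae_eq (hs : s ⊆ M.cells) :
    (⋃ T ∈ s, interior T : Set (Pt d)) =ᵐ[volume] (⋃ T ∈ s, T : Set (Pt d)) := by
  have := fun T : s => (M.isCell T (hs T.2)).interior_ae_eq
  simpa only [Set.iUnion_subtype] using Filter.EventuallyEq.countable_iUnion this

theorem setIntegral_biUnion (hs : s ⊆ M.cells) {f : Pt d → ℝ} (hf : ∀ T ∈ s, IntegrableOn f T) :
    ∫ x in ⋃ T ∈ s, T, f x = ∑ T ∈ s, ∫ x in T, f x := by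
  rw [← setIntegral_congr_set (biUnion_interior_ae_eq hs), integral_biUnion_finset]
  · refine Finset.sum_congr rfl fun T hT => setIntegral_congr_set ?_
    exact (M.isCell T (hs hT)).interior_ae_eq
  · exact fun T _ => isOpen_interior.measurableSet
  · exact fun T hT T' hT' hne => M.disjoint_interior (hs hT) (hs hT') hne
  · exact fun T hT => (hf T hT).mono_set interior_subset

theorem memL2_biUnion {u : Pt d → F} (hu : ∀ T ∈ s, MemL2 T u) : MemL2 (⋃ T ∈ s, T) u := by
  classical
  induction s using Finset.induction_on with
  | empty => simp [MemL2]
  | insert T s _ ih =>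
    rw [Finset.set_biUnion_insert]
    have h1 := hu T (Finset.mem_insert_self T s)
    have h2 := ih fun T' hT' => hu T' (Finset.mem_insert_of_mem hT')
    have hm : AEStronglyMeasurable u (volume.restrict (T ∪ ⋃ T ∈ s, T)) :=
      aestronglyMeasurable_union_iff.2 ⟨h1.1, h2.1⟩
    refine (memLp_two_iff hm).2 ((lintegral_union_le _ _ _).trans_lt ?_)
    exact ENNReal.add_lt_top.2 ⟨(memLp_two_iff h1.1).1 h1, (memLp_two_iff h2.1).1 h2⟩

theorem sqInt_biUnion (hs : s ⊆ M.cells) {u : Pt d → F} (hu : ∀ T ∈ s, MemL2 T u) :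
    sqInt (⋃ T ∈ s, T) u = ∑ T ∈ s, sqInt T u :=
  setIntegral_biUnion hs fun T hT => (hu T hT).integrable_sq

theorem isClosed_biUnion_active : IsClosed (⋃ T ∈ M.active, T) :=
  isClosed_biUnion_finset fun _ hT => (isCell_of_mem_active hT).isCompact.isClosed

theorem activeDomain_eq : M.activeDomain = interior (⋃ T ∈ M.active, T) := by
  rw [activeDomain, isClosed_biUnion_active.closure_eq]

theorem isOpen_activeDomain : IsOpen M.activeDomain := isOpen_interior

theorem interior_subset_activeDomain {T : Set (Pt d)} (hT : T ∈ M.active) :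
    interior T ⊆ M.activeDomain := by
  rw [activeDomain_eq]
  exact interior_mono (Set.subset_biUnion_of_mem (u := fun T => T) hT)

theorem activeDomain_ae_eq : M.activeDomain =ᵐ[volume] (⋃ T ∈ M.active, T : Set (Pt d)) := by
  refine Filter.EventuallyLE.antisymm ?_ ?_
  · rw [activeDomain_eq]
    exact interior_subset.eventuallyLE
  · refine (biUnion_interior_ae_eq active_subset).symm.le.trans (LE.le.eventuallyLE ?_)
    exact Set.iUnion₂_subset fun T hT => interior_subset_activeDomain hT

theorem domain_subset_activeDomain : M.domain ⊆ M.activeDomain := by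
  rw [activeDomain_eq]
  refine interior_maximal (fun x hx => ?_) M.isOpen_domain
  obtain ⟨T, hT, hxT⟩ := Set.mem_iUnion₂.1 (M.domain_subset hx)
  exact Set.mem_iUnion₂.2 ⟨T, mem_active.2 ⟨hT, x, hxT, hx⟩, hxT⟩

theorem sqInt_activeDomain {u : Pt d → F} (hu : ∀ T ∈ M.active, MemL2 T u) :
    sqInt M.activeDomain u = ∑ T ∈ M.active, sqInt T u := by
  rw [sqInt_congr_set u activeDomain_ae_eq, sqInt_biUnion active_subset hu]

theorem sqInt_cutDomain {u : Pt d → F} (hu : ∀ T ∈ M.cutCells, MemL2 T u) :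
    sqInt M.cutDomain u = ∑ T ∈ M.cutCells, sqInt T u :=
  sqInt_biUnion (cutCells_subset.trans active_subset) hu

theorem memL2_activeDomain {u : Pt d → F} (hu : ∀ T ∈ M.active, MemL2 T u) :
    MemL2 M.activeDomain u :=
  (memL2_biUnion hu).mono (by rw [activeDomain_eq]; exact interior_subset)

theorem memL2_of_activeDomain {u : Pt d → F} (hu : MemL2 M.activeDomain u) {T : Set (Pt d)}
    (hT : T ∈ M.active) : MemL2 T u := by
  have := hu.mono (interior_subset_activeDomain hT)
  rwa [MemL2, (isCell_of_mem_active hT).restrict_interior] at this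

theorem sum_interiorCells_le {u : Pt d → F} (hu : MemL2 M.domain u) :
    ∑ T ∈ M.interiorCells, sqInt T u ≤ sqInt M.domain u := by
  have hsub : ∀ T ∈ M.interiorCells, interior T ⊆ M.domain := fun T hT =>
    (mem_interiorCells.1 hT).2
  have hcell := interiorCells_subset.trans (active_subset (M := M))
  rw [← sqInt_biUnion hcell, sqInt_congr_set u (biUnion_interior_ae_eq hcell).symm]
  · exact sqInt_mono hu (Set.iUnion₂_subset hsub)
  · intro T hT
    have := hu.mono (hsub T hT)
    rwa [MemL2, (M.isCell T (hcell hT)).restrict_interior] at this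

theorem meshSize_nonneg : 0 ≤ M.meshSize :=
  Real.sSup_nonneg (by rintro _ ⟨T, -, rfl⟩; exact Metric.diam_nonneg)

theorem diam_le_meshSize {T : Set (Pt d)} (hT : T ∈ M.cells) : Metric.diam T ≤ M.meshSize :=
  le_csSup ((M.cells.finite_toSet.image _).bddAbove) ⟨T, hT, rfl⟩

theorem meshSize_pos (hd : 1 ≤ d) {T : Set (Pt d)} (hT : T ∈ M.cells) : 0 < M.meshSize :=
  ((M.isCell T hT).diam_pos hd).trans_le (diam_le_meshSize hT)

end UnfittedMesh

end Cells

/-! ### Balls across a facet shared by two cells. -/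

section Facets

variable {d : ℕ}

theorem IsCell.vectorSpan_eq_top {T : Set (Pt d)} (hT : IsCell T) : vectorSpan ℝ T = ⊤ := by
  rw [← direction_affineSpan, affineSpan_eq_top_of_nonempty_interior
    (hT.2.mono (interior_mono (subset_convexHull ℝ T))), AffineSubspace.direction_top]

theorem IsCell.not_isFacet_self {T : Set (Pt d)} (hT : IsCell T) : ¬ IsFacet T T := by
  rintro ⟨-, -, hrank⟩
  rw [hT.vectorSpan_eq_top, finrank_top, finrank_euclideanSpace, Fintype.card_fin] at hrank
  omega

/-- The normal is the normalised Riesz representative of a functional that exposes the facet. It is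
nonzero, since otherwise the facet would be the whole cell; its orthogonal complement contains the
direction of the facet and has the same dimension `d - 1`. -/
theorem exists_unit_normal {F T : Set (Pt d)} (hT : IsCell T) (hF : IsFacet F T) :
    ∃ n : Pt d, ‖n‖ = 1 ∧ (∀ x ∈ F, ∀ z ∈ T, ⟪n, z⟫ ≤ ⟪n, x⟫) ∧
      vectorSpan ℝ F = (Submodule.span ℝ {n})ᗮ := by
  obtain ⟨hne, hexp, hrank⟩ := hF
  obtain ⟨l, hl⟩ := hexp hne
  have hl0 : l ≠ 0 := by
    rintro rfl
    have hFT : F = T := by rw [hl]; ext; simp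
    rw [hFT] at hne hexp hrank
    exact hT.not_isFacet_self ⟨hne, hexp, hrank⟩
  set n₀ := (InnerProductSpace.toDual ℝ (Pt d)).symm l with hn₀
  have hn₀0 : n₀ ≠ 0 := by simpa [hn₀] using hl0
  have hin : ∀ z, ⟪n₀, z⟫ = l z := fun z => InnerProductSpace.toDual_symm_apply
  have hmax : ∀ x ∈ F, ∀ z ∈ T, ⟪‖n₀‖⁻¹ • n₀, z⟫ ≤ ⟪‖n₀‖⁻¹ • n₀, x⟫ := by
    intro x hx z hz
    rw [hl] at hx
    rw [real_inner_smul_left, real_inner_smul_left, hin, hin]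
    exact mul_le_mul_of_nonneg_left (hx.2 z hz) (by positivity)
  have hunit : ‖‖n₀‖⁻¹ • n₀‖ = 1 := norm_smul_inv_norm (𝕜 := ℝ) hn₀0
  refine ⟨‖n₀‖⁻¹ • n₀, hunit, hmax, ?_⟩
  have hFT : F ⊆ T := hexp.subset
  refine Submodule.eq_of_le_of_finrank_eq ?_ ?_
  · rw [vectorSpan_def, Submodule.span_le]
    rintro _ ⟨x, hx, y, hy, rfl⟩
    rw [SetLike.mem_coe, Submodule.mem_orthogonal_singleton_iff_inner_right]
    simp only [vsub_eq_sub, inner_sub_right]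
    linarith [hmax x hx y (hFT hy), hmax y hy x (hFT hx)]
  · have h1 := Submodule.finrank_add_finrank_orthogonal (Submodule.span ℝ {‖n₀‖⁻¹ • n₀})
    rw [finrank_span_singleton (by rw [← norm_pos_iff, hunit]; exact one_pos),
      finrank_euclideanSpace, Fintype.card_fin] at h1
    omega

/-- The convex hull of the disc in the facet and the deep point `y` contains a half-ball around the
disc's centre: from `y`, project `z` through to the hyperplane at `w` and check that `w` is in the
disc. -/
theorem half_ball_subset {T : Set (Pt d)} (hT : Convex ℝ T) {n x y : Pt d} {r h : ℝ}
    (hr : 0 < r) (hy : y ∈ T) (hny : r ≤ ⟪n, x⟫ - ⟪n, y⟫)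
    (hn : ‖n‖ = 1) (hyx : ‖y - x‖ ≤ h)
    (hdisc : ∀ w, ⟪n, w⟫ = ⟪n, x⟫ → ‖w - x‖ ≤ r → w ∈ T) {z : Pt d}
    (hz : ‖z - x‖ ≤ r ^ 2 / (4 * (r + h))) (hnz : ⟪n, z⟫ ≤ ⟪n, x⟫) : z ∈ T := by
  have h0 : 0 ≤ h := (norm_nonneg _).trans hyx
  set s := r ^ 2 / (4 * (r + h)) with hs
  have hs4 : s * (r + h) = r ^ 2 / 4 := by
    rw [hs]
    field_simp
  have hs0 : 0 ≤ s := by positivity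
  have hsr : s ≤ r / 4 := by nlinarith
  set b := ⟪n, x⟫ - ⟪n, y⟫ with hb
  have hb0 : 0 < b := hr.trans_le hny
  -- The weight for which `w` in `z = τ y + (1 - τ) w` lies in the hyperplane through `x`.
  set τ := (⟪n, x⟫ - ⟪n, z⟫) / b with hτ
  have hτb : τ * b = ⟪n, x⟫ - ⟪n, z⟫ := by
    rw [hτ]
    field_simp
  have hnum : ⟪n, x⟫ - ⟪n, z⟫ ≤ s := by
    have h1 := real_inner_le_norm n (x - z)
    rw [hn, one_mul, inner_sub_right, norm_sub_rev] at h1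
    exact h1.trans hz
  have hτ0 : 0 ≤ τ := div_nonneg (by linarith) hb0.le
  have hτs : τ * r ≤ s := by nlinarith
  have hτ4 : τ ≤ 1 / 4 := by
    by_contra hcon
    push Not at hcon
    nlinarith
  have h1τ : 0 < 1 - τ := by linarith
  set w := (1 - τ)⁻¹ • (z - τ • y) with hw
  have hzw : z = τ • y + (1 - τ) • w := by
    rw [hw, smul_smul, mul_inv_cancel₀ h1τ.ne', one_smul, add_sub_cancel]
  have hwx : w - x = (1 - τ)⁻¹ • ((z - x) - τ • (y - x)) := by
    have : x = (1 - τ)⁻¹ • ((1 - τ) • x) := by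
      rw [smul_smul, inv_mul_cancel₀ h1τ.ne', one_smul]
    conv_lhs => rw [hw, this]
    rw [← smul_sub]
    congr 1
    module
  have hwT : w ∈ T := by
    refine hdisc w ?_ ?_
    · have h2 : ⟪n, w - x⟫ = 0 := by
        rw [hwx, real_inner_smul_right, inner_sub_right, real_inner_smul_right, inner_sub_right,
          inner_sub_right]
        have : ⟪n, z⟫ - ⟪n, x⟫ - τ * (⟪n, y⟫ - ⟪n, x⟫) = 0 := by
          linarith [hτb, show τ * (⟪n, y⟫ - ⟪n, x⟫) = - (τ * b) by rw [hb]; ring]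
        rw [this, mul_zero]
      rw [inner_sub_right] at h2
      linarith
    · rw [hwx, norm_smul, norm_inv, Real.norm_of_nonneg h1τ.le]
      have h2 : ‖(z - x) - τ • (y - x)‖ ≤ s + τ * h := by
        refine (norm_sub_le _ _).trans ?_
        rw [norm_smul, Real.norm_of_nonneg hτ0]
        gcongr
      have h3 : (1 - τ)⁻¹ ≤ 2 := by
        rw [inv_le_comm₀ h1τ (by norm_num)]
        linarith
      -- The radius `s` satisfies `s (r + h) = r ^ 2 / 4`, and `τ r ≤ s`.
      have h4 : s + τ * h ≤ r / 4 := by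
        have : (s + τ * h) * r ≤ r / 4 * r := by nlinarith
        exact le_of_mul_le_mul_right this hr
      calc (1 - τ)⁻¹ * ‖(z - x) - τ • (y - x)‖ ≤ 2 * (r / 4) := by
            gcongr
            exact h2.trans h4
        _ ≤ r := by linarith
  rw [hzw]
  exact hT hy hwT hτ0 h1τ.le (by ring)

theorem inner_add_le_of_closedBall_subset {T : Set (Pt d)} {n x y : Pt d} {r : ℝ} (hr : 0 ≤ r)
    (hn : ‖n‖ = 1) (hball : Metric.closedBall y r ⊆ T) (hmax : ∀ z ∈ T, ⟪n, z⟫ ≤ ⟪n, x⟫) :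
    r ≤ ⟪n, x⟫ - ⟪n, y⟫ := by
  have h1 : y + r • n ∈ Metric.closedBall y r := by
    rw [mem_closedBall_iff_norm, add_sub_cancel_left, norm_smul, hn, mul_one,
      Real.norm_of_nonneg hr]
  have h2 := hmax _ (hball h1)
  rw [inner_add_right, real_inner_smul_right, real_inner_self_eq_norm_sq, hn] at h2
  linarith

theorem closedBall_half_subset {n x : Pt d} (hn : ‖n‖ = 1) {s : ℝ} (hs : 0 ≤ s) :
    Metric.closedBall (x - (s / 2) • n) (s / 2) ⊆
      Metric.closedBall x s ∩ {z | ⟪n, z⟫ ≤ ⟪n, x⟫} := by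
  intro z hz
  rw [mem_closedBall_iff_norm] at hz
  constructor
  · rw [mem_closedBall_iff_norm]
    have h1 : z - x = (z - (x - (s / 2) • n)) - (s / 2) • n := by module
    rw [h1]
    refine (norm_sub_le _ _).trans ?_
    rw [norm_smul, hn, Real.norm_of_nonneg (by positivity)]
    linarith
  · have h1 : ⟪n, z - (x - (s / 2) • n)⟫ ≤ s / 2 :=
      (real_inner_le_norm n (z - (x - (s / 2) • n))).trans (by rw [hn, one_mul]; exact hz)
    rw [inner_sub_right, inner_sub_right, real_inner_smul_right, real_inner_self_eq_norm_sq,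
      hn] at h1
    simp only [Set.mem_ofPred_eq]
    linarith

/-- Regularity gives a disc of radius `r = ρ ^ 2 * h` in the facet and a ball of that radius in each
cell, so each cell contains a half-ball around the disc's centre. The half-balls lie on opposite
sides and fill a ball; each contains a ball of half its radius. -/
theorem UnfittedMesh.IsRegular.exists_facet_ball {M : UnfittedMesh d} {ρ : ℝ} (hρ : 0 < ρ)
    (hM : M.IsRegular ρ) (h0 : 0 < M.meshSize) {T T' : Set (Pt d)} (hT : T ∈ M.cells)
    (hT' : T' ∈ M.cells) (hadj : FacetAdjacent T T') :
    ∃ x a a' : Pt d,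
      Metric.closedBall x (ρ ^ 4 / (4 * (ρ ^ 2 + 1)) * M.meshSize) ⊆ T ∪ T' ∧
      Metric.closedBall a (ρ ^ 4 / (4 * (ρ ^ 2 + 1)) * M.meshSize / 2) ⊆
        T ∩ Metric.closedBall x (ρ ^ 4 / (4 * (ρ ^ 2 + 1)) * M.meshSize) ∧
      Metric.closedBall a' (ρ ^ 4 / (4 * (ρ ^ 2 + 1)) * M.meshSize / 2) ⊆
        T' ∩ Metric.closedBall x (ρ ^ 4 / (4 * (ρ ^ 2 + 1)) * M.meshSize) := by
  set h := M.meshSize with hh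
  have hcT := M.isCell T hT
  have hcT' := M.isCell T' hT'
  obtain ⟨n, hn, hmax, hspan⟩ := exists_unit_normal hcT hadj.1
  obtain ⟨n', hn', hmax', hspan'⟩ := exists_unit_normal hcT' hadj.2
  obtain ⟨x, hxF, hdisc⟩ := hM.facet_ball T hT _ hadj.1
  obtain ⟨y, hy⟩ := hM.cell_ball T hT
  obtain ⟨y', hy'⟩ := hM.cell_ball T' hT'
  set r := ρ ^ 2 * h with hr
  have hr0 : 0 < r := by positivity
  have hs : ρ ^ 4 / (4 * (ρ ^ 2 + 1)) * h = r ^ 2 / (4 * (r + h)) := by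
    rw [hr]
    field_simp
  rw [hs]
  set s := r ^ 2 / (4 * (r + h)) with hsdef
  have hs0 : 0 < s := by positivity
  have hrT : r ≤ ρ * Metric.diam T := by
    have := hM.quasiUniform T hT
    rw [hr, pow_two, mul_assoc]
    gcongr
  have hrT' : r ≤ ρ * Metric.diam T' := by
    have := hM.quasiUniform T' hT'
    rw [hr, pow_two, mul_assoc]
    gcongr
  have hyr : Metric.closedBall y r ⊆ T := (Metric.closedBall_subset_closedBall hrT).trans hy
  have hyr' : Metric.closedBall y' r ⊆ T' := (Metric.closedBall_subset_closedBall hrT').trans hy'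
  have hyT : y ∈ T := hyr (Metric.mem_closedBall_self hr0.le)
  have hyT' : y' ∈ T' := hyr' (Metric.mem_closedBall_self hr0.le)
  have hdist : ‖y - x‖ ≤ h := by
    rw [← dist_eq_norm]
    exact (Metric.dist_le_diam_of_mem hcT.isBounded hyT hxF.1).trans (diam_le_meshSize hT)
  have hdist' : ‖y' - x‖ ≤ h := by
    rw [← dist_eq_norm]
    exact (Metric.dist_le_diam_of_mem hcT'.isBounded hyT' hxF.2).trans (diam_le_meshSize hT')
  have hdiscF : ∀ w, ⟪n, w⟫ = ⟪n, x⟫ → ‖w - x‖ ≤ r → w ∈ T ∩ T' := by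
    intro w hw hwx
    refine hdisc ⟨?_, ?_⟩
    · rw [mem_closedBall_iff_norm]
      exact hwx.trans hrT
    · have h1 : w - x ∈ vectorSpan ℝ (T ∩ T') := by
        rw [hspan, Submodule.mem_orthogonal_singleton_iff_inner_right, inner_sub_right, hw, sub_self]
      have h2 := AffineSubspace.vadd_mem_of_mem_direction
        (by rwa [direction_affineSpan] : w - x ∈ (affineSpan ℝ (T ∩ T')).direction)
        (subset_affineSpan ℝ _ hxF)
      simpa using h2
  -- Both unit normals span the orthogonal complement of the direction of the same facet.
  have hpar : n' = n ∨ n' = -n := by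
    have h1 : Submodule.span ℝ {n'} = Submodule.span ℝ {n} := by
      rw [← Submodule.orthogonal_orthogonal (Submodule.span ℝ {n'}), ← hspan', hspan,
        Submodule.orthogonal_orthogonal]
    have h2 : n' ∈ Submodule.span ℝ {n} := h1 ▸ Submodule.mem_span_singleton_self n'
    obtain ⟨c, hc⟩ := Submodule.mem_span_singleton.1 h2
    have h3 : |c| = 1 := by
      rw [← hc, norm_smul, hn, mul_one] at hn'
      exact hn'
    rcases eq_or_eq_neg_of_abs_eq h3 with h4 | h4
    · left; rw [← hc, h4, one_smul]
    · right; rw [← hc, h4, neg_smul, one_smul]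
  have hhalf : ∀ z, ‖z - x‖ ≤ s → ⟪n, z⟫ ≤ ⟪n, x⟫ → z ∈ T := fun z hz hnz =>
    half_ball_subset hcT.convex hr0 hyT
      (inner_add_le_of_closedBall_subset hr0.le hn hyr (hmax x hxF)) hn hdist
      (fun w hw hwx => (hdiscF w hw hwx).1) hz hnz
  have hhalf' : ∀ z, ‖z - x‖ ≤ s → ⟪n', z⟫ ≤ ⟪n', x⟫ → z ∈ T' := fun z hz hnz =>
    half_ball_subset hcT'.convex hr0 hyT'
      (inner_add_le_of_closedBall_subset hr0.le hn' hyr' (hmax' x hxF)) hn' hdist'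
      (fun w hw hwx => (hdiscF w (by
        rcases hpar with h | h <;> simpa [h, inner_neg_left] using hw) hwx).2) hz hnz
  -- With equal normals, `x - s n` would lie in both cells, hence in the facet, although `⟪n, ·⟫` is
  -- strictly smaller there than at `x`.
  have hopp : n' = -n := by
    refine hpar.resolve_left fun heq => ?_
    rw [heq] at hhalf'
    have hz : ‖(x - s • n) - x‖ ≤ s := by
      rw [sub_sub_cancel_left, norm_neg, norm_smul, hn, Real.norm_of_nonneg hs0.le, mul_one]
    have hnz : ⟪n, x - s • n⟫ = ⟪n, x⟫ - s := by
      rw [inner_sub_right, real_inner_smul_right, real_inner_self_eq_norm_sq, hn]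
      ring
    have h1 := hmax (x - s • n) ⟨hhalf _ hz (by linarith), hhalf' _ hz (by linarith)⟩ x hxF.1
    linarith
  refine ⟨x, x - (s / 2) • n, x - (s / 2) • n', fun z hz => ?_, fun z hz => ?_, fun z hz => ?_⟩
  · rw [mem_closedBall_iff_norm] at hz
    rcases le_total ⟪n, z⟫ ⟪n, x⟫ with h1 | h1
    · exact .inl (hhalf z hz h1)
    · refine .inr (hhalf' z hz ?_)
      rw [hopp, inner_neg_left, inner_neg_left]
      linarith
  · obtain ⟨h1, h2⟩ := closedBall_half_subset hn hs0.le hz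
    exact ⟨hhalf z (mem_closedBall_iff_norm.1 h1) h2, h1⟩
  · obtain ⟨h1, h2⟩ := closedBall_half_subset hn' hs0.le hz
    exact ⟨hhalf' z (mem_closedBall_iff_norm.1 h1) h2, h1⟩

end Facets

/-! ### Bounding a pseudo-distance along a chain. -/

section Chains

/-- A chain can be shortened to a path without repeated vertices, which has fewer steps than `s` has
elements; the triangle inequality then sums the steps. -/
theorem exists_chain_bound {α : Type*} (s : Finset α) {r : α → α → Prop} {a b : α}
    (ha : a ∈ s) (hr : ∀ x y, r x y → x ≠ y ∧ y ∈ s) (hchain : Relation.ReflTransGen r a b)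
    {D : α → α → ℝ} (hD0 : ∀ x, D x x = 0) (hsymm : ∀ x y, D x y = D y x)
    (htri : ∀ x y z, D x z ≤ D x y + D y z)
    {E : ℝ} (hE0 : 0 ≤ E) (hE : ∀ x ∈ s, ∀ y ∈ s, r x y → D x y ≤ E) :
    D a b ≤ s.card * E := by
  classical
  let G : SimpleGraph s := SimpleGraph.fromRel fun x y => r x.1 y.1
  have hreach : ∃ hb : b ∈ s, G.Reachable ⟨a, ha⟩ ⟨b, hb⟩ := by
    induction hchain with
    | refl => exact ⟨ha, SimpleGraph.Reachable.refl _⟩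
    | tail _ hcd ih =>
      obtain ⟨hc, hreach⟩ := ih
      obtain ⟨hne, hd⟩ := hr _ _ hcd
      refine ⟨hd, hreach.trans (SimpleGraph.Adj.reachable ?_)⟩
      rw [SimpleGraph.fromRel_adj]
      exact ⟨fun h => hne (congrArg Subtype.val h), .inl hcd⟩
  obtain ⟨hb, hreach⟩ := hreach
  have hwalk : ∀ {x y : s} (p : G.Walk x y), D x.1 y.1 ≤ p.length * E := by
    intro x y p
    induction p with
    | nil => simp [hD0]
    | cons hadj p ih =>
      rw [SimpleGraph.fromRel_adj] at hadj
      have h1 : D _ _ ≤ E := hadj.2.elim (hE _ (Subtype.prop _) _ (Subtype.prop _)) fun h => by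
        rw [hsymm]
        exact hE _ (Subtype.prop _) _ (Subtype.prop _) h
      rw [SimpleGraph.Walk.length_cons]
      push_cast
      linarith [htri _ _ _ |>.trans (add_le_add h1 ih)]
  obtain ⟨p⟩ := hreach
  have hlen := (SimpleGraph.Walk.toPath p).2.length_lt
  rw [Fintype.card_coe] at hlen
  refine (hwalk (SimpleGraph.Walk.toPath p).1).trans ?_
  gcongr

end Chains

/-! ### Polynomial approximation on whole aggregates. -/

section Aggregates

variable {d : ℕ} {F : Type*} [NormedAddCommGroup F] [InnerProductSpace ℝ F]
variable {M : UnfittedMesh d}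

namespace UnfittedMesh.Aggregation

variable (A : M.Aggregation)

open Classical in
/-- The cells of the aggregate with root cell `R`. -/
def aggregateCells (R : Set (Pt d)) : Finset (Set (Pt d)) := M.active.filter fun T => A.root T = R

variable {A}

theorem mem_aggregateCells {R T : Set (Pt d)} :
    T ∈ A.aggregateCells R ↔ T ∈ M.active ∧ A.root T = R := by
  simp [aggregateCells]

theorem aggregateCells_subset {R : Set (Pt d)} : A.aggregateCells R ⊆ M.active :=
  fun _ hT => (mem_aggregateCells.1 hT).1

theorem aggregateCells_subset_cells {R : Set (Pt d)} : A.aggregateCells R ⊆ M.cells :=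
  aggregateCells_subset.trans active_subset

theorem aggregate_eq (R : Set (Pt d)) : A.aggregate R = ⋃ T ∈ A.aggregateCells R, T := by
  ext x
  simp only [aggregate, Set.mem_iUnion, mem_aggregateCells, exists_prop, and_assoc]

theorem root_mem_aggregateCells {R : Set (Pt d)} (hR : R ∈ M.interiorCells) :
    R ∈ A.aggregateCells R :=
  mem_aggregateCells.2 ⟨interiorCells_subset hR, A.root_self R hR⟩

theorem subset_aggregate {R T : Set (Pt d)} (hT : T ∈ A.aggregateCells R) :
    T ⊆ A.aggregate R := by
  rw [aggregate_eq]
  exact Set.subset_biUnion_of_mem (u := fun T => T) hT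

theorem isBounded_aggregate (R : Set (Pt d)) : Bornology.IsBounded (A.aggregate R) := by
  rw [aggregate_eq]
  exact (Bornology.isBounded_biUnion_finset _).2 fun T hT =>
    (isCell_of_mem_active (aggregateCells_subset hT)).isBounded

theorem IsBounded.aggregate_subset {K : ℝ} (hA : A.IsBounded K) {R : Set (Pt d)}
    (hR : R ∈ M.interiorCells) {x : Pt d} (hx : x ∈ A.aggregate R) :
    A.aggregate R ⊆ Metric.closedBall x (K * M.meshSize) := fun _ hz =>
  (Metric.dist_le_diam_of_mem (isBounded_aggregate R) hz hx).trans (hA R hR)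

theorem chain_of_mem {R T : Set (Pt d)} (hT : T ∈ A.aggregateCells R) :
    Relation.ReflTransGen (fun S S' => FacetAdjacent S S' ∧ S' ∈ A.aggregateCells R) R T := by
  obtain ⟨hTa, rfl⟩ := mem_aggregateCells.1 hT
  by_cases hTi : T ∈ M.interiorCells
  · rw [A.root_self T hTi]
  · have := A.chain T (mem_cutCells.2 ⟨hTa, hTi⟩)
    simpa only [mem_aggregateCells] using this

theorem sqInt_aggregate {R : Set (Pt d)} {u : Pt d → F}
    (hu : ∀ T ∈ A.aggregateCells R, MemL2 T u) :
    sqInt (A.aggregate R) u = ∑ T ∈ A.aggregateCells R, sqInt T u := by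
  rw [aggregate_eq, sqInt_biUnion aggregateCells_subset_cells hu]

theorem memL2_aggregate {R : Set (Pt d)} {u : Pt d → F}
    (hu : ∀ T ∈ A.aggregateCells R, MemL2 T u) : MemL2 (A.aggregate R) u := by
  rw [aggregate_eq]
  exact memL2_biUnion hu

end UnfittedMesh.Aggregation

open UnfittedMesh UnfittedMesh.Aggregation

theorem UnfittedMesh.IsRegular.exists_ball {ρ : ℝ} (hρ : 0 < ρ) (hM : M.IsRegular ρ)
    {T : Set (Pt d)} (hT : T ∈ M.cells) :
    ∃ x, Metric.closedBall x (ρ ^ 2 * M.meshSize) ⊆ T := by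
  obtain ⟨x, hx⟩ := hM.cell_ball T hT
  refine ⟨x, (Metric.closedBall_subset_closedBall ?_).trans hx⟩
  have := hM.quasiUniform T hT
  rw [pow_two, mul_assoc]
  gcongr

theorem UnfittedMesh.Aggregation.IsBounded.pos {A : M.Aggregation} (hd : 1 ≤ d) {K : ℝ}
    (hA : A.IsBounded K) {R : Set (Pt d)} (hR : R ∈ M.interiorCells) : 0 < K := by
  have hRc := active_subset (interiorCells_subset hR)
  have h1 : Metric.diam R ≤ K * M.meshSize :=
    (Metric.diam_mono (subset_aggregate (root_mem_aggregateCells hR))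
      (isBounded_aggregate R)).trans (hA R hR)
  have h2 := (M.isCell R hRc).diam_pos hd
  exact pos_of_mul_pos_left (h2.trans_le h1) (meshSize_pos hd hRc).le

/-- Volume count: the cells have disjoint interiors, each contains a ball of radius `ρ ^ 2 * h`, and
all lie in a ball of radius `K h`. -/
theorem UnfittedMesh.Aggregation.IsBounded.card_le {A : M.Aggregation} (hd : 1 ≤ d) {ρ K : ℝ}
    (hρ : 0 < ρ) (hM : M.IsRegular ρ) (hA : A.IsBounded K) {R : Set (Pt d)}
    (hR : R ∈ M.interiorCells) : ((A.aggregateCells R).card : ℝ) ≤ (K / ρ ^ 2) ^ d := by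
  have hRc := active_subset (interiorCells_subset hR)
  have h0 := meshSize_pos hd hRc
  have hK := hA.pos hd hR
  obtain ⟨x, hx⟩ := hM.exists_ball hρ hRc
  have hr0 : 0 < ρ ^ 2 * M.meshSize := by positivity
  have hxA : x ∈ A.aggregate R :=
    subset_aggregate (root_mem_aggregateCells hR) (hx (Metric.mem_closedBall_self hr0.le))
  set β := volume.real (Metric.closedBall (0 : Pt d) 1) with hβ
  have hvol : ∀ (y : Pt d) {r : ℝ}, 0 ≤ r → volume.real (Metric.closedBall y r) = r ^ d * β := by
    intro y r hr
    rw [measureReal_def, Measure.addHaar_closedBall' _ _ hr, ENNReal.toReal_mul,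
      ENNReal.toReal_ofReal (by positivity), finrank_euclideanSpace, Fintype.card_fin]
    rfl
  have hβpos : 0 < β :=
    ENNReal.toReal_pos (Metric.measure_closedBall_pos volume _ one_pos).ne'
      (isCompact_closedBall _ _).measure_lt_top.ne
  have h1 : ∑ T ∈ A.aggregateCells R, ∫ _ in T, (1 : ℝ) ≤
      volume.real (Metric.closedBall x (K * M.meshSize)) := by
    rw [← setIntegral_biUnion (aggregateCells_subset_cells (A := A)), ← aggregate_eq]
    · rw [setIntegral_const, smul_eq_mul, mul_one]
      exact measureReal_mono (hA.aggregate_subset hR hxA)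
        (isCompact_closedBall _ _).measure_lt_top.ne
    · intro T hT
      have := (M.isCell T (aggregateCells_subset_cells hT)).isCompact.measure_lt_top (μ := volume)
      exact integrableOn_const this.ne
  have h2 : ∀ T ∈ A.aggregateCells R, (ρ ^ 2 * M.meshSize) ^ d * β ≤ ∫ _ in T, (1 : ℝ) := by
    intro T hT
    obtain ⟨y, hy⟩ := hM.exists_ball hρ (aggregateCells_subset_cells hT)
    rw [setIntegral_const, smul_eq_mul, mul_one, ← hvol y hr0.le]
    exact measureReal_mono hy
      (M.isCell T (aggregateCells_subset_cells hT)).isCompact.measure_lt_top.ne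
  have h3 := (Finset.card_nsmul_le_sum _ _ _ h2).trans h1
  rw [hvol x (by positivity), nsmul_eq_mul, ← mul_assoc] at h3
  have h4 := le_of_mul_le_mul_right h3 hβpos
  rw [mul_pow, mul_pow, ← mul_assoc] at h4
  have h5 := le_of_mul_le_mul_right h4 (by positivity)
  rw [div_pow, le_div_iff₀ (by positivity)]
  exact h5

variable [FiniteDimensional ℝ F]

theorem exists_polynomial_approx_of_interior {T U : Set (Pt d)} (hT : Convex ℝ T)
    (hbdd : Bornology.IsBounded T) (hTU : interior T ⊆ U) {h : ℝ} (h0 : 0 < h)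
    (hh : ∀ x ∈ T, ∀ y ∈ T, ‖x - y‖ ≤ h) {m : ℕ} {u : Pt d → F}
    {g : (Fin m → Fin d) → Pt d → F} (hu : MemL2 U u)
    (hg2 : ∀ I, MemL2 U (g I)) (hg : ∀ I, IsWeakPartial U u I (g I)) :
    ∃ q ∈ polyF d F (m - 1), sqInt T (fun x => u x - q x) ≤
      (2 * 4 ^ d * d ^ m + 2) * h ^ (2 * m) * (sqInt T u + ∑ I, sqInt T (g I)) := by
  obtain ⟨q, hq, hle⟩ := exists_polynomial_approx isOpen_interior hT.interior
    (hbdd.subset interior_subset) h0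
    (fun x hx y hy => hh x (interior_subset hx) y (interior_subset hy))
    (hu.mono hTU) (fun I => (hg2 I).mono hTU) fun I => (hg I).mono hTU
  refine ⟨q, hq, ?_⟩
  have hae : interior T =ᵐ[volume] T := interior_ae_eq_of_null_frontier (hT.addHaar_frontier volume)
  simpa only [sqInt_congr_set _ hae] using hle

/-- The large ball is contained in the ball of twice its radius centred at any of its points `a`,
where the concentric estimate applies. -/
theorem exists_inner_ball_bound (d : ℕ) (F : Type*) [NormedAddCommGroup F] [InnerProductSpace ℝ F]
    [FiniteDimensional ℝ F] (k : ℕ) (κ τ : ℝ) (hτ : 0 < τ) :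
    ∃ C : ℝ, 0 < C ∧ ∀ f ∈ polyF d F k, ∀ (x a : Pt d) (h : ℝ), 0 < h →
      a ∈ Metric.closedBall x (κ * h) →
      sqInt (Metric.closedBall x (κ * h)) f ≤ C * sqInt (Metric.closedBall a (τ * h)) f := by
  obtain ⟨C, hC, hle⟩ := exists_ball_bound d F k (2 * κ / τ)
  refine ⟨C, hC, fun f hf x a h hh ha => ?_⟩
  refine le_trans ?_ (hle f hf a (τ * h) (by positivity))
  refine sqInt_mono (memL2_of_mem_polyF hf Metric.isBounded_closedBall) fun z hz => ?_
  have h1 : 2 * κ / τ * (τ * h) = κ * h + κ * h := by field_simp; ring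
  rw [h1]
  exact (dist_triangle_right z a x).trans (add_le_add hz ha)

/-- Each cell has a Bramble–Hilbert polynomial. Those of facet-adjacent cells are close because both
are close to the polynomial of a ball across the facet, and closeness on a small ball extends to one
ball `𝔅` around the aggregate. The root's polynomial, reached by a bounded chain, therefore serves
all cells. -/
theorem exists_aggregate_approx (hd : 1 ≤ d) (F : Type*) [NormedAddCommGroup F]
    [InnerProductSpace ℝ F] [FiniteDimensional ℝ F] (m : ℕ) {ρ : ℝ} (hρ : 0 < ρ) (K : ℝ) :
    ∃ C : ℝ, 0 < C ∧ ∀ (M : UnfittedMesh d) (A : M.Aggregation), M.IsRegular ρ → A.IsBounded K →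
      ∀ R ∈ M.interiorCells, ∀ (u : Pt d → F) (g : (Fin m → Fin d) → Pt d → F),
        MemL2 M.activeDomain u → (∀ I, MemL2 M.activeDomain (g I)) →
        (∀ I, IsWeakPartial M.activeDomain u I (g I)) →
        ∃ q ∈ polyF d F (m - 1), sqInt (A.aggregate R) (fun x => u x - q x) ≤
          C * M.meshSize ^ (2 * m) *
            (sqInt (A.aggregate R) u + ∑ I, sqInt (A.aggregate R) (g I)) := by
  set σ := ρ ^ 4 / (4 * (ρ ^ 2 + 1)) with hσ
  have hσ0 : 0 < σ := by positivity
  obtain ⟨C₁, hC₁, hball⟩ := exists_inner_ball_bound d F (m - 1) K (σ / 2) (by positivity)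
  -- A bound for the number of cells; the absolute value is there because `K` has no sign until a
  -- mesh is given.
  set N := |(K / ρ ^ 2) ^ d| + 1 with hN
  -- The length `(2 * σ + 1) * h` bounds the diameters both of cells and of facet balls of radius `σ
  -- * h`.
  set C₀ : ℝ := (2 * 4 ^ d * d ^ m + 2) * (2 * σ + 1) ^ (2 * m) with hC₀
  have hN0 : 0 < N := by positivity
  have hC₀0 : 0 < C₀ := by positivity
  -- Sum over at most `N` cells, each contributing its own error and that of a chain of at most `N`
  -- links, each of squared size at most `16 * C₁` times the local error.
  refine ⟨N * (2 + 2 * (N ^ 2 * (16 * C₁))) * C₀, by positivity, ?_⟩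
  intro M A hM hA R hR u g hu hg2 hg
  have hRc := active_subset (interiorCells_subset hR)
  set h := M.meshSize with hh
  have h0 : 0 < h := meshSize_pos hd hRc
  have hcard : ((A.aggregateCells R).card : ℝ) ≤ N :=
    (hA.card_le hd hρ hM hR).trans ((le_abs_self _).trans (by linarith))
  have hcell : ∀ T ∈ A.aggregateCells R, IsCell T := fun T hT =>
    M.isCell T (aggregateCells_subset_cells hT)
  have huA : MemL2 (A.aggregate R) u :=
    memL2_aggregate fun T hT => memL2_of_activeDomain hu (aggregateCells_subset hT)
  have hgA : ∀ I, MemL2 (A.aggregate R) (g I) := fun I =>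
    memL2_aggregate fun T hT => memL2_of_activeDomain (hg2 I) (aggregateCells_subset hT)
  set S := sqInt (A.aggregate R) u + ∑ I, sqInt (A.aggregate R) (g I) with hS
  have hS0 : 0 ≤ S := add_nonneg (sqInt_nonneg _ _) (Finset.sum_nonneg fun _ _ => sqInt_nonneg _ _)
  set B := C₀ * h ^ (2 * m) * S with hB
  have hB0 : 0 ≤ B := by positivity
  -- local approximation on convex subsets of the aggregate
  have hloc : ∀ T : Set (Pt d), Convex ℝ T → T ⊆ A.aggregate R → interior T ⊆ M.activeDomain →
      (∀ x ∈ T, ∀ y ∈ T, ‖x - y‖ ≤ (2 * σ + 1) * h) →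
      ∃ q ∈ polyF d F (m - 1), sqInt T (fun x => u x - q x) ≤ B := by
    intro T hT hTA hTU hTh
    obtain ⟨q, hq, hle⟩ := exists_polynomial_approx_of_interior hT
      ((isBounded_aggregate R).subset hTA) hTU (by positivity) hTh hu hg2 hg
    refine ⟨q, hq, hle.trans ?_⟩
    rw [hB, hC₀, mul_assoc _ ((2 * σ + 1) ^ (2 * m)), ← mul_pow]
    gcongr
    exact add_le_add (sqInt_mono huA hTA) (Finset.sum_le_sum fun I _ => sqInt_mono (hgA I) hTA)
  have hlocT : ∀ T ∈ A.aggregateCells R, ∃ q ∈ polyF d F (m - 1),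
      sqInt T (fun x => u x - q x) ≤ B := fun T hT => by
    refine hloc T (hcell T hT).convex (subset_aggregate hT)
      (interior_subset_activeDomain (aggregateCells_subset hT)) fun x hx y hy => ?_
    rw [← dist_eq_norm]
    refine (Metric.dist_le_diam_of_mem (hcell T hT).isBounded hx hy).trans
      ((diam_le_meshSize (aggregateCells_subset_cells hT)).trans ?_)
    rw [← hh]
    nlinarith
  have hq' : ∀ T : Set (Pt d), ∃ q ∈ polyF d F (m - 1),
      T ∈ A.aggregateCells R → sqInt T (fun x => u x - q x) ≤ B := fun T => by
    by_cases hT : T ∈ A.aggregateCells R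
    · obtain ⟨q, hq, hle⟩ := hlocT T hT
      exact ⟨q, hq, fun _ => hle⟩
    · exact ⟨0, zero_mem _, fun h => absurd h hT⟩
  choose q hq hqB using hq'
  obtain ⟨x₀, hx₀⟩ := hM.exists_ball hρ hRc
  have hx₀A : x₀ ∈ A.aggregate R := subset_aggregate (root_mem_aggregateCells hR)
    (hx₀ (Metric.mem_closedBall_self (by positivity)))
  set 𝔅 := Metric.closedBall x₀ (K * h) with h𝔅
  have hA𝔅 : A.aggregate R ⊆ 𝔅 := hA.aggregate_subset hR hx₀A
  have hL2 : ∀ {p : Pt d → F}, p ∈ polyF d F (m - 1) → ∀ {T : Set (Pt d)},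
      Bornology.IsBounded T → MemL2 T p := fun hp _ hT => memL2_of_mem_polyF hp hT
  -- polynomials that approximate `u` on overlapping sets are close
  have hclose : ∀ {T T' : Set (Pt d)} {p p' : Pt d → F} {a : Pt d}, p ∈ polyF d F (m - 1) →
      p' ∈ polyF d F (m - 1) → T ⊆ A.aggregate R → T' ⊆ A.aggregate R →
      sqInt T (fun x => u x - p x) ≤ B → sqInt T' (fun x => u x - p' x) ≤ B →
      Metric.closedBall a (σ / 2 * h) ⊆ T → Metric.closedBall a (σ / 2 * h) ⊆ T' →
      sqInt 𝔅 (fun x => p x - p' x) ≤ 4 * C₁ * B := by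
    intro T T' p p' a hp hp' hTA hTA' hpB hpB' ha ha'
    have hTb := (isBounded_aggregate R).subset hTA
    have hTb' := (isBounded_aggregate R).subset hTA'
    have haT : a ∈ 𝔅 := hA𝔅 (hTA (ha (Metric.mem_closedBall_self (by positivity))))
    have h1 := hball _ (sub_mem hp hp') x₀ a h h0 haT
    have h2 : sqInt (Metric.closedBall a (σ / 2 * h)) (fun x => p x - p' x) ≤ 2 * B + 2 * B := by
      have hm1 : MemL2 T (fun x => u x - p x) := (huA.mono hTA).sub (hL2 hp hTb)
      have hm2 : MemL2 T' (fun x => u x - p' x) := (huA.mono hTA').sub (hL2 hp' hTb')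
      have hm3 : MemL2 T (fun x => p x - u x) := (hL2 hp hTb).sub (huA.mono hTA)
      refine (sqInt_sub_le (hm3.mono ha) (hm2.mono ha')).trans ?_
      rw [sqInt_sub_comm _ p u]
      gcongr
      · exact (sqInt_mono hm1 ha).trans hpB
      · exact (sqInt_mono hm2 ha').trans hpB'
    calc sqInt 𝔅 (fun x => p x - p' x) ≤ C₁ * (2 * B + 2 * B) := h1.trans (by gcongr; exact h2)
      _ = 4 * C₁ * B := by ring
  have hadj : ∀ T ∈ A.aggregateCells R, ∀ T' ∈ A.aggregateCells R, FacetAdjacent T T' →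
      sqInt 𝔅 (fun x => q T x - q T' x) ≤ 16 * C₁ * B := by
    intro T hT T' hT' hTT'
    obtain ⟨x, a, a', hx, ha, ha'⟩ := hM.exists_facet_ball hρ h0 (aggregateCells_subset_cells hT)
      (aggregateCells_subset_cells hT') hTT'
    rw [← hσ, ← hh] at hx ha ha'
    rw [show σ * h / 2 = σ / 2 * h by ring] at ha ha'
    have hxA : Metric.closedBall x (σ * h) ⊆ A.aggregate R :=
      hx.trans (Set.union_subset (subset_aggregate hT) (subset_aggregate hT'))
    -- The interior of the ball lies in `Ω_h`, the interior of the union of closed cells, so the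
    -- weak derivatives of `u` are available across the facet.
    obtain ⟨p, hp, hpB⟩ := hloc (Metric.closedBall x (σ * h)) (convex_closedBall _ _) hxA (by
        rw [activeDomain_eq]
        refine interior_mono (hx.trans (Set.union_subset ?_ ?_))
        · exact Set.subset_biUnion_of_mem (u := fun T => T) (aggregateCells_subset hT)
        · exact Set.subset_biUnion_of_mem (u := fun T => T) (aggregateCells_subset hT'))
      (fun y hy z hz => by
        rw [← dist_eq_norm]
        have := (dist_triangle_right y z x).trans (add_le_add hy hz)
        nlinarith)
    have h1 := hclose (hq T) hp (subset_aggregate hT) hxA (hqB T hT) hpB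
      (ha.trans Set.inter_subset_left) (ha.trans Set.inter_subset_right)
    have h2 := hclose hp (hq T') hxA (subset_aggregate hT') hpB (hqB T' hT')
      (ha'.trans Set.inter_subset_right) (ha'.trans Set.inter_subset_left)
    have hb : Bornology.IsBounded 𝔅 := Metric.isBounded_closedBall
    refine (sqInt_sub_le ((hL2 (hq T) hb).sub (hL2 hp hb))
      ((hL2 hp hb).sub (hL2 (hq T') hb))).trans ?_
    linarith
  -- The chain argument needs the triangle inequality, hence norms in `L²(𝔅)` rather than their
  -- squares.
  let L := toL2 𝔅 (polyF d F (m - 1)) fun p hp => hL2 hp Metric.isBounded_closedBall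
  have hLsq : ∀ T T' : Set (Pt d), ‖L ⟨q T, hq T⟩ - L ⟨q T', hq T'⟩‖ ^ 2 =
      sqInt 𝔅 (fun x => q T x - q T' x) := by
    intro T T'
    rw [← map_sub]
    exact norm_toLp_sq (hL2 (sub_mem (hq T) (hq T')) Metric.isBounded_closedBall)
  have hdist : ∀ T ∈ A.aggregateCells R,
      sqInt 𝔅 (fun x => q T x - q R x) ≤ N ^ 2 * (16 * C₁ * B) := by
    intro T hT
    have h1 := exists_chain_bound (A.aggregateCells R) (root_mem_aggregateCells hR)
      (fun S S' hSS' => ⟨fun heq => by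
        have h2 := hSS'.1.2
        rw [heq, Set.inter_self] at h2
        exact (hcell S' hSS'.2).not_isFacet_self h2, hSS'.2⟩) (chain_of_mem hT)
      (D := fun T T' => ‖L ⟨q T, hq T⟩ - L ⟨q T', hq T'⟩‖) (fun T => by simp)
      (fun T T' => norm_sub_rev _ _) (fun T T' T'' => norm_sub_le_norm_sub_add_norm_sub _ _ _)
      (E := √(16 * C₁ * B)) (Real.sqrt_nonneg _)
      (fun S hS S' hS' hSS' => Real.le_sqrt_of_sq_le (by
        rw [hLsq]
        exact hadj S hS S' hS' hSS'.1))
    rw [sqInt_sub_comm, ← hLsq]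
    calc ‖L ⟨q R, hq R⟩ - L ⟨q T, hq T⟩‖ ^ 2
        ≤ (N * √(16 * C₁ * B)) ^ 2 := by
          gcongr
          refine h1.trans ?_
          gcongr
      _ = N ^ 2 * (16 * C₁ * B) := by rw [mul_pow, Real.sq_sqrt (by positivity)]
  refine ⟨q R, hq R, ?_⟩
  rw [sqInt_aggregate fun T hT => (huA.mono (subset_aggregate hT)).sub
    (hL2 (hq R) (hcell T hT).isBounded)]
  have hterm : ∀ T ∈ A.aggregateCells R, sqInt T (fun x => u x - q R x) ≤
      2 * B + 2 * (N ^ 2 * (16 * C₁ * B)) := by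
    intro T hT
    have hb := (hcell T hT).isBounded
    refine (sqInt_sub_le ((huA.mono (subset_aggregate hT)).sub (hL2 (hq T) hb))
      ((hL2 (hq T) hb).sub (hL2 (hq R) hb))).trans ?_
    gcongr
    · exact hqB T hT
    · refine (sqInt_mono ?_ ((subset_aggregate hT).trans hA𝔅)).trans (hdist T hT)
      exact (hL2 (hq T) Metric.isBounded_closedBall).sub (hL2 (hq R) Metric.isBounded_closedBall)
  calc ∑ T ∈ A.aggregateCells R, sqInt T (fun x => u x - q R x)
      ≤ (A.aggregateCells R).card * (2 * B + 2 * (N ^ 2 * (16 * C₁ * B))) := by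
        rw [← nsmul_eq_mul]
        exact Finset.sum_le_card_nsmul _ _ _ hterm
    _ ≤ N * (2 * B + 2 * (N ^ 2 * (16 * C₁ * B))) := by gcongr
    _ = _ := by rw [hB]; ring

end Aggregates

/-! ### Uniqueness of weak derivatives and monotonicity of Sobolev norms. -/

section Sobolev

variable {d : ℕ} {F : Type*} [NormedAddCommGroup F] [InnerProductSpace ℝ F] [CompleteSpace F]
variable {U W : Set (Pt d)} {u : Pt d → F}

/-- The fundamental lemma of the calculus of variations. It makes the chosen `weakPartial` on a
subset agree almost everywhere with the one on a larger set. -/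
theorem IsWeakPartial.ae_eq (hU : IsOpen U) {j : ℕ} {I : Fin j → Fin d} {g g' : Pt d → F}
    (hg : MemL2 U g) (hg' : MemL2 U g') (h : IsWeakPartial U u I g) (h' : IsWeakPartial U u I g') :
    g =ᵐ[volume.restrict U] g' := by
  have hl : LocallyIntegrable g (volume.restrict U) := hg.locallyIntegrable (by norm_num)
  have hl' : LocallyIntegrable g' (volume.restrict U) := hg'.locallyIntegrable (by norm_num)
  have h0 := hU.ae_eq_zero_of_integral_contDiff_smul_eq_zero
    ((hl.sub hl').locallyIntegrableOn U) fun φ hφ hφc hφU => by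
      have h1 := (h φ ⟨hφ, hφc, hφU⟩).symm.trans (h' φ ⟨hφ, hφc, hφU⟩)
      have h2 : (-1 : ℝ) ^ j ≠ 0 := pow_ne_zero _ (by norm_num)
      have h3 := smul_right_injective F h2 h1
      simp only [Pi.sub_apply, smul_sub]
      rw [integral_sub (hl.integrable_smul_left_of_hasCompactSupport hφ.continuous hφc)
        (hl'.integrable_smul_left_of_hasCompactSupport hφ.continuous hφc), h3, sub_self]
  filter_upwards [h0, ae_restrict_mem hU.measurableSet] with x hx hxU
  exact sub_eq_zero.1 (hx hxU)

theorem weakPartial_spec {j : ℕ} {I : Fin j → Fin d}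
    (h : ∃ g, MemL2 U g ∧ IsWeakPartial U u I g) :
    MemL2 U (weakPartial U u I) ∧ IsWeakPartial U u I (weakPartial U u I) := by
  rw [weakPartial, dif_pos h]
  exact h.choose_spec

theorem isWeakPartial_zero (I : Fin 0 → Fin d) : IsWeakPartial U u I u := by
  intro φ _
  simp

theorem sobolevNorm_sq (k : ℕ) (U : Set (Pt d)) (u : Pt d → F) :
    sobolevNorm k U u ^ 2 = ∑ j ∈ Finset.range (k + 1), ∑ I : Fin j → Fin d,
      sqInt U (weakPartial U u I) := by
  rw [sobolevNorm, Real.sq_sqrt]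
  · simp only [l2Norm_sq]
  · positivity

theorem sobolevNorm_nonneg (k : ℕ) (U : Set (Pt d)) (u : Pt d → F) : 0 ≤ sobolevNorm k U u :=
  Real.sqrt_nonneg _

theorem sum_sqInt_weakPartial_le {k j : ℕ} (hj : j ≤ k) (U : Set (Pt d)) (u : Pt d → F) :
    ∑ I : Fin j → Fin d, sqInt U (weakPartial U u I) ≤ sobolevNorm k U u ^ 2 := by
  rw [sobolevNorm_sq]
  exact Finset.single_le_sum
    (f := fun j => ∑ I : Fin j → Fin d, sqInt U (weakPartial U u I))
    (fun j _ => Finset.sum_nonneg fun _ _ => sqInt_nonneg _ _) (Finset.mem_range_succ_iff.2 hj)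

theorem MemSobolev.weakPartial_spec {k : ℕ} (h : MemSobolev k U u) {j : ℕ} (hj : j ≤ k)
    (I : Fin j → Fin d) :
    MemL2 U (weakPartial U u I) ∧ IsWeakPartial U u I (weakPartial U u I) :=
  UnfittedFE.weakPartial_spec (h.2 j hj I)

theorem MemSobolev.mono {k : ℕ} (h : MemSobolev k W u) (hUW : U ⊆ W) : MemSobolev k U u :=
  ⟨h.1.mono hUW, fun _ hj I => ⟨weakPartial W u I, (h.weakPartial_spec hj I).1.mono hUW,
    (h.weakPartial_spec hj I).2.mono hUW⟩⟩

theorem MemSobolev.weakPartial_ae_eq {k : ℕ} (h : MemSobolev k W u) (hU : IsOpen U)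
    (hUW : U ⊆ W) {j : ℕ} (hj : j ≤ k) (I : Fin j → Fin d) :
    weakPartial U u I =ᵐ[volume.restrict U] weakPartial W u I := by
  have h1 := (h.mono hUW).weakPartial_spec hj I
  have h2 := h.weakPartial_spec hj I
  exact h1.2.ae_eq hU h1.1 (h2.1.mono hUW) (h2.2.mono hUW)

theorem MemSobolev.sobolevNorm_mono {k : ℕ} (h : MemSobolev k W u) (hU : IsOpen U)
    (hUW : U ⊆ W) : sobolevNorm k U u ≤ sobolevNorm k W u := by
  refine le_of_sq_le_sq ?_ (sobolevNorm_nonneg _ _ _)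
  rw [sobolevNorm_sq, sobolevNorm_sq]
  refine Finset.sum_le_sum fun j hj => Finset.sum_le_sum fun I _ => ?_
  have hj' := Finset.mem_range_succ_iff.1 hj
  rw [sqInt_congr (h.weakPartial_ae_eq hU hUW hj' I)]
  exact sqInt_mono (h.weakPartial_spec hj' I).1 hUW

theorem MemSobolev.sqInt_add_sum_le {k : ℕ} (h : MemSobolev k W u) (hW : IsOpen W)
    (hUW : U ⊆ W) :
    sqInt U u + ∑ I : Fin k → Fin d, sqInt U (weakPartial W u I) ≤
      2 * sobolevNorm k W u ^ 2 := by
  have h1 : sqInt U u ≤ sobolevNorm k W u ^ 2 := by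
    refine (sqInt_mono h.1 hUW).trans ?_
    -- The zeroth-order term of `sobolevNorm` is a chosen weak partial along the empty index tuple;
    -- by uniqueness it is `u` almost everywhere.
    have hs := h.weakPartial_spec (Nat.zero_le k) (Fin.elim0 : Fin 0 → Fin d)
    rw [sqInt_congr ((isWeakPartial_zero _).ae_eq hW h.1 hs.1 hs.2)]
    refine le_trans ?_ (sum_sqInt_weakPartial_le (Nat.zero_le k) W u)
    exact Finset.single_le_sum (f := fun I : Fin 0 → Fin d => sqInt W (weakPartial W u I))
      (fun _ _ => sqInt_nonneg _ _) (Finset.mem_univ _)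
  have h2 : ∑ I : Fin k → Fin d, sqInt U (weakPartial W u I) ≤ sobolevNorm k W u ^ 2 := by
    refine le_trans ?_ (sum_sqInt_weakPartial_le le_rfl W u)
    exact Finset.sum_le_sum fun I _ => sqInt_mono (h.weakPartial_spec le_rfl I).1 hUW
  linarith

end Sobolev

/-! ### The operators `ℋ_h` on one aggregate. -/

section LocalStabilisation

variable {d : ℕ} {F : Type*} [NormedAddCommGroup F] [InnerProductSpace ℝ F]
variable {M : UnfittedMesh d}

open UnfittedMesh UnfittedMesh.Aggregation

theorem integrableOn_inner {S : Set (Pt d)} {u v : Pt d → F} (hu : MemL2 S u) (hv : MemL2 S v) :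
    IntegrableOn (fun x => ⟪u x, v x⟫) S := by
  refine Integrable.mono' (hu.integrable_sq.add hv.integrable_sq) (hu.1.inner hv.1)
    (Filter.Eventually.of_forall fun x => ?_)
  have h1 := norm_inner_le_norm (𝕜 := ℝ) (u x) (v x)
  simp only [Pi.add_apply]
  nlinarith [sq_nonneg (‖u x‖ - ‖v x‖), sq_nonneg (‖u x‖), sq_nonneg (‖v x‖)]

theorem l2Inner_self (S : Set (Pt d)) (u : Pt d → F) : l2Inner S u u = sqInt S u := by
  unfold l2Inner sqInt
  simp only [real_inner_self_eq_norm_sq]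

theorem sqInt_add_eq {S : Set (Pt d)} {u v : Pt d → F} (hu : MemL2 S u) (hv : MemL2 S v) :
    sqInt S (fun x => u x + v x) = sqInt S u + 2 * l2Inner S u v + sqInt S v := by
  unfold sqInt l2Inner
  have hi := (integrableOn_inner hu hv).const_mul 2
  have hadd : IntegrableOn (fun x => ‖u x‖ ^ 2 + 2 * ⟪u x, v x⟫) S := hu.integrable_sq.add hi
  rw [← integral_const_mul, ← integral_add hu.integrable_sq hi,
    ← integral_add hadd hv.integrable_sq]
  refine integral_congr_ae (Filter.Eventually.of_forall fun x => ?_)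
  exact norm_add_sq_real (u x) (v x)

/-- On every active cell, `v` coincides with an element of `V`. -/
def IsPiecewise (M : UnfittedMesh d) (V : Submodule ℝ (Pt d → F)) (v : Pt d → F) : Prop :=
  ∀ T ∈ M.active, ∃ p ∈ V, v =ᵐ[volume.restrict T] p

/-- The element of `V` that `bulkOp` assigns to the aggregate with root cell `R`. -/
def bulkValue (A : M.Aggregation) (V : Submodule ℝ (Pt d → F)) (v : Pt d → F) (R : Set (Pt d)) :
    BulkOperator → Pt d → F
  | .extension => localRep V R v
  | .projection => localProj V (A.aggregate R) v

theorem sum_indicator_interior_eq {T : Set (Pt d)} (hT : T ∈ M.active)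
    (f : Set (Pt d) → Pt d → F) {x : Pt d} (hx : x ∈ interior T) :
    (∑ T ∈ M.active, (interior T).indicator (f T)) x = f T x := by
  rw [Finset.sum_apply, Finset.sum_eq_single T]
  · exact Set.indicator_of_mem hx _
  · intro T' hT' hne
    refine Set.indicator_of_notMem (fun hx' => ?_) _
    exact Set.disjoint_left.1
      (M.disjoint_interior (active_subset hT) (active_subset hT') hne.symm) hx hx'
  · exact fun h => absurd hT h

theorem sum_indicator_interior_ae_eq {T : Set (Pt d)} (hT : T ∈ M.active)
    (f : Set (Pt d) → Pt d → F) :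
    (∑ T ∈ M.active, (interior T).indicator (f T)) =ᵐ[volume.restrict T] f T := by
  rw [← (isCell_of_mem_active hT).restrict_interior]
  filter_upwards [ae_restrict_mem isOpen_interior.measurableSet] with x hx
  exact sum_indicator_interior_eq hT f hx

theorem bulkOp_ae_eq (A : M.Aggregation) (V : Submodule ℝ (Pt d → F)) (κ : BulkOperator)
    (v : Pt d → F) {R T : Set (Pt d)} (hT : T ∈ A.aggregateCells R) :
    bulkOp A V κ v =ᵐ[volume.restrict T] bulkValue A V v R κ := by
  obtain ⟨hTa, rfl⟩ := mem_aggregateCells.1 hT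
  cases κ
  · exact sum_indicator_interior_ae_eq hTa fun T => localRep V (A.root T) v
  · exact sum_indicator_interior_ae_eq hTa fun T => localProj V (A.aggregate (A.root T)) v

variable [FiniteDimensional ℝ F]

theorem IsPiecewise.memL2 {V : Submodule ℝ (Pt d → F)} {l : ℕ} (hV : V ≤ polyF d F l)
    {v : Pt d → F} (hv : IsPiecewise M V v) {T : Set (Pt d)} (hT : T ∈ M.active) : MemL2 T v := by
  obtain ⟨p, hp, hvp⟩ := hv T hT
  exact (memL2_of_mem_polyF (hV hp) (isCell_of_mem_active hT).isBounded).congr hvp.symm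

theorem IsPiecewise.memL2_aggregate {V : Submodule ℝ (Pt d → F)} {l : ℕ} (hV : V ≤ polyF d F l)
    {v : Pt d → F} (hv : IsPiecewise M V v) (A : M.Aggregation) (R : Set (Pt d)) :
    MemL2 (A.aggregate R) v :=
  UnfittedMesh.Aggregation.memL2_aggregate fun _ hT => hv.memL2 hV (aggregateCells_subset hT)

/-- The image of `V` in `L²(S)` is finite-dimensional, hence admits orthogonal projections. This
rules out the default value in `localProj`. -/
theorem exists_l2_projection {V : Submodule ℝ (Pt d → F)} {l : ℕ} (hV : V ≤ polyF d F l)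
    {S : Set (Pt d)} (hS : Bornology.IsBounded S) {v : Pt d → F} (hv : MemL2 S v) :
    ∃ p ∈ V, ∀ w ∈ V, l2Inner S (fun x => v x - p x) w = 0 := by
  have hV2 : ∀ p ∈ V, MemL2 S p := fun p hp => memL2_of_mem_polyF (hV hp) hS
  have : FiniteDimensional ℝ V := Submodule.finiteDimensional_of_le hV
  let L := toL2 S V hV2
  obtain ⟨w, ⟨p, rfl⟩, hw⟩ := Submodule.HasOrthogonalProjection.exists_orthogonal
    (K := LinearMap.range L) (MemLp.toLp v hv)
  refine ⟨p.1, p.2, fun q hq => ?_⟩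
  rw [← inner_toLp (hv.sub (hV2 p.1 p.2)) (hV2 q hq), real_inner_comm]
  exact hw (L ⟨q, hq⟩) ⟨⟨q, hq⟩, rfl⟩

/-- The aggregate lies in a ball of radius `K h` centred at the centre of a ball of radius `ρ ^ 2 *
h` inside the root, so the comparison on concentric balls applies. -/
theorem exists_aggregate_bound (hd : 1 ≤ d) (F : Type*) [NormedAddCommGroup F]
    [InnerProductSpace ℝ F] [FiniteDimensional ℝ F] (l : ℕ) {ρ : ℝ} (hρ : 0 < ρ) (K : ℝ) :
    ∃ C : ℝ, 0 < C ∧ ∀ (M : UnfittedMesh d) (A : M.Aggregation), M.IsRegular ρ → A.IsBounded K →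
      ∀ R ∈ M.interiorCells, ∀ f ∈ polyF d F l,
        sqInt (A.aggregate R) f ≤ C * sqInt R f := by
  obtain ⟨C, hC, hle⟩ := exists_inner_ball_bound d F l K (ρ ^ 2) (by positivity)
  refine ⟨C, hC, fun M A hM hA R hR f hf => ?_⟩
  have hRc := active_subset (interiorCells_subset hR)
  have h0 := meshSize_pos hd hRc
  obtain ⟨x, hx⟩ := hM.exists_ball hρ hRc
  have hxA : x ∈ A.aggregate R := subset_aggregate (root_mem_aggregateCells hR)
    (hx (Metric.mem_closedBall_self (by positivity)))
  have hK := hA.pos hd hR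
  calc sqInt (A.aggregate R) f ≤ sqInt (Metric.closedBall x (K * M.meshSize)) f :=
        sqInt_mono (memL2_of_mem_polyF hf Metric.isBounded_closedBall)
          (hA.aggregate_subset hR hxA)
    _ ≤ C * sqInt (Metric.closedBall x (ρ ^ 2 * M.meshSize)) f :=
        hle f hf x x M.meshSize h0 (Metric.mem_closedBall_self (by positivity))
    _ ≤ C * sqInt R f := by
        gcongr
        exact sqInt_mono (memL2_of_mem_polyF hf (M.isCell R hRc).isBounded) hx

variable {A : M.Aggregation} {V : Submodule ℝ (Pt d → F)} {l : ℕ} {v : Pt d → F}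
  {R : Set (Pt d)}

theorem localRep_spec (hv : IsPiecewise M V v) (hR : R ∈ M.interiorCells) :
    localRep V R v ∈ V ∧ v =ᵐ[volume.restrict R] localRep V R v := by
  have h := hv R (interiorCells_subset hR)
  rw [localRep, dif_pos h]
  exact h.choose_spec

theorem localProj_spec (hV : V ≤ polyF d F l) (hv : IsPiecewise M V v) :
    localProj V (A.aggregate R) v ∈ V ∧
      ∀ w ∈ V, l2Inner (A.aggregate R) (fun x => v x - localProj V (A.aggregate R) v x) w = 0 := by
  have h := exists_l2_projection hV (isBounded_aggregate R) (hv.memL2_aggregate hV A R)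
  rw [localProj, dif_pos h]
  exact h.choose_spec

theorem bulkValue_mem (hV : V ≤ polyF d F l) (hv : IsPiecewise M V v) (hR : R ∈ M.interiorCells)
    (κ : BulkOperator) : bulkValue A V v R κ ∈ V := by
  cases κ
  · exact (localRep_spec hv hR).1
  · exact (localProj_spec hV hv).1

/-- The operators `ℋ_h` are quasi-optimal on each aggregate. -/
theorem sqInt_sub_bulkValue_le (hV : V ≤ polyF d F l) (hv : IsPiecewise M V v)
    (hR : R ∈ M.interiorCells) {C : ℝ} (hC0 : 0 < C)
    (hC : ∀ f ∈ polyF d F l, sqInt (A.aggregate R) f ≤ C * sqInt R f)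
    (κ : BulkOperator) {q : Pt d → F} (hq : q ∈ V) :
    sqInt (A.aggregate R) (fun x => v x - bulkValue A V v R κ x) ≤
      (2 + 2 * C) * sqInt (A.aggregate R) (fun x => v x - q x) := by
  have hb := isBounded_aggregate (A := A) R
  have hvA := hv.memL2_aggregate hV A R
  have hpV := bulkValue_mem (A := A) hV hv hR κ
  have hp2 := memL2_of_mem_polyF (hV hpV) hb
  have hq2 := memL2_of_mem_polyF (hV hq) hb
  have hpos := sqInt_nonneg (A.aggregate R) (fun x => v x - q x)
  cases κ with
  | extension =>
    have hae : v =ᵐ[volume.restrict R] bulkValue A V v R .extension := (localRep_spec hv hR).2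
    set p := bulkValue A V v R .extension
    have h1 := sqInt_sub_le (hvA.sub hq2) (hq2.sub hp2)
    have h2 := hC _ (sub_mem (hV hq) (hV hpV))
    -- The extension agrees with `v` on the root, so the inverse estimate for `q - p` involves only
    -- the error `v - q` there.
    have h3 : sqInt R (q - p) = sqInt R (fun x => v x - q x) := by
      rw [sqInt_sub_comm R v q]
      exact sqInt_congr (hae.mono fun x hx => by simp only [Pi.sub_apply, hx])
    have h4 : sqInt R (fun x => v x - q x) ≤ sqInt (A.aggregate R) (fun x => v x - q x) :=
      sqInt_mono (hvA.sub hq2) (subset_aggregate (root_mem_aggregateCells hR))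
    rw [h3] at h2
    have h5 : sqInt (A.aggregate R) (fun x => q x - p x) ≤
        C * sqInt (A.aggregate R) (fun x => v x - q x) := h2.trans (by gcongr)
    linarith
  | projection =>
    have horth := (localProj_spec (A := A) (R := R) hV hv).2
    change ∀ w ∈ V, l2Inner _ (fun x => v x - bulkValue A V v R .projection x) w = 0 at horth
    set p := bulkValue A V v R .projection
    -- Pythagoras: the projection is a best approximation, and its constant 1 is below `2 + 2 * C`.
    have h1 := sqInt_add_eq (hvA.sub hp2) (hp2.sub hq2)
    have h2 : l2Inner (A.aggregate R) (fun x => v x - p x) (fun x => p x - q x) = 0 :=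
      horth _ (sub_mem hpV hq)
    rw [h2] at h1
    simp only [sub_add_sub_cancel] at h1
    have h3 := sqInt_nonneg (A.aggregate R) (fun x => p x - q x)
    nlinarith

open Classical in
/-- On the root cell, the residual of `ℋ_h` is controlled by the one on the cut cells. -/
theorem sqInt_root_sub_bulkValue_le (hV : V ≤ polyF d F l) (hv : IsPiecewise M V v)
    (hR : R ∈ M.interiorCells) {C : ℝ} (hC0 : 0 < C)
    (hC : ∀ f ∈ polyF d F l, sqInt (A.aggregate R) f ≤ C * sqInt R f) (κ : BulkOperator) :
    sqInt R (fun x => v x - bulkValue A V v R κ x) ≤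
      C * ∑ T ∈ (A.aggregateCells R).erase R, sqInt T (fun x => v x - bulkValue A V v R κ x) := by
  have hpV := bulkValue_mem (A := A) hV hv hR κ
  have hsum0 : 0 ≤ ∑ T ∈ (A.aggregateCells R).erase R,
      sqInt T (fun x => v x - bulkValue A V v R κ x) :=
    Finset.sum_nonneg fun _ _ => sqInt_nonneg _ _
  cases κ with
  | extension =>
    have hae : v =ᵐ[volume.restrict R] bulkValue A V v R .extension := (localRep_spec hv hR).2
    have h0 : sqInt R (fun x => v x - bulkValue A V v R .extension x) = 0 := by
      have h1 : (fun x => v x - bulkValue A V v R .extension x) =ᵐ[volume.restrict R] fun _ => 0 :=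
        hae.mono fun x hx => sub_eq_zero.2 hx
      rw [sqInt_congr h1]
      simp [sqInt]
    rw [h0]
    positivity
  | projection =>
    have horth := (localProj_spec (A := A) (R := R) hV hv).2
    change ∀ w ∈ V, l2Inner _ (fun x => v x - bulkValue A V v R .projection x) w = 0 at horth
    set p := bulkValue A V v R .projection
    obtain ⟨pR, hpR, hvR⟩ := hv R (interiorCells_subset hR)
    -- The residual on the root, continued as a polynomial to the whole aggregate, is an admissible
    -- test function for the orthogonality.
    set e : Pt d → F := pR - p with he
    have heV : e ∈ V := sub_mem hpR hpV
    have hcell : ∀ T ∈ A.aggregateCells R, MemL2 T (fun x => v x - p x) ∧ MemL2 T e :=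
      fun T hT => by
        have hTb := (isCell_of_mem_active (aggregateCells_subset hT)).isBounded
        exact ⟨(hv.memL2 hV (aggregateCells_subset hT)).sub (memL2_of_mem_polyF (hV hpV) hTb),
          memL2_of_mem_polyF (hV heV) hTb⟩
    have hRe : (fun x => v x - p x) =ᵐ[volume.restrict R] e :=
      hvR.mono fun x hx => by simp only [hx, he, Pi.sub_apply]
    have hsplit : l2Inner (A.aggregate R) (fun x => v x - p x) e =
        ∑ T ∈ A.aggregateCells R, l2Inner T (fun x => v x - p x) e := by
      rw [aggregate_eq]
      exact setIntegral_biUnion aggregateCells_subset_cells fun T hT =>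
        integrableOn_inner (hcell T hT).1 (hcell T hT).2
    rw [horth e heV, ← Finset.add_sum_erase _ _ (root_mem_aggregateCells hR)] at hsplit
    have hroot : l2Inner R (fun x => v x - p x) e = sqInt R e := by
      rw [← l2Inner_self]
      exact integral_congr_ae (hRe.mono fun x hx => by simp only at hx; simp only [hx])
    rw [sqInt_congr hRe]
    -- Young's inequality, weighted so that after the inverse estimate for `e` half of `sqInt R e`
    -- can be absorbed on the left.
    have hyoung : ∀ T ∈ (A.aggregateCells R).erase R, -l2Inner T (fun x => v x - p x) e ≤
        C / 2 * sqInt T (fun x => v x - p x) + (2 * C)⁻¹ * sqInt T e := by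
      intro T hT
      have hTm := hcell T (Finset.mem_of_mem_erase hT)
      refine (neg_le_abs _).trans ((l2Inner_le hTm.1 hTm.2).trans ?_)
      rw [← l2Norm_sq, ← l2Norm_sq]
      set a := l2Norm T fun x => v x - p x
      set b := l2Norm T e
      have h1 : C / 2 * a ^ 2 + (2 * C)⁻¹ * b ^ 2 - a * b = (2 * C)⁻¹ * (C * a - b) ^ 2 := by
        field_simp
        ring
      have h2 : 0 ≤ (2 * C)⁻¹ * (C * a - b) ^ 2 := by positivity
      linarith
    have hsum := Finset.sum_le_sum hyoung
    rw [Finset.sum_neg_distrib, Finset.sum_add_distrib, ← Finset.mul_sum, ← Finset.mul_sum] at hsum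
    have herase : ∑ T ∈ (A.aggregateCells R).erase R, sqInt T e ≤ C * sqInt R e := by
      refine le_trans ?_ (hC e (hV heV))
      rw [sqInt_aggregate fun T hT => (hcell T hT).2]
      exact Finset.sum_le_sum_of_subset_of_nonneg (Finset.erase_subset _ _)
        fun _ _ _ => sqInt_nonneg _ _
    have hhalf : (2 * C)⁻¹ * ∑ T ∈ (A.aggregateCells R).erase R, sqInt T e ≤ sqInt R e / 2 := by
      calc (2 * C)⁻¹ * ∑ T ∈ (A.aggregateCells R).erase R, sqInt T e
          ≤ (2 * C)⁻¹ * (C * sqInt R e) := by gcongr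
        _ = sqInt R e / 2 := by field_simp
    linarith

end LocalStabilisation

/-! ### Summation over aggregates. -/

section Global

variable {d : ℕ} {F : Type*} [NormedAddCommGroup F] [InnerProductSpace ℝ F]
variable {M : UnfittedMesh d} {A : M.Aggregation}

open UnfittedMesh UnfittedMesh.Aggregation

theorem sum_active_eq (A : M.Aggregation) (f : Set (Pt d) → ℝ) :
    ∑ T ∈ M.active, f T = ∑ R ∈ M.interiorCells, ∑ T ∈ A.aggregateCells R, f T := by
  classical
  rw [← Finset.sum_fiberwise_of_maps_to A.root_mem]
  refine Finset.sum_congr rfl fun R _ => Finset.sum_congr ?_ fun _ _ => rfl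
  ext T
  simp [mem_aggregateCells]

-- Every interior cell is its own root, so removing the roots from the aggregates leaves exactly the
-- cut cells.
open Classical in
theorem sum_cutCells_eq (A : M.Aggregation) (f : Set (Pt d) → ℝ) :
    ∑ T ∈ M.cutCells, f T =
      ∑ R ∈ M.interiorCells, ∑ T ∈ (A.aggregateCells R).erase R, f T := by
  have h1 : ∑ T ∈ M.cutCells, f T + ∑ T ∈ M.interiorCells, f T = ∑ T ∈ M.active, f T :=
    Finset.sum_sdiff interiorCells_subset
  have h2 : ∑ R ∈ M.interiorCells, ∑ T ∈ A.aggregateCells R, f T =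
      ∑ R ∈ M.interiorCells, (f R + ∑ T ∈ (A.aggregateCells R).erase R, f T) :=
    Finset.sum_congr rfl fun R hR =>
      (Finset.add_sum_erase _ f (root_mem_aggregateCells hR)).symm
  rw [sum_active_eq A, h2, Finset.sum_add_distrib] at h1
  linarith

theorem sqInt_activeDomain_eq_sum_aggregate (A : M.Aggregation) {u : Pt d → F}
    (hu : ∀ T ∈ M.active, MemL2 T u) :
    sqInt M.activeDomain u = ∑ R ∈ M.interiorCells, sqInt (A.aggregate R) u := by
  rw [sqInt_activeDomain hu, sum_active_eq A]
  exact Finset.sum_congr rfl fun R _ =>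
    (sqInt_aggregate fun T hT => hu T (aggregateCells_subset hT)).symm

theorem mem_aggregateCells_root {T : Set (Pt d)} (hT : T ∈ M.active) :
    T ∈ A.aggregateCells (A.root T) :=
  mem_aggregateCells.2 ⟨hT, rfl⟩

/-- The function that coincides with `q R` on the aggregate of root `R`. -/
theorem exists_aggregatewise (A : M.Aggregation) (q : Set (Pt d) → Pt d → F) :
    ∃ w : Pt d → F, ∀ R, ∀ T ∈ A.aggregateCells R, w =ᵐ[volume.restrict T] q R := by
  refine ⟨∑ T ∈ M.active, (interior T).indicator (q (A.root T)), fun R T hT => ?_⟩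
  obtain ⟨hTa, rfl⟩ := mem_aggregateCells.1 hT
  exact sum_indicator_interior_ae_eq hTa fun T => q (A.root T)

variable [FiniteDimensional ℝ F] {V : Submodule ℝ (Pt d → F)} {l : ℕ} {v : Pt d → F}

theorem memL2_sub_bulkOp (A : M.Aggregation) (hV : V ≤ polyF d F l) (hv : IsPiecewise M V v)
    (κ : BulkOperator) {T : Set (Pt d)} (hT : T ∈ M.active) :
    MemL2 T (fun x => v x - bulkOp A V κ v x) := by
  have hp := bulkValue_mem (A := A) hV hv (A.root_mem T hT) κ
  exact (hv.memL2 hV hT).sub ((memL2_of_mem_polyF (hV hp) (isCell_of_mem_active hT).isBounded).congr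
    (bulkOp_ae_eq A V κ v (mem_aggregateCells_root hT)).symm)

theorem memL2_cutDomain_sub_bulkOp (A : M.Aggregation) (hV : V ≤ polyF d F l)
    (hv : IsPiecewise M V v) (κ : BulkOperator) :
    MemL2 M.cutDomain (fun x => v x - bulkOp A V κ v x) :=
  memL2_biUnion fun _ hT => memL2_sub_bulkOp A hV hv κ (cutCells_subset hT)

theorem sqInt_sub_bulkOp (κ : BulkOperator) {R T : Set (Pt d)} (hT : T ∈ A.aggregateCells R) :
    sqInt T (fun x => v x - bulkOp A V κ v x) = sqInt T (fun x => v x - bulkValue A V v R κ x) :=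
  sqInt_congr ((bulkOp_ae_eq A V κ v hT).mono fun x hx => by simp only [hx])

theorem bulkStab_self (A : M.Aggregation) (V : Submodule ℝ (Pt d → F)) (κ : BulkOperator)
    (v : Pt d → F) :
    bulkStab A V κ v v = sqInt M.cutDomain (fun x => v x - bulkOp A V κ v x) :=
  l2Inner_self _ _

theorem sqInt_cutDomain_sub_bulkOp_le (hV : V ≤ polyF d F l) (hv : IsPiecewise M V v)
    {C : ℝ} (hC0 : 0 < C)
    (hC : ∀ R ∈ M.interiorCells, ∀ f ∈ polyF d F l, sqInt (A.aggregate R) f ≤ C * sqInt R f)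
    (κ : BulkOperator) {q : Set (Pt d) → Pt d → F} (hq : ∀ R ∈ M.interiorCells, q R ∈ V) :
    sqInt M.cutDomain (fun x => v x - bulkOp A V κ v x) ≤
      (2 + 2 * C) * ∑ R ∈ M.interiorCells, sqInt (A.aggregate R) (fun x => v x - q R x) := by
  rw [sqInt_cutDomain fun T hT => memL2_sub_bulkOp A hV hv κ (cutCells_subset hT), Finset.mul_sum]
  refine (Finset.sum_le_sum_of_subset_of_nonneg cutCells_subset
    fun _ _ _ => sqInt_nonneg _ _).trans ?_
  rw [sum_active_eq A]
  refine Finset.sum_le_sum fun R hR => ?_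
  refine le_trans (le_of_eq ?_) (sqInt_sub_bulkValue_le hV hv hR hC0 (hC R hR) κ (hq R hR))
  have hp := bulkValue_mem (A := A) hV hv hR κ
  rw [sqInt_aggregate fun T hT => (hv.memL2 hV (aggregateCells_subset hT)).sub
    (memL2_of_mem_polyF (hV hp) (isCell_of_mem_active (aggregateCells_subset hT)).isBounded)]
  exact Finset.sum_congr rfl fun T hT => sqInt_sub_bulkOp κ hT

theorem sqInt_cutDomain_sub_bulkOp_le_activeDomain (hV : V ≤ polyF d F l)
    (hv : IsPiecewise M V v) {C : ℝ} (hC0 : 0 < C)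
    (hC : ∀ R ∈ M.interiorCells, ∀ f ∈ polyF d F l, sqInt (A.aggregate R) f ≤ C * sqInt R f)
    (κ : BulkOperator) :
    sqInt M.cutDomain (fun x => v x - bulkOp A V κ v x) ≤
      (2 + 2 * C) * sqInt M.activeDomain v := by
  -- Quasi-optimality against the zero polynomial is stability.
  have h := sqInt_cutDomain_sub_bulkOp_le hV hv hC0 hC κ (q := 0) fun _ _ => V.zero_mem
  simp only [Pi.zero_apply, sub_zero] at h
  rwa [sqInt_activeDomain_eq_sum_aggregate A fun T hT => hv.memL2 hV hT]

-- Off the root, `v` is its residual plus the polynomial `p`; the inverse estimate moves `p` to the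
-- root, where it is `v` up to a residual that is controlled by the cut cells.
open Classical in
theorem sqInt_aggregate_le (hV : V ≤ polyF d F l) (hv : IsPiecewise M V v) {R : Set (Pt d)}
    (hR : R ∈ M.interiorCells) {C : ℝ} (hC0 : 0 < C)
    (hC : ∀ f ∈ polyF d F l, sqInt (A.aggregate R) f ≤ C * sqInt R f) (κ : BulkOperator) :
    sqInt (A.aggregate R) v ≤ (1 + 4 * C) * sqInt R v + (2 + 4 * C ^ 2) *
      ∑ T ∈ (A.aggregateCells R).erase R, sqInt T (fun x => v x - bulkValue A V v R κ x) := by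
  have hpV := hV (bulkValue_mem (A := A) hV hv hR κ)
  have hroot := sqInt_root_sub_bulkValue_le hV hv hR hC0 hC κ
  set p := bulkValue A V v R κ
  have hv2 : ∀ T ∈ A.aggregateCells R, MemL2 T v := fun T hT =>
    hv.memL2 hV (aggregateCells_subset hT)
  have hp2 : ∀ T ∈ A.aggregateCells R, MemL2 T p := fun T hT =>
    memL2_of_mem_polyF hpV (isCell_of_mem_active (aggregateCells_subset hT)).isBounded
  have hRm := root_mem_aggregateCells (A := A) hR
  rw [sqInt_aggregate hv2, ← Finset.add_sum_erase _ _ hRm]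
  have h1 : ∑ T ∈ (A.aggregateCells R).erase R, sqInt T v ≤
      2 * ∑ T ∈ (A.aggregateCells R).erase R, sqInt T (fun x => v x - p x) +
        2 * ∑ T ∈ (A.aggregateCells R).erase R, sqInt T p := by
    rw [Finset.mul_sum, Finset.mul_sum, ← Finset.sum_add_distrib]
    exact Finset.sum_le_sum fun T hT => sqInt_le_add (hv2 T (Finset.mem_of_mem_erase hT))
      (hp2 T (Finset.mem_of_mem_erase hT))
  have h2 : ∑ T ∈ (A.aggregateCells R).erase R, sqInt T p ≤ C * sqInt R p := by
    refine le_trans ?_ (hC p hpV)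
    rw [sqInt_aggregate hp2]
    exact Finset.sum_le_sum_of_subset_of_nonneg (Finset.erase_subset _ _)
      fun _ _ _ => sqInt_nonneg _ _
  have h3 := sqInt_le_add (hp2 R hRm) (hv2 R hRm)
  rw [sqInt_sub_comm] at h3
  have h4 := mul_le_mul_of_nonneg_left (h3.trans (add_le_add_left
    (mul_le_mul_of_nonneg_left hroot zero_le_two) _)) hC0.le
  linarith

theorem sqInt_activeDomain_le (hV : V ≤ polyF d F l) (hv : IsPiecewise M V v)
    {C : ℝ} (hC0 : 0 < C)
    (hC : ∀ R ∈ M.interiorCells, ∀ f ∈ polyF d F l, sqInt (A.aggregate R) f ≤ C * sqInt R f)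
    (κ : BulkOperator) :
    sqInt M.activeDomain v ≤ (1 + 4 * C) * sqInt M.domain v +
      (2 + 4 * C ^ 2) * sqInt M.cutDomain (fun x => v x - bulkOp A V κ v x) := by
  classical
  have hv2 : ∀ T ∈ M.active, MemL2 T v := fun T hT => hv.memL2 hV hT
  have hΩ := sum_interiorCells_le ((memL2_activeDomain hv2).mono domain_subset_activeDomain)
  rw [sqInt_cutDomain fun T hT => memL2_sub_bulkOp A hV hv κ (cutCells_subset hT),
    sum_cutCells_eq A, sqInt_activeDomain_eq_sum_aggregate A hv2]
  refine le_trans ?_ (add_le_add_left (mul_le_mul_of_nonneg_left hΩ (by positivity)) _)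
  rw [Finset.mul_sum, Finset.mul_sum, ← Finset.sum_add_distrib]
  refine Finset.sum_le_sum fun R hR => ?_
  refine (sqInt_aggregate_le hV hv hR hC0 (hC R hR) κ).trans_eq ?_
  congr 2
  exact Finset.sum_congr rfl fun T hT => (sqInt_sub_bulkOp κ (Finset.mem_of_mem_erase hT)).symm

theorem abs_bulkStab_le (A : M.Aggregation) (hV : V ≤ polyF d F l) {u : Pt d → F}
    (hu : IsPiecewise M V u) (hv : IsPiecewise M V v) (κ : BulkOperator) :
    |bulkStab A V κ u v| ≤ l2Norm M.cutDomain (fun x => u x - bulkOp A V κ u x) *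
      l2Norm M.cutDomain (fun x => v x - bulkOp A V κ v x) :=
  l2Inner_le (memL2_cutDomain_sub_bulkOp A hV hu κ) (memL2_cutDomain_sub_bulkOp A hV hv κ)

/-- Functions that are in `V` on each aggregate lie in the kernel of the stabilisation. -/
theorem bulkStab_eq_zero (hV : V ≤ polyF d F l) {u : Pt d → F} (hu : IsPiecewise M V u)
    (hv : IsPiecewise M V v) {C : ℝ} (hC0 : 0 < C)
    (hC : ∀ R ∈ M.interiorCells, ∀ f ∈ polyF d F l, sqInt (A.aggregate R) f ≤ C * sqInt R f)
    (κ : BulkOperator) {q : Set (Pt d) → Pt d → F} (hq : ∀ R ∈ M.interiorCells, q R ∈ V)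
    (huq : ∀ R ∈ M.interiorCells, ∀ T ∈ A.aggregateCells R, u =ᵐ[volume.restrict T] q R) :
    bulkStab A V κ u v = 0 := by
  -- Quasi-optimality against `u` itself, represented by `q`, makes its residual zero;
  -- Cauchy–Schwarz then kills the form.
  have h1 := sqInt_cutDomain_sub_bulkOp_le hV hu hC0 hC κ hq
  have h2 : ∑ R ∈ M.interiorCells, sqInt (A.aggregate R) (fun x => u x - q R x) = 0 := by
    refine Finset.sum_eq_zero fun R hR => ?_
    rw [sqInt_aggregate fun T hT => (hu.memL2 hV (aggregateCells_subset hT)).sub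
      (memL2_of_mem_polyF (hV (hq R hR))
        (isCell_of_mem_active (aggregateCells_subset hT)).isBounded)]
    refine Finset.sum_eq_zero fun T hT => ?_
    have h3 : (fun x => u x - q R x) =ᵐ[volume.restrict T] fun _ => 0 :=
      (huq R hR T hT).mono fun x hx => sub_eq_zero.2 hx
    rw [sqInt_congr h3]
    simp [sqInt]
  rw [h2, mul_zero, ← l2Norm_sq] at h1
  have h4 : l2Norm M.cutDomain (fun x => u x - bulkOp A V κ u x) = 0 :=
    pow_eq_zero_iff two_ne_zero |>.1 (le_antisymm h1 (sq_nonneg _))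
  have h5 := abs_bulkStab_le A hV hu hv κ
  rw [h4, zero_mul] at h5
  exact abs_nonpos_iff.1 h5

/-- Avoids square roots of constants, since `D ≤ (D + 1) ^ 2`. -/
theorem le_mul_of_sq_le {x y D : ℝ} (hD : 0 ≤ D) (hy : 0 ≤ y) (h : x ^ 2 ≤ D * y ^ 2) :
    x ≤ (D + 1) * y := by
  refine le_of_sq_le_sq (h.trans ?_) (by positivity)
  nlinarith [mul_nonneg (show 0 ≤ D ^ 2 + D + 1 by positivity) (sq_nonneg y)]

end Global

/-! ### The claims for a general piecewise polynomial space. -/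

section Stability

variable {d : ℕ}

open UnfittedMesh UnfittedMesh.Aggregation

theorem exists_aggregatewise_approx (hd : 1 ≤ d) (F : Type*) [NormedAddCommGroup F]
    [InnerProductSpace ℝ F] [FiniteDimensional ℝ F] (k : ℕ) {ρ : ℝ} (hρ : 0 < ρ) (K : ℝ) :
    ∃ C : ℝ, 0 < C ∧ ∀ (M : UnfittedMesh d) (A : M.Aggregation), M.IsRegular ρ → A.IsBounded K →
      ∀ W : Set (Pt d), IsOpen W → M.activeDomain ⊆ W → ∀ m ≤ k + 1, ∀ u : Pt d → F,
        MemSobolev m W u → ∃ q : Set (Pt d) → Pt d → F,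
          (∀ R ∈ M.interiorCells, q R ∈ polyF d F k) ∧
          ∑ R ∈ M.interiorCells, sqInt (A.aggregate R) (fun x => u x - q R x) ≤
            C * (M.meshSize ^ m * sobolevNorm m W u) ^ 2 := by
  choose C hC happ using fun m => exists_aggregate_approx hd F m hρ K
  -- Summing over the orders `0, …, k + 1` makes the constant uniform in the order; the factor 2
  -- comes from `sqInt_add_sum_le`.
  refine ⟨2 * ∑ m ∈ Finset.range (k + 2), C m,
    mul_pos two_pos (Finset.sum_pos (fun m _ => hC m) (by simp)), ?_⟩
  intro M A hM hA W hW hMW m hm u hu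
  have hspec := hu.weakPartial_spec le_rfl
  have hex : ∀ R, ∃ q : Pt d → F, R ∈ M.interiorCells → q ∈ polyF d F (m - 1) ∧
      sqInt (A.aggregate R) (fun x => u x - q x) ≤ C m * M.meshSize ^ (2 * m) *
        (sqInt (A.aggregate R) u + ∑ I : Fin m → Fin d, sqInt (A.aggregate R) (weakPartial W u I)) := by
    intro R
    by_cases hR : R ∈ M.interiorCells
    · obtain ⟨q, hq⟩ := happ m M A hM hA R hR u (weakPartial W u) (hu.1.mono hMW)
        (fun I => (hspec I).1.mono hMW) (fun I => (hspec I).2.mono hMW)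
      exact ⟨q, fun _ => hq⟩
    · exact ⟨0, fun h => absurd h hR⟩
  choose q hq using hex
  refine ⟨q, fun R hR => polyF_mono (by omega) (hq R hR).1, ?_⟩
  have hcell : ∀ {f : Pt d → F}, MemL2 W f → ∀ T ∈ M.active, MemL2 T f :=
    fun hf _ hT => memL2_of_activeDomain (hf.mono hMW) hT
  have hCm : C m ≤ ∑ m ∈ Finset.range (k + 2), C m :=
    Finset.single_le_sum (fun i _ => (hC i).le) (Finset.mem_range.2 (by omega))
  calc ∑ R ∈ M.interiorCells, sqInt (A.aggregate R) (fun x => u x - q R x)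
      ≤ ∑ R ∈ M.interiorCells, C m * M.meshSize ^ (2 * m) *
          (sqInt (A.aggregate R) u + ∑ I : Fin m → Fin d, sqInt (A.aggregate R) (weakPartial W u I)) :=
        Finset.sum_le_sum fun R hR => (hq R hR).2
    _ = C m * M.meshSize ^ (2 * m) *
          (sqInt M.activeDomain u + ∑ I : Fin m → Fin d, sqInt M.activeDomain (weakPartial W u I)) := by
        rw [← Finset.mul_sum, Finset.sum_add_distrib, Finset.sum_comm,
          sqInt_activeDomain_eq_sum_aggregate A (hcell hu.1)]
        congr 2
        exact Finset.sum_congr rfl fun I _ =>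
          (sqInt_activeDomain_eq_sum_aggregate A (hcell (hspec I).1)).symm
    _ ≤ (∑ m ∈ Finset.range (k + 2), C m) * M.meshSize ^ (2 * m) *
          (2 * sobolevNorm m W u ^ 2) := by
        have h0 := M.meshSize_nonneg
        have h1 := hu.sqInt_add_sum_le hW hMW
        have h2 := (hC m).le.trans hCm
        have h3 : 0 ≤ sqInt M.activeDomain u +
            ∑ I : Fin m → Fin d, sqInt M.activeDomain (weakPartial W u I) :=
          add_nonneg (sqInt_nonneg _ _) (Finset.sum_nonneg fun _ _ => sqInt_nonneg _ _)
        gcongr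
    _ = _ := by ring

variable {F : Type*} [NormedAddCommGroup F] [InnerProductSpace ℝ F] [FiniteDimensional ℝ F]
variable {M : UnfittedMesh d} {A : M.Aggregation} {V : Submodule ℝ (Pt d → F)} {l : ℕ}

theorem normEquivalence_bulkStab (hV : V ≤ polyF d F l) {Vh : Set (Pt d → F)}
    (hVh : ∀ v ∈ Vh, IsPiecewise M V v) {C : ℝ} (hC0 : 0 < C)
    (hC : ∀ R ∈ M.interiorCells, ∀ f ∈ polyF d F l, sqInt (A.aggregate R) f ≤ C * sqInt R f)
    (κ : BulkOperator) {D : ℝ} (hD : 3 + 4 * C + 4 * C ^ 2 ≤ D) :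
    NormEquivalence M Vh (bulkStab A V κ) D := by
  intro w hw
  rw [l2Norm_sq, l2Norm_sq, bulkStab_self]
  have hp := hVh w hw
  have h1 := sqInt_mono (memL2_activeDomain fun T hT => hp.memL2 hV hT)
    domain_subset_activeDomain
  have h2 := sqInt_cutDomain_sub_bulkOp_le_activeDomain hV hp hC0 hC κ
  have h3 := sqInt_activeDomain_le hV hp hC0 hC κ
  have h4 := sqInt_nonneg M.domain w
  have h5 := sqInt_nonneg M.activeDomain w
  have h6 := sqInt_nonneg M.cutDomain (fun x => w x - bulkOp A V κ w x)
  constructor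
  · nlinarith [mul_le_mul_of_nonneg_right hD h5, mul_nonneg (sq_nonneg C) h5,
      mul_nonneg hC0.le h5]
  · nlinarith [mul_le_mul_of_nonneg_right hD h4, mul_le_mul_of_nonneg_right hD h6,
      mul_nonneg (sq_nonneg C) h4, mul_nonneg hC0.le h6]

/-- Cauchy–Schwarz separates the residuals. That of `v` is bounded by stability; that of `P w` by
quasi-optimality, with the error split as `P w - w` and `w - q`. -/
theorem weakConsistency_bulkStab {k : ℕ} (hkV : polyF d F k ≤ V) (hV : V ≤ polyF d F l)
    {Vh : Set (Pt d → F)} (hVh : ∀ v ∈ Vh, IsPiecewise M V v) {C : ℝ} (hC0 : 0 < C)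
    (hC : ∀ R ∈ M.interiorCells, ∀ f ∈ polyF d F l, sqInt (A.aggregate R) f ≤ C * sqInt R f)
    {W : Set (Pt d)} (hMW : M.activeDomain ⊆ W) {B : ℝ} (hB0 : 0 < B)
    (hB : ∀ m ≤ k + 1, ∀ u : Pt d → F, MemSobolev m W u → ∃ q : Set (Pt d) → Pt d → F,
      (∀ R ∈ M.interiorCells, q R ∈ polyF d F k) ∧
      ∑ R ∈ M.interiorCells, sqInt (A.aggregate R) (fun x => u x - q R x) ≤
        B * (M.meshSize ^ m * sobolevNorm m W u) ^ 2)
    (κ : BulkOperator) {c : ℝ} {P : (Pt d → F) → (Pt d → F)}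
    (hP : IsInterpolator M.activeDomain Vh k M.meshSize c P) {D : ℝ}
    (hD : ((2 + 2 * C) * (2 * c ^ 2 + 2 * B) + 1) * (2 + 2 * C + 1) ≤ D) :
    WeakConsistency M W Vh k P (bulkStab A V κ) D := by
  intro m hm w hw v hv
  have hwA := hw.1.mono hMW
  have hPw := hVh _ (hP.1 w hwA)
  have hvp := hVh v hv
  obtain ⟨q, hq, hsum⟩ := hB m hm w hw
  set y := M.meshSize ^ m * sobolevNorm m W w with hy
  have hy0 : 0 ≤ y := mul_nonneg (pow_nonneg M.meshSize_nonneg m) (sobolevNorm_nonneg _ _ _)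
  have hcells : ∀ T ∈ M.active, MemL2 T (fun x => P w x - w x) := fun T hT =>
    (hPw.memL2 hV hT).sub (memL2_of_activeDomain hwA hT)
  have hint : sqInt M.activeDomain (fun x => P w x - w x) ≤ c ^ 2 * y ^ 2 := by
    rw [sqInt_sub_comm, ← l2Norm_sq, ← mul_pow, ← sq_abs (c * y), abs_mul, abs_of_nonneg hy0]
    refine pow_le_pow_left₀ (l2Norm_nonneg _ _) ((hP.2 m hm w (hw.mono hMW)).trans ?_) 2
    rw [mul_assoc]
    have h1 := hw.sobolevNorm_mono M.isOpen_activeDomain hMW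
    have h2 : M.meshSize ^ m * sobolevNorm m M.activeDomain w ≤ y :=
      mul_le_mul_of_nonneg_left h1 (pow_nonneg M.meshSize_nonneg m)
    refine (mul_le_mul_of_nonneg_right (le_abs_self c) ?_).trans
      (mul_le_mul_of_nonneg_left h2 (abs_nonneg c))
    exact mul_nonneg (pow_nonneg M.meshSize_nonneg m) (sobolevNorm_nonneg _ _ _)
  rw [sqInt_activeDomain_eq_sum_aggregate A hcells] at hint
  have htri : ∑ R ∈ M.interiorCells, sqInt (A.aggregate R) (fun x => P w x - q R x) ≤
      2 * ∑ R ∈ M.interiorCells, sqInt (A.aggregate R) (fun x => P w x - w x) +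
        2 * ∑ R ∈ M.interiorCells, sqInt (A.aggregate R) (fun x => w x - q R x) := by
    rw [Finset.mul_sum, Finset.mul_sum, ← Finset.sum_add_distrib]
    refine Finset.sum_le_sum fun R hR => ?_
    have hwR : MemL2 (A.aggregate R) w := memL2_aggregate fun T hT =>
      memL2_of_activeDomain hwA (aggregateCells_subset hT)
    exact sqInt_sub_le ((hPw.memL2_aggregate hV A R).sub hwR)
      (hwR.sub (memL2_of_mem_polyF (hq R hR) (isBounded_aggregate R)))
  have h1 : l2Norm M.cutDomain (fun x => P w x - bulkOp A V κ (P w) x) ≤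
      ((2 + 2 * C) * (2 * c ^ 2 + 2 * B) + 1) * y := by
    refine le_mul_of_sq_le (by positivity) hy0 ?_
    rw [l2Norm_sq, mul_assoc]
    refine (sqInt_cutDomain_sub_bulkOp_le hV hPw hC0 hC κ fun R hR => hkV (hq R hR)).trans ?_
    gcongr
    linarith
  have h2 : l2Norm M.cutDomain (fun x => v x - bulkOp A V κ v x) ≤
      (2 + 2 * C + 1) * l2Norm M.activeDomain v := by
    refine le_mul_of_sq_le (by positivity) (l2Norm_nonneg _ _) ?_
    rw [l2Norm_sq, l2Norm_sq]
    exact sqInt_cutDomain_sub_bulkOp_le_activeDomain hV hvp hC0 hC κ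
  have hv0 := l2Norm_nonneg M.activeDomain v
  calc bulkStab A V κ (P w) v
      ≤ (((2 + 2 * C) * (2 * c ^ 2 + 2 * B) + 1) * y) *
          ((2 + 2 * C + 1) * l2Norm M.activeDomain v) :=
        (le_abs_self _).trans ((abs_bulkStab_le A hV hPw hvp κ).trans
          (mul_le_mul h1 h2 (l2Norm_nonneg _ _) (by positivity)))
    _ = (((2 + 2 * C) * (2 * c ^ 2 + 2 * B) + 1) * (2 + 2 * C + 1)) *
          (y * l2Norm M.activeDomain v) := by ring
    _ ≤ D * (y * l2Norm M.activeDomain v) := by gcongr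
    _ = _ := by rw [hy]; ring

/-- Gluing one approximating polynomial per aggregate gives an element of the kernel. The glued
function may jump between aggregates, which is harmless because the space imposes no continuity
across cells. -/
theorem kernelApproximation_bulkStab {k : ℕ} (hkV : polyF d F k ≤ V) (hV : V ≤ polyF d F l)
    {C : ℝ} (hC0 : 0 < C)
    (hC : ∀ R ∈ M.interiorCells, ∀ f ∈ polyF d F l, sqInt (A.aggregate R) f ≤ C * sqInt R f)
    {W : Set (Pt d)} (hMW : M.activeDomain ⊆ W) {B : ℝ} (hB0 : 0 < B)
    (hB : ∀ m ≤ k + 1, ∀ u : Pt d → F, MemSobolev m W u → ∃ q : Set (Pt d) → Pt d → F,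
      (∀ R ∈ M.interiorCells, q R ∈ polyF d F k) ∧
      ∑ R ∈ M.interiorCells, sqInt (A.aggregate R) (fun x => u x - q R x) ≤
        B * (M.meshSize ^ m * sobolevNorm m W u) ^ 2)
    (κ : BulkOperator) {D : ℝ} (hD : B + 1 ≤ D) :
    KernelApproximation M W {v | IsPiecewise M V v} k (bulkStab A V κ) D := by
  intro m hm r hr
  obtain ⟨q, hq, hsum⟩ := hB m hm r hr
  obtain ⟨w, hw⟩ := exists_aggregatewise A q
  have hwp : IsPiecewise M V w := fun T hT =>
    ⟨_, hkV (hq _ (A.root_mem T hT)), hw _ T (mem_aggregateCells_root hT)⟩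
  have hrT : ∀ T ∈ M.active, MemL2 T r := fun T hT => memL2_of_activeDomain (hr.1.mono hMW) hT
  have hcells : ∀ T ∈ M.active, MemL2 T (fun x => r x - w x) := fun T hT =>
    (hrT T hT).sub (hwp.memL2 hV hT)
  refine ⟨w, ⟨hwp, fun φ hφ => bulkStab_eq_zero hV hwp hφ hC0 hC κ (fun R hR => hkV (hq R hR))
    fun R _ => hw R⟩, ?_⟩
  have hy0 : 0 ≤ M.meshSize ^ m * sobolevNorm m W r :=
    mul_nonneg (pow_nonneg M.meshSize_nonneg m) (sobolevNorm_nonneg _ _ _)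
  rw [mul_assoc]
  refine (le_mul_of_sq_le hB0.le hy0 ?_).trans (mul_le_mul_of_nonneg_right hD hy0)
  rw [l2Norm_sq, sqInt_activeDomain_eq_sum_aggregate A hcells]
  refine le_trans (le_of_eq (Finset.sum_congr rfl fun R hR => ?_)) hsum
  rw [sqInt_aggregate fun T hT => hcells T (aggregateCells_subset hT), sqInt_aggregate fun T hT =>
    (hrT T (aggregateCells_subset hT)).sub (memL2_of_mem_polyF (hq R hR)
      (isCell_of_mem_active (aggregateCells_subset hT)).isBounded)]
  exact Finset.sum_congr rfl fun T hT => sqInt_congr ((hw R T hT).mono fun x hx => by simp only [hx])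

/-- Allowing every `D ≥ C` lets the flux and pressure constants be merged into one. -/
theorem exists_stabilisation_constant (hd : 1 ≤ d) {k : ℕ} (hkV : polyF d F k ≤ V)
    (hV : V ≤ polyF d F l) {ρ : ℝ} (hρ : 0 < ρ) (K c : ℝ) :
    ∃ C : ℝ, 0 < C ∧ ∀ D ≥ C, ∀ (M : UnfittedMesh d) (A : M.Aggregation),
      M.IsRegular ρ → A.IsBounded K →
      ∀ W : Set (Pt d), IsOpen W → M.activeDomain ⊆ W → ∀ κ : BulkOperator,
        (∀ Vh : Set (Pt d → F), (∀ v ∈ Vh, IsPiecewise M V v) →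
          NormEquivalence M Vh (bulkStab A V κ) D ∧
          ∀ P : (Pt d → F) → (Pt d → F), IsInterpolator M.activeDomain Vh k M.meshSize c P →
            WeakConsistency M W Vh k P (bulkStab A V κ) D) ∧
        (∀ p ∈ V, ∀ v, IsPiecewise M V v → bulkStab A V κ p v = 0) ∧
        KernelApproximation M W {v | IsPiecewise M V v} k (bulkStab A V κ) D := by
  obtain ⟨C, hC0, hC⟩ := exists_aggregate_bound hd F l hρ K
  obtain ⟨B, hB0, hB⟩ := exists_aggregatewise_approx hd F k hρ K
  set C₁ := 3 + 4 * C + 4 * C ^ 2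
  set C₂ := ((2 + 2 * C) * (2 * c ^ 2 + 2 * B) + 1) * (2 + 2 * C + 1)
  have h1 : 0 < C₁ := by positivity
  have h2 : 0 < C₂ := by positivity
  refine ⟨C₁ + C₂ + (B + 1), by positivity, fun D hD M A hM hA W hW hMW κ => ?_⟩
  have hC' := hC M A hM hA
  have hB' := hB M A hM hA W hW hMW
  refine ⟨fun Vh hVh => ⟨?_, fun P hP => ?_⟩, fun p hp v hv => ?_, ?_⟩
  · exact normEquivalence_bulkStab hV hVh hC0 hC' κ (by linarith)
  · exact weakConsistency_bulkStab hkV hV hVh hC0 hC' hMW hB0 hB' κ hP (by linarith)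
  · exact bulkStab_eq_zero hV (fun _ _ => ⟨p, hp, Filter.EventuallyEq.rfl⟩) hv hC0 hC' κ
      (q := fun _ => p) (fun _ _ => hp) fun _ _ _ _ => Filter.EventuallyEq.rfl
  · exact kernelApproximation_bulkStab hkV hV hC0 hC' hMW hB0 hB' κ (by linarith)

end Stability

end UnfittedFE

end

theorem mainTheorem5 (d : ℕ) (hd : 1 ≤ d)
    (Vd : Submodule ℝ (UnfittedFE.Pt d → UnfittedFE.Pt d))
    (V0 : Submodule ℝ (UnfittedFE.Pt d → ℝ))
    (hVd : ∃ m, Vd ≤ UnfittedFE.polyVector d m)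
    (hV0 : ∃ m, V0 ≤ UnfittedFE.polyScalar d m)
    (ku kp : ℕ)
    (hku : IsGreatest {k | UnfittedFE.polyVector d k ≤ Vd} ku)
    (hkp : IsGreatest {k | UnfittedFE.polyScalar d k ≤ V0} kp)
    (ρ K c : ℝ) (hρ : 0 < ρ) :
    ∃ C : ℝ, 0 < C ∧
      ∀ (M : UnfittedFE.UnfittedMesh d) (A : M.Aggregation),
        M.IsRegular ρ → A.IsBounded K →
      ∀ Ωext : Set (UnfittedFE.Pt d), IsOpen Ωext → M.activeDomain ⊆ Ωext →
      ∀ κd κ0 : UnfittedFE.BulkOperator,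
        UnfittedFE.NormEquivalence M (UnfittedFE.fluxSpace M Vd)
          (UnfittedFE.bulkStab A Vd κd) C ∧
        UnfittedFE.NormEquivalence M (UnfittedFE.pressureSpace M V0)
          (UnfittedFE.bulkStab A V0 κ0) C ∧
        (∀ Pd : (UnfittedFE.Pt d → UnfittedFE.Pt d) → (UnfittedFE.Pt d → UnfittedFE.Pt d),
          UnfittedFE.IsInterpolator M.activeDomain (UnfittedFE.fluxSpace M Vd) ku M.meshSize c Pd →
          UnfittedFE.WeakConsistency M Ωext (UnfittedFE.fluxSpace M Vd) ku Pd
            (UnfittedFE.bulkStab A Vd κd) C) ∧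
        (∀ P0 : (UnfittedFE.Pt d → ℝ) → (UnfittedFE.Pt d → ℝ),
          UnfittedFE.IsInterpolator M.activeDomain (UnfittedFE.pressureSpace M V0) kp
            M.meshSize c P0 →
          UnfittedFE.WeakConsistency M Ωext (UnfittedFE.pressureSpace M V0) kp P0
            (UnfittedFE.bulkStab A V0 κ0) C) ∧
        (∀ a : ℝ, ∀ q ∈ UnfittedFE.pressureSpace M V0,
          UnfittedFE.bulkStab A V0 κ0 (fun _ => a) q = 0) ∧
        UnfittedFE.KernelApproximation M Ωext (UnfittedFE.pressureSpace M V0) kp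
          (UnfittedFE.bulkStab A V0 κ0) C := by
  obtain ⟨md, hVd⟩ := hVd
  obtain ⟨m0, hV0⟩ := hV0
  have hkd := hku.1
  have hk0 := hkp.1
  rw [Set.mem_ofPred_eq, ← UnfittedFE.polyF_euclidean] at hkd
  rw [Set.mem_ofPred_eq, ← UnfittedFE.polyF_real] at hk0
  rw [← UnfittedFE.polyF_euclidean] at hVd
  rw [← UnfittedFE.polyF_real] at hV0
  obtain ⟨Cd, hCd0, hCd⟩ := UnfittedFE.exists_stabilisation_constant hd hkd hVd hρ K c
  obtain ⟨C0, hC00, hC0⟩ := UnfittedFE.exists_stabilisation_constant hd hk0 hV0 hρ K c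
  -- The sum dominates both constants. Fluxes use only the second component of membership in
  -- `fluxSpace`, and `pressureSpace` is by definition the full piecewise space.
  refine ⟨Cd + C0, add_pos hCd0 hC00, fun M A hM hA W hW hMW κd κ0 => ?_⟩
  obtain ⟨hd1, -, -⟩ := hCd (Cd + C0) (by linarith) M A hM hA W hW hMW κd
  obtain ⟨h01, h02, h03⟩ := hC0 (Cd + C0) (by linarith) M A hM hA W hW hMW κ0
  obtain ⟨hdn, hdw⟩ := hd1 (UnfittedFE.fluxSpace M Vd) fun v hv => hv.2
  obtain ⟨h0n, h0w⟩ := h01 (UnfittedFE.pressureSpace M V0) fun v hv => hv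
  refine ⟨hdn, h0n, hdw, h0w, fun a q hq => h02 _ (hk0 ?_) q hq, h03⟩
  rw [UnfittedFE.polyF_real]
  exact UnfittedFE.const_mem_polyScalar kp a
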